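/- Let $k$ be a field of characteristic $0$. A Lie coalgebra $L$ over $k$ is a vector space with a map $\Delta\colon L\to L\otimes L$ whose image lies in the skew-symmetric tensors and which satisfies the co-Jacobi identity $(1+\xi+\xi^2)(\mathrm{id}\otimes\Delta)\Delta=0$, where $\xi$ is the cyclic permutation of $L^{\otimes 3}$. It is conilpotent if there is an increasing exhaustive filtration $0=F_0L\subseteq F_1L\subseteq\cdots$ with $\Delta(F_iL)\subseteq\sum_{p+q=i}F_pL\otimes F_qL$. Its Chevalley–Eilenberg algebra $C(L)$ is the exterior algebra $\Lambda L$, with $C^n(L)=\Lambda^nL$ and the derivation differential extending $\Delta\colon L\to\Lambda^2L$; $C^{>0}(L)$ is its augmentation ideal, a non-unital dg algebra. An $A_\infty$-algebra is a $\mathbb Z$-graded vector space $A$ with a square-zero coderivation $d$ of degree $1$, vanishing on the coaugmentation, of the tensor coalgebra $\mathrm{Bar}\,A=\bigoplus_{i\ge0}A[1]^{\otimes i}$; its components $A[1]^{\otimes n}\to A[1]$ are the operations $m_n$. Morphisms are morphisms of dg coalgebras of bar constructions; a morphism is a quasi-isomorphism if its linear component is a quasi-isomorphism for $m_1$, and two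 $A_\infty$-algebras are quasi-isomorphic if a zigzag of quasi-isomorphisms joins them. A dg algebra is an $A_\infty$-algebra via its bar construction. Put $F_n\mathrm{Bar}\,A=\bigoplus_{i\le n}A[1]^{\otimes i}$. $A$ is minimal if $d$ induces zero on $\mathrm{gr}_F\mathrm{Bar}\,A$ (i.e. $m_1=0$). A minimal $A$ is 1-generated if $A^n=0$ for $n\le0$ and, for all $j\ge1$, $F_1H^j(\mathrm{Bar}\,A)=0$, where $F_1H^j$ is the space of classes represented by cocycles in $F_1\mathrm{Bar}\,A$. **Theorem.** (a) Let $L$ be a conilpotent Lie coalgebra over $k$ and let $H$ be a minimal $A_\infty$-algebra quasi-isomorphic to $C^{>0}(L)$. Then $H$ is 1-generated; moreover, the smallest subspace of $H$ which contains $H^1$ and is closed under all operations $m_n$ is $H$ itself. (b) The same conclusions hold for every minimal $A_\infty$-algebra $H$ quasi-isomorphic to the reduced Chevalley–Eilenberg cochain algebra $C^{>0}(\mathfrak g^*)$ of a finite-dimensional nilpotent Lie algebra $\mathfrak g$ over $k$, where $\mathfrak g^*$ is the Lie coalgebra with $(\Delta\xi)(x,y)=\xi([x,y])$. (c) The same conclusions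 hold for every minimal $A_\infty$-algebra $H$ quasi-isomorphic to the reduced algebra of continuous cochains $C^{>0}(\mathfrak g')$ of a pro-nilpotent Lie algebra $\mathfrak g$ over $k$, i.e. a topological Lie algebra which is a projective limit of discrete finite-dimensional nilpotent Lie algebras; here $\mathfrak g'$ is the Lie coalgebra of continuous linear functionals on $\mathfrak g$ ($k$ discrete), with $(\Delta\xi)(x,y)=\xi([x,y])$. -/

import Mathlib

open scoped TensorProduct

/-! ### Graded vector spaces and the tensor coalgebra -/

section Bar

variable {k A : Type*} [Field k] [AddCommGroup A] [Module k A]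

/-- The sign operator `a ↦ (-1)^(n-1) a` for `a` of degree `n`, i.e. the parity operator of the
shifted graded space `A[1]`. -/
noncomputable def shiftSign (deg : ℤ → Submodule k A) (h : DirectSum.IsInternal deg) :
    A →ₗ[k] A :=
  (DirectSum.toModule k ℤ A
      (fun n => (((n - 1).negOnePow : ℤˣ) : ℤ) • (deg n).subtype)) ∘ₗ
    (LinearEquiv.ofBijective (DirectSum.coeLinearMap deg) h).symm.toLinearMap

theorem shiftSign_apply {deg : ℤ → Submodule k A} (h : DirectSum.IsInternal deg) {n : ℤ} {a : A}
    (ha : a ∈ deg n) : shiftSign deg h a = (((n - 1).negOnePow : ℤˣ) : ℤ) • a := by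
  have : (LinearEquiv.ofBijective (DirectSum.coeLinearMap deg) h).symm a =
      DirectSum.lof k ℤ (fun n => deg n) n ⟨a, ha⟩ := by
    rw [LinearEquiv.symm_apply_eq]
    exact (DirectSum.coeLinearMap_lof deg n (⟨a, ha⟩ : deg n)).symm
  simp only [shiftSign, LinearMap.comp_apply, LinearEquiv.coe_coe, this, DirectSum.toModule_lof]
  simp

/-- Two linear maps on a graded space agree if they agree on homogeneous elements. -/
theorem ext_homogeneous {B : Type*} [AddCommGroup B] [Module k B] {deg : ℤ → Submodule k A}
    (h : DirectSum.IsInternal deg) {f g : A →ₗ[k] B}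
    (hfg : ∀ n, ∀ a ∈ deg n, f a = g a) : f = g := by
  have : (⨆ n, deg n) ≤ LinearMap.eqLocus f g := iSup_le fun n a ha => hfg n a ha
  rw [h.submodule_iSup_eq_top] at this
  ext a
  exact this (Submodule.mem_top (x := a))

/-- A linear identity on the tensor algebra may be proved by induction on words. -/
theorem TensorAlgebra.ext_word {B : Type*} [AddCommGroup B] [Module k B]
    {f g : TensorAlgebra k A →ₗ[k] B} (h1 : f 1 = g 1)
    (hs : ∀ v w, f w = g w → f (TensorAlgebra.ι k v * w) = g (TensorAlgebra.ι k v * w)) :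
    f = g := by
  have key : ∀ a : TensorAlgebra k A, ∀ w, f w = g w → f (a * w) = g (a * w) := by
    intro a
    induction a using TensorAlgebra.induction with
    | algebraMap r =>
      intro w hw
      rw [Algebra.algebraMap_eq_smul_one, smul_one_mul, map_smul, map_smul, hw]
    | ι v => exact hs v
    | mul a b ha hb => intro w hw; rw [mul_assoc]; exact ha _ (hb _ hw)
    | add a b ha hb => intro w hw; rw [add_mul, map_add, map_add, ha _ hw, hb _ hw]
  ext a
  simpa using key a 1 h1

/-- One step of the recursion defining `deconcat`. -/
noncomputable def deconcatStep :
    A →ₗ[k] Module.End k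
      (TensorAlgebra k A × (TensorAlgebra k A ⊗[k] TensorAlgebra k A)) :=
  LinearMap.mk₂ k
    (fun v p => (TensorAlgebra.ι k v * p.1,
      1 ⊗ₜ (TensorAlgebra.ι k v * p.1) + (TensorAlgebra.ι k v ⊗ₜ 1) * p.2))
    (by intros; ext <;> simp [add_mul, TensorProduct.tmul_add, TensorProduct.add_tmul]; abel)
    (by intros; ext <;> simp [← TensorProduct.smul_tmul', smul_add])
    (by intros; ext <;> simp [mul_add, TensorProduct.tmul_add]; abel)
    (by intros; ext <;> simp [smul_add])

theorem deconcatStep_apply (v : A) (p) :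
    deconcatStep (k := k) v p = (TensorAlgebra.ι k v * p.1,
      1 ⊗ₜ (TensorAlgebra.ι k v * p.1) + (TensorAlgebra.ι k v ⊗ₜ 1) * p.2) := rfl

/-- The deconcatenation coproduct of the tensor coalgebra,
`Δ(v₁ ⋯ vₙ) = ∑ᵢ (v₁ ⋯ vᵢ) ⊗ (vᵢ₊₁ ⋯ vₙ)`, characterised by `deconcat_one` and
`deconcat_ι_mul`. -/
noncomputable def deconcat :
    TensorAlgebra k A →ₗ[k] TensorAlgebra k A ⊗[k] TensorAlgebra k A :=
  LinearMap.snd k _ _ ∘ₗ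
    (LinearMap.applyₗ ((1 : TensorAlgebra k A),
      (1 : TensorAlgebra k A) ⊗ₜ[k] (1 : TensorAlgebra k A))) ∘ₗ
    (TensorAlgebra.lift k (deconcatStep (k := k) (A := A))).toLinearMap

@[simp] theorem deconcat_one :
    deconcat (1 : TensorAlgebra k A) = 1 ⊗ₜ 1 := by
  simp [deconcat]

theorem deconcat_ι_mul (v : A) (w : TensorAlgebra k A) :
    deconcat (TensorAlgebra.ι k v * w) =
      1 ⊗ₜ (TensorAlgebra.ι k v * w) + (TensorAlgebra.ι k v ⊗ₜ 1) * deconcat w := by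
  have h : ∀ w : TensorAlgebra k A,
      (TensorAlgebra.lift k (deconcatStep (k := k) (A := A)) w (1, 1 ⊗ₜ 1)).1 = w := by
    have := TensorAlgebra.ext_word (k := k) (A := A)
      (f := LinearMap.fst k _ _ ∘ₗ
        (LinearMap.applyₗ ((1 : TensorAlgebra k A),
          (1 : TensorAlgebra k A) ⊗ₜ[k] (1 : TensorAlgebra k A))) ∘ₗ
        (TensorAlgebra.lift k (deconcatStep (k := k) (A := A))).toLinearMap)
      (g := LinearMap.id) (by simp) (by
        intro v w hw
        simp only [LinearMap.comp_apply, LinearMap.applyₗ_apply_apply, AlgHom.toLinearMap_apply,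
          LinearMap.fst_apply, LinearMap.id_apply] at hw ⊢
        simp [deconcatStep_apply, hw])
    intro w
    exact LinearMap.congr_fun this w
  simp [deconcat, deconcatStep_apply, h w]

/-- The parity operator of the bar construction, for the grading of `A[1]`. -/
noncomputable def barSign (deg : ℤ → Submodule k A) (h : DirectSum.IsInternal deg) :
    TensorAlgebra k A →ₗ[k] TensorAlgebra k A :=
  (TensorAlgebra.lift k (TensorAlgebra.ι k ∘ₗ shiftSign deg h)).toLinearMap

/-- `IsBarWord deg n w`: `w` is a product `a₁ ⋯ aᵣ` (`r ≥ 0`) of homogeneous elements of `A` with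
`∑ (deg aᵢ - 1) = n`. -/
inductive IsBarWord (deg : ℤ → Submodule k A) : ℤ → TensorAlgebra k A → Prop
  | nil : IsBarWord deg 0 1
  | cons {p n : ℤ} {a : A} {w : TensorAlgebra k A} (ha : a ∈ deg p) (hw : IsBarWord deg n w) :
      IsBarWord deg (p - 1 + n) (TensorAlgebra.ι k a * w)

/-- The degree `n` part of the tensor coalgebra generated by `A[1]`. -/
def barDegree (deg : ℤ → Submodule k A) (n : ℤ) : Submodule k (TensorAlgebra k A) :=
  Submodule.span k {w | IsBarWord deg n w}

/-- The tensor filtration `F_n = ⊕_{i ≤ n} A[1]^{⊗ i}`. -/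
def barFiltration (k A : Type*) [Field k] [AddCommGroup A] [Module k A] (n : ℕ) :
    Submodule k (TensorAlgebra k A) :=
  ⨆ (i : ℕ) (_ : i ≤ n), (LinearMap.range (TensorAlgebra.ι k : A →ₗ[k] TensorAlgebra k A)) ^ i

theorem barSign_ι_mul (deg : ℤ → Submodule k A) (h : DirectSum.IsInternal deg) (v : A)
    (w : TensorAlgebra k A) :
    barSign deg h (TensorAlgebra.ι k v * w) =
      TensorAlgebra.ι k (shiftSign deg h v) * barSign deg h w := by
  simp [barSign]

theorem ι_mul_mem_barDegree {deg : ℤ → Submodule k A} {p n : ℤ} {a : A} (ha : a ∈ deg p)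
    {w : TensorAlgebra k A} (hw : w ∈ barDegree deg n) :
    TensorAlgebra.ι k a * w ∈ barDegree deg (p - 1 + n) := by
  induction hw using Submodule.span_induction with
  | mem x hx => exact Submodule.subset_span (IsBarWord.cons ha hx)
  | zero => simp
  | add x y _ _ hx hy => rw [mul_add]; exact Submodule.add_mem _ hx hy
  | smul c x _ hx => rw [mul_smul_comm]; exact Submodule.smul_mem _ c hx

/-- One step of the recursion defining `barDiff`. -/
noncomputable def barDiffStep (τ d : A →ₗ[k] A) (b : A →ₗ[k] A →ₗ[k] A) :
    A →ₗ[k] Module.End k (TensorAlgebra k A × TensorAlgebra k A × (A →ₗ[k] TensorAlgebra k A)) :=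
  LinearMap.mk₂ k
    (fun v p => (TensorAlgebra.ι k v * p.1,
      TensorAlgebra.ι k (d v) * p.1 + TensorAlgebra.ι k (τ v) * p.2.1 + p.2.2 v,
      (LinearMap.mulRight k p.1) ∘ₗ TensorAlgebra.ι k ∘ₗ b.flip v))
    (by intros; ext <;> simp [add_mul]; abel)
    (by intros; ext <;> simp [smul_add])
    (by intros; ext <;> simp [mul_add]; abel)
    (by intros; ext <;> simp [smul_add])

theorem barDiffStep_apply (τ d : A →ₗ[k] A) (b : A →ₗ[k] A →ₗ[k] A) (v : A) (p) :
    barDiffStep τ d b v p = (TensorAlgebra.ι k v * p.1,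
      TensorAlgebra.ι k (d v) * p.1 + TensorAlgebra.ι k (τ v) * p.2.1 + p.2.2 v,
      (LinearMap.mulRight k p.1) ∘ₗ TensorAlgebra.ι k ∘ₗ b.flip v) := rfl

/-- The pair of the map `barDiff` and the auxiliary map `(v, u ⋯) ↦ b(v, u) ⋯`. -/
noncomputable def barDiffAux (τ d : A →ₗ[k] A) (b : A →ₗ[k] A →ₗ[k] A) :
    TensorAlgebra k A →ₗ[k]
      (TensorAlgebra k A × TensorAlgebra k A × (A →ₗ[k] TensorAlgebra k A)) :=
  (LinearMap.applyₗ ((1 : TensorAlgebra k A), (0 : TensorAlgebra k A),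
      (0 : A →ₗ[k] TensorAlgebra k A))) ∘ₗ
    (TensorAlgebra.lift k (barDiffStep τ d b)).toLinearMap

/-- Multiplication of the first letter of a word by `v` on the left:
`barHead b v (u w) = b(v, u) w` and `barHead b v 1 = 0`. -/
noncomputable def barHead (τ d : A →ₗ[k] A) (b : A →ₗ[k] A →ₗ[k] A) (v : A) :
    TensorAlgebra k A →ₗ[k] TensorAlgebra k A :=
  LinearMap.applyₗ v ∘ₗ LinearMap.snd k _ _ ∘ₗ LinearMap.snd k _ _ ∘ₗ barDiffAux τ d b

/-- The coderivation of the tensor coalgebra with linear component `d` and quadratic component `b`: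
`v₁ ⋯ vₙ ↦ ∑ᵢ τv₁ ⋯ τvᵢ₋₁ (d vᵢ) vᵢ₊₁ ⋯ vₙ + ∑ᵢ τv₁ ⋯ τvᵢ₋₁ b(vᵢ, vᵢ₊₁) vᵢ₊₂ ⋯ vₙ`,
where `τ` is the parity operator of `A[1]`; see `barDiff_ι_mul`. -/
noncomputable def barDiff (τ d : A →ₗ[k] A) (b : A →ₗ[k] A →ₗ[k] A) :
    TensorAlgebra k A →ₗ[k] TensorAlgebra k A :=
  LinearMap.fst k _ _ ∘ₗ LinearMap.snd k _ _ ∘ₗ barDiffAux τ d b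

section barDiff

variable (τ d : A →ₗ[k] A) (b : A →ₗ[k] A →ₗ[k] A)

theorem barDiffAux_ι_mul (v : A) (w : TensorAlgebra k A) :
    barDiffAux τ d b (TensorAlgebra.ι k v * w) = barDiffStep τ d b v (barDiffAux τ d b w) := by
  simp [barDiffAux]

theorem barDiffAux_one : barDiffAux τ d b 1 = (1, 0, 0) := by
  simp [barDiffAux]

theorem barDiffAux_fst (w : TensorAlgebra k A) : (barDiffAux τ d b w).1 = w := by
  have := TensorAlgebra.ext_word (k := k) (A := A)
    (f := LinearMap.fst k _ _ ∘ₗ barDiffAux τ d b) (g := LinearMap.id)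
    (by simp [barDiffAux_one]) (by
      intro v w hw
      simp only [LinearMap.comp_apply, LinearMap.fst_apply, LinearMap.id_apply] at hw ⊢
      rw [barDiffAux_ι_mul, barDiffStep_apply, hw])
  exact LinearMap.congr_fun this w

theorem barDiff_one : barDiff τ d b 1 = 0 := by
  simp [barDiff, barDiffAux_one]

theorem barHead_one (v : A) : barHead τ d b v 1 = 0 := by
  simp [barHead, barDiffAux_one]

theorem barHead_ι_mul (v u : A) (w : TensorAlgebra k A) :
    barHead τ d b v (TensorAlgebra.ι k u * w) = TensorAlgebra.ι k (b v u) * w := by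
  simp [barHead, barDiffAux_ι_mul, barDiffStep_apply, barDiffAux_fst]

theorem barDiff_ι_mul (v : A) (w : TensorAlgebra k A) :
    barDiff τ d b (TensorAlgebra.ι k v * w) =
      TensorAlgebra.ι k (d v) * w + TensorAlgebra.ι k (τ v) * barDiff τ d b w +
        barHead τ d b v w := by
  simp [barHead, barDiff, barDiffAux_ι_mul, barDiffStep_apply, barDiffAux_fst]

theorem deconcat_barHead (v : A) (w : TensorAlgebra k A) :
    deconcat (barHead τ d b v w) =
      1 ⊗ₜ barHead τ d b v w + (barHead τ d b v).rTensor _ (deconcat w) := by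
  have := TensorAlgebra.ext_word (k := k) (A := A)
    (f := deconcat ∘ₗ barHead τ d b v)
    (g := TensorProduct.mk k _ _ 1 ∘ₗ barHead τ d b v +
      (barHead τ d b v).rTensor _ ∘ₗ deconcat)
    (by simp [barHead_one]) (by
      intro u w _
      simp only [LinearMap.comp_apply, LinearMap.add_apply, TensorProduct.mk_apply,
        barHead_ι_mul, deconcat_ι_mul, map_add, LinearMap.rTensor_tmul, barHead_one,
        TensorProduct.zero_tmul, zero_add]
      congr 1
      generalize deconcat w = z
      induction z with
      | zero => simp
      | add x y hx hy => rw [mul_add, mul_add, map_add, hx, hy]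
      | tmul x y => simp [barHead_ι_mul])
  exact LinearMap.congr_fun this w

theorem barDiff_coderivation (T : TensorAlgebra k A →ₗ[k] TensorAlgebra k A) (hT1 : T 1 = 1)
    (hT : ∀ v w, T (TensorAlgebra.ι k v * w) = TensorAlgebra.ι k (τ v) * T w) :
    deconcat ∘ₗ barDiff τ d b =
      (TensorProduct.map (barDiff τ d b) LinearMap.id + TensorProduct.map T (barDiff τ d b)) ∘ₗ
        deconcat := by
  apply TensorAlgebra.ext_word
  · simp [barDiff_one]
  · intro v w hw
    simp only [LinearMap.comp_apply] at hw ⊢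
    set E : TensorAlgebra k A ⊗[k] TensorAlgebra k A →ₗ[k]
        TensorAlgebra k A ⊗[k] TensorAlgebra k A :=
      TensorProduct.map (barDiff τ d b) LinearMap.id + TensorProduct.map T (barDiff τ d b)
      with hE
    have key : ∀ z : TensorAlgebra k A ⊗[k] TensorAlgebra k A,
        E ((TensorAlgebra.ι k v ⊗ₜ 1) * z) =
        (TensorAlgebra.ι k (d v) ⊗ₜ 1) * z + (TensorAlgebra.ι k (τ v) ⊗ₜ 1) * E z +
          (barHead τ d b v).rTensor _ z := by
      intro z
      induction z with
      | zero => simp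
      | add x y hx hy => simp only [mul_add, map_add, hx, hy]; abel
      | tmul x y =>
        simp only [hE, Algebra.TensorProduct.tmul_mul_tmul, one_mul, LinearMap.add_apply,
          TensorProduct.map_tmul, LinearMap.id_apply, barDiff_ι_mul, TensorProduct.add_tmul, hT,
          mul_add, LinearMap.rTensor_tmul]
        abel
    rw [deconcat_ι_mul, map_add, key, ← hw, barDiff_ι_mul]
    simp only [map_add, deconcat_ι_mul, deconcat_barHead, hE, LinearMap.add_apply,
      TensorProduct.map_tmul, barDiff_one, TensorProduct.zero_tmul, hT1, barDiff_ι_mul,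
      TensorProduct.tmul_add]
    abel

theorem barDiff_barDiff (hd : ∀ a, d (d a) = 0) (hτd : ∀ a, τ (d a) = - d (τ a))
    (hττ : ∀ a, τ (τ a) = a) (hτb : ∀ a c, τ (b a c) = - b (τ a) (τ c))
    (hdb : ∀ a c, d (b a c) + b (d a) c + b (τ a) (d c) = 0)
    (hbb : ∀ a c e, b (b a c) e + b (τ a) (b c e) = 0) (w : TensorAlgebra k A) :
    barDiff τ d b (barDiff τ d b w) = 0 := by
  have h3 : ∀ v u : A, ∀ w : TensorAlgebra k A,
      barHead τ d b (τ v) (barHead τ d b u w) + barHead τ d b (b v u) w = 0 := by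
    intro v u w
    have := TensorAlgebra.ext_word (k := k) (A := A)
      (f := barHead τ d b (τ v) ∘ₗ barHead τ d b u + barHead τ d b (b v u)) (g := 0)
      (by simp [barHead_one]) (by
        intro t w _
        simp only [LinearMap.add_apply, LinearMap.comp_apply, barHead_ι_mul, LinearMap.zero_apply]
        rw [← add_mul, ← map_add, add_comm, hbb]; simp)
    exact LinearMap.congr_fun this w
  have h2 : ∀ v : A, ∀ w : TensorAlgebra k A,
      barHead τ d b (d v) w + barHead τ d b (τ v) (barDiff τ d b w) +
        barDiff τ d b (barHead τ d b v w) = 0 := by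
    intro v w
    have := TensorAlgebra.ext_word (k := k) (A := A)
      (f := barHead τ d b (d v) + barHead τ d b (τ v) ∘ₗ barDiff τ d b +
        barDiff τ d b ∘ₗ barHead τ d b v) (g := 0)
      (by simp [barHead_one, barDiff_one]) (by
        intro u w _
        simp only [LinearMap.add_apply, LinearMap.comp_apply, barHead_ι_mul, LinearMap.zero_apply,
          barDiff_ι_mul, map_add]
        have e1 := h3 v u w
        have e2 : TensorAlgebra.ι k (d (b v u)) * w + TensorAlgebra.ι k (b (d v) u) * w +
            TensorAlgebra.ι k (b (τ v) (d u)) * w = 0 := by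
          rw [← add_mul, ← add_mul, ← map_add, ← map_add, hdb]; simp
        rw [hτb, map_neg, neg_mul]
        refine Eq.trans ?_ ((congrArg₂ (· + ·) e1 e2).trans (add_zero 0))
        abel)
    exact LinearMap.congr_fun this w
  have := TensorAlgebra.ext_word (k := k) (A := A)
    (f := barDiff τ d b ∘ₗ barDiff τ d b) (g := 0)
    (by simp [barDiff_one]) (by
      intro v w hw
      simp only [LinearMap.comp_apply, LinearMap.zero_apply] at hw ⊢
      simp only [barDiff_ι_mul, map_add, hw, hd, hττ, hτd, map_zero, zero_mul, mul_zero, map_neg,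
        neg_mul, zero_add, add_zero]
      rw [← h2 v w]
      abel)
  exact LinearMap.congr_fun this w

theorem barDiff_mem {deg : ℤ → Submodule k A} (hτ : ∀ n, ∀ a ∈ deg n, τ a ∈ deg n)
    (hd : ∀ n, ∀ a ∈ deg n, d a ∈ deg (n + 1))
    (hb : ∀ m n, ∀ a ∈ deg m, ∀ c ∈ deg n, b a c ∈ deg (m + n)) (n : ℤ)
    (w : TensorAlgebra k A) (hw : w ∈ barDegree deg n) :
    barDiff τ d b w ∈ barDegree deg (n + 1) := by
  have hH : ∀ {p n : ℤ} {a : A} {w : TensorAlgebra k A}, a ∈ deg p → IsBarWord deg n w →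
      barHead τ d b a w ∈ barDegree deg (p - 1 + n + 1) := by
    intro p n a w ha hw
    cases hw with
    | nil => simp [barHead_one]
    | @cons q m c w hc hw =>
      rw [barHead_ι_mul]
      have := ι_mul_mem_barDegree (hb p q a ha c hc) (Submodule.subset_span hw)
      rwa [show p - 1 + (q - 1 + m) + 1 = p + q - 1 + m by ring]
  induction hw using Submodule.span_induction with
  | zero => simp
  | add x y _ _ hx hy => rw [map_add]; exact Submodule.add_mem _ hx hy
  | smul c x _ hx => rw [map_smul]; exact Submodule.smul_mem _ c hx
  | mem x hx =>
    replace hx : IsBarWord deg n x := hx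
    induction hx with
    | nil => simp [barDiff_one]
    | @cons p n a w ha hw ih =>
      rw [barDiff_ι_mul]
      refine Submodule.add_mem _ (Submodule.add_mem _ ?_ ?_) (hH ha hw)
      · have := ι_mul_mem_barDegree (hd p a ha) (Submodule.subset_span hw)
        rwa [show p - 1 + n + 1 = p + 1 - 1 + n by ring]
      · have := ι_mul_mem_barDegree (hτ p a ha) ih
        rwa [show p - 1 + n + 1 = p - 1 + (n + 1) by ring]

end barDiff

end Bar

/-! ### A-infinity algebras -/

/-- An A-infinity algebra over `k`: a graded vector space `A` with a square-zero coderivation `D`,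
of degree one and vanishing on the coaugmentation, of the tensor coalgebra generated by `A[1]`
(the bar construction of `A`). -/
structure AInfinityAlgebra.{u, v} (k : Type u) [Field k] where
  carrier : Type v
  [addCommGroup : AddCommGroup carrier]
  [module : Module k carrier]
  deg : ℤ → Submodule k carrier
  isInternal : DirectSum.IsInternal deg
  D : TensorAlgebra k carrier →ₗ[k] TensorAlgebra k carrier
  D_one : D 1 = 0
  D_mem : ∀ n, ∀ w ∈ barDegree deg n, D w ∈ barDegree deg (n + 1)
  coderivation : deconcat ∘ₗ D =
    (TensorProduct.map D LinearMap.id + TensorProduct.map (barSign deg isInternal) D) ∘ₗ deconcat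
  D_D : ∀ w, D (D w) = 0

namespace AInfinityAlgebra

universe u v

variable {k : Type u} [Field k]

attribute [instance] AInfinityAlgebra.addCommGroup AInfinityAlgebra.module

/-- The Taylor components `A[1]^{⊗ n} → A[1]` of the codifferential, i.e. the operations `mₙ`
written in terms of `A[1]`. -/
noncomputable def taylor (A : AInfinityAlgebra.{u, v} k) (n : ℕ) :
    MultilinearMap k (fun _ : Fin n => A.carrier) A.carrier :=
  (TensorAlgebra.ιInv ∘ₗ A.D).compMultilinearMap (TensorAlgebra.tprod k A.carrier n)

/-- The linear operation `m₁`, a differential on `A`. -/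
noncomputable def m₁ (A : AInfinityAlgebra.{u, v} k) : A.carrier →ₗ[k] A.carrier :=
  TensorAlgebra.ιInv ∘ₗ A.D ∘ₗ TensorAlgebra.ι k

/-- The differential induced on the associated graded of the tensor filtration is zero. -/
def IsMinimal (A : AInfinityAlgebra.{u, v} k) : Prop :=
  ∀ n, ∀ w ∈ barFiltration k A.carrier (n + 1), A.D w ∈ barFiltration k A.carrier n

/-- A morphism of A-infinity algebras: a morphism of dg coalgebras of bar constructions. -/
structure Hom (A B : AInfinityAlgebra.{u, v} k) where
  toFun : TensorAlgebra k A.carrier →ₗ[k] TensorAlgebra k B.carrier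
  map_mem : ∀ n, ∀ w ∈ barDegree A.deg n, toFun w ∈ barDegree B.deg n
  comul : deconcat ∘ₗ toFun = TensorProduct.map toFun toFun ∘ₗ deconcat
  counit : ∀ w, TensorAlgebra.algebraMapInv (toFun w) = TensorAlgebra.algebraMapInv w
  map_one : toFun 1 = 1
  map_D : ∀ w, toFun (A.D w) = B.D (toFun w)

/-- The linear Taylor component of a morphism. -/
noncomputable def Hom.f₁ {A B : AInfinityAlgebra.{u, v} k} (f : Hom A B) :
    A.carrier →ₗ[k] B.carrier :=
  TensorAlgebra.ιInv ∘ₗ f.toFun ∘ₗ TensorAlgebra.ι k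

/-- A morphism is a quasi-isomorphism if its linear component induces a bijection on the
cohomology of `m₁`. The two conditions are injectivity and surjectivity on cohomology. -/
def Hom.IsQuasiIso {A B : AInfinityAlgebra.{u, v} k} (f : Hom A B) : Prop :=
  (∀ a, A.m₁ a = 0 → f.f₁ a ∈ LinearMap.range B.m₁ → a ∈ LinearMap.range A.m₁) ∧
  (∀ b, B.m₁ b = 0 → ∃ a, A.m₁ a = 0 ∧ f.f₁ a - b ∈ LinearMap.range B.m₁)

/-- Two A-infinity algebras are quasi-isomorphic if they are joined by a zigzag of
quasi-isomorphisms. -/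
def QuasiIsomorphic : AInfinityAlgebra.{u, v} k → AInfinityAlgebra.{u, v} k → Prop :=
  Relation.EqvGen fun A B => ∃ f : Hom A B, f.IsQuasiIso

/-- `A` is concentrated in positive degrees, and for `j ≥ 1` every cocycle of degree `j` of the bar
construction which lies in the step `F_1` of the tensor filtration is a coboundary, that is,
`F_1 H^j(Bar A) = 0`. -/
def IsOneGenerated (A : AInfinityAlgebra.{u, v} k) : Prop :=
  (∀ n ≤ 0, A.deg n = ⊥) ∧
  ∀ j : ℤ, 1 ≤ j → ∀ w ∈ barFiltration k A.carrier 1 ⊓ barDegree A.deg j, A.D w = 0 →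
    ∃ y ∈ barDegree A.deg (j - 1), A.D y = w

/-- The smallest subspace of `A` which contains `S` and is closed under all operations `mₙ`. -/
def generated (A : AInfinityAlgebra.{u, v} k) (S : Submodule k A.carrier) :
    Submodule k A.carrier :=
  sInf {W | S ≤ W ∧ ∀ (n : ℕ) (a : Fin n → A.carrier), (∀ i, a i ∈ W) → A.taylor n a ∈ W}

/-- Every element is a linear combination of iterated operations applied to elements of degree
one. -/
def IsGeneratedInDegreeOne (A : AInfinityAlgebra.{u, v} k) : Prop :=
  A.generated (A.deg 1) = ⊤

end AInfinityAlgebra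

/-! ### Differential graded algebras -/

/-- A dg algebra over `k`, associative but not necessarily unital. -/
structure NonUnitalDGAlgebra.{u, v} (k : Type u) [Field k] where
  carrier : Type v
  [addCommGroup : AddCommGroup carrier]
  [module : Module k carrier]
  deg : ℤ → Submodule k carrier
  isInternal : DirectSum.IsInternal deg
  mul : carrier →ₗ[k] carrier →ₗ[k] carrier
  mul_assoc : ∀ a b c, mul (mul a b) c = mul a (mul b c)
  mul_mem : ∀ m n, ∀ a ∈ deg m, ∀ b ∈ deg n, mul a b ∈ deg (m + n)
  d : carrier →ₗ[k] carrier
  d_mem : ∀ n, ∀ a ∈ deg n, d a ∈ deg (n + 1)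
  d_d : ∀ a, d (d a) = 0
  leibniz : ∀ n, ∀ a ∈ deg n, ∀ b,
    d (mul a b) = mul (d a) b + ((n.negOnePow : ℤˣ) : ℤ) • mul a (d b)

namespace NonUnitalDGAlgebra

universe u v

variable {k : Type u} [Field k] (A : NonUnitalDGAlgebra.{u, v} k)

attribute [instance] NonUnitalDGAlgebra.addCommGroup NonUnitalDGAlgebra.module

/-- The parity operator of `A[1]`. -/
noncomputable def sign : A.carrier →ₗ[k] A.carrier := shiftSign A.deg A.isInternal

/-- The product as an operation on `A[1]`: `(a, b) ↦ (-1)^|a| a b`. -/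
noncomputable def shiftedMul : A.carrier →ₗ[k] A.carrier →ₗ[k] A.carrier :=
  -(A.mul ∘ₗ A.sign)

theorem sign_apply {n : ℤ} {a : A.carrier} (ha : a ∈ A.deg n) :
    A.sign a = -(((n.negOnePow : ℤˣ) : ℤ) • a) := by
  rw [sign, shiftSign_apply A.isInternal ha, Int.negOnePow_sub, Int.negOnePow_one]
  simp

theorem shiftedMul_apply {n : ℤ} {a : A.carrier} (ha : a ∈ A.deg n) (b : A.carrier) :
    A.shiftedMul a b = ((n.negOnePow : ℤˣ) : ℤ) • A.mul a b := by
  simp only [shiftedMul, LinearMap.neg_apply, LinearMap.comp_apply, A.sign_apply ha, map_neg,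
    neg_neg, map_zsmul, LinearMap.smul_apply]

theorem negOnePow_smul_smul (n : ℤ) {M : Type*} [AddCommGroup M] (a : M) :
    ((n.negOnePow : ℤˣ) : ℤ) • ((n.negOnePow : ℤˣ) : ℤ) • a = a := by
  rw [smul_smul, ← Units.val_mul, Int.units_mul_self]; simp

theorem sign_mem (n : ℤ) (a : A.carrier) (ha : a ∈ A.deg n) : A.sign a ∈ A.deg n := by
  rw [A.sign_apply ha]
  exact neg_mem (zsmul_mem ha _)

theorem shiftedMul_mem (m n : ℤ) (a : A.carrier) (ha : a ∈ A.deg m) (b : A.carrier)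
    (hb : b ∈ A.deg n) : A.shiftedMul a b ∈ A.deg (m + n) := by
  rw [A.shiftedMul_apply ha]
  exact zsmul_mem (A.mul_mem m n a ha b hb) _

theorem sign_d (a : A.carrier) : A.sign (A.d a) = - A.d (A.sign a) := by
  have := ext_homogeneous A.isInternal (f := A.sign ∘ₗ A.d) (g := -(A.d ∘ₗ A.sign)) (by
    intro n a ha
    simp only [LinearMap.comp_apply, LinearMap.neg_apply, A.sign_apply ha,
      A.sign_apply (A.d_mem n a ha), map_neg, map_zsmul, Int.negOnePow_succ]
    simp)
  exact LinearMap.congr_fun this a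

theorem sign_sign (a : A.carrier) : A.sign (A.sign a) = a := by
  have := ext_homogeneous A.isInternal (f := A.sign ∘ₗ A.sign) (g := LinearMap.id) (by
    intro n a ha
    simp only [LinearMap.comp_apply, LinearMap.id_apply, A.sign_apply ha, map_neg, map_zsmul,
      smul_neg, neg_neg, negOnePow_smul_smul])
  exact LinearMap.congr_fun this a

theorem sign_shiftedMul (a b : A.carrier) :
    A.sign (A.shiftedMul a b) = - A.shiftedMul (A.sign a) (A.sign b) := by
  have := ext_homogeneous A.isInternal (f := A.shiftedMul.compr₂ A.sign)
    (g := -(A.shiftedMul.compl₁₂ A.sign A.sign)) (by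
      intro m a ha
      apply ext_homogeneous A.isInternal
      intro n b hb
      simp only [LinearMap.compr₂_apply, LinearMap.neg_apply, LinearMap.compl₁₂_apply,
        A.sign_apply ha, A.sign_apply hb, A.sign_apply (A.shiftedMul_mem m n a ha b hb),
        map_neg, map_zsmul, LinearMap.smul_apply, Int.negOnePow_add, Units.val_mul, mul_smul,
        neg_neg]
      rw [smul_neg, smul_comm])
  exact LinearMap.congr_fun₂ this a b

theorem d_shiftedMul (a b : A.carrier) :
    A.d (A.shiftedMul a b) + A.shiftedMul (A.d a) b + A.shiftedMul (A.sign a) (A.d b) = 0 := by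
  have := ext_homogeneous A.isInternal
    (f := A.shiftedMul.compr₂ A.d + A.shiftedMul ∘ₗ A.d + A.shiftedMul.compl₁₂ A.sign A.d)
    (g := 0) (by
      intro m a ha
      ext b
      simp only [LinearMap.add_apply, LinearMap.compr₂_apply, LinearMap.comp_apply,
        LinearMap.compl₁₂_apply, A.sign_apply ha, A.shiftedMul_apply ha,
        A.shiftedMul_apply (A.d_mem m a ha), map_neg, map_zsmul, LinearMap.neg_apply,
        LinearMap.smul_apply, A.leibniz m a ha, smul_add, negOnePow_smul_smul,
        Int.negOnePow_succ, Units.val_neg, neg_smul, LinearMap.zero_apply]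
      abel)
  exact LinearMap.congr_fun₂ this a b

theorem shiftedMul_shiftedMul (a b c : A.carrier) :
    A.shiftedMul (A.shiftedMul a b) c + A.shiftedMul (A.sign a) (A.shiftedMul b c) = 0 := by
  have h : ∀ b, (A.shiftedMul.flip c) ∘ₗ A.shiftedMul.flip b +
      A.shiftedMul.flip (A.shiftedMul b c) ∘ₗ A.sign = 0 := by
    intro b
    apply ext_homogeneous A.isInternal
    intro m a ha
    have := ext_homogeneous A.isInternal
      (f := A.shiftedMul.flip c ∘ₗ A.shiftedMul a +
        A.shiftedMul (A.sign a) ∘ₗ A.shiftedMul.flip c) (g := 0) (by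
        intro n b hb
        simp only [LinearMap.add_apply, LinearMap.comp_apply, LinearMap.flip_apply,
          A.shiftedMul_apply (A.mul_mem m n a ha b hb), A.shiftedMul_apply ha,
          A.shiftedMul_apply hb, A.sign_apply ha, map_neg, map_zsmul, LinearMap.neg_apply,
          LinearMap.smul_apply, A.mul_assoc, Int.negOnePow_add, Units.val_mul, mul_smul,
          negOnePow_smul_smul, LinearMap.zero_apply]
        rw [smul_neg, add_neg_cancel])
    simpa using LinearMap.congr_fun this b
  simpa using LinearMap.congr_fun (h b) a

/-- A dg algebra as an A-infinity algebra, through its bar construction. -/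
noncomputable def toAInfinity : AInfinityAlgebra.{u, v} k where
  carrier := A.carrier
  deg := A.deg
  isInternal := A.isInternal
  D := barDiff A.sign A.d A.shiftedMul
  D_one := barDiff_one _ _ _
  D_mem := barDiff_mem _ _ _ A.sign_mem A.d_mem A.shiftedMul_mem
  coderivation := barDiff_coderivation _ _ _ _ (by simp [barSign])
    (fun v w => barSign_ι_mul A.deg A.isInternal v w)
  D_D := barDiff_barDiff _ _ _ A.d_d A.sign_d A.sign_sign A.sign_shiftedMul A.d_shiftedMul
    A.shiftedMul_shiftedMul

end NonUnitalDGAlgebra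

/-! ### Lie coalgebras and their Chevalley-Eilenberg algebras -/

/-- The cyclic permutation `a ⊗ b ⊗ c ↦ b ⊗ c ⊗ a`. -/
noncomputable def tensorCycle (k L : Type*) [Field k] [AddCommGroup L] [Module k L] :
    L ⊗[k] (L ⊗[k] L) →ₗ[k] L ⊗[k] (L ⊗[k] L) :=
  (TensorProduct.assoc k L L L).toLinearMap ∘ₗ (TensorProduct.comm k L (L ⊗[k] L)).toLinearMap

/-- A Lie coalgebra structure on a vector space. -/
structure LieCoalgebra (k L : Type*) [Field k] [AddCommGroup L] [Module k L] where
  cobracket : L →ₗ[k] L ⊗[k] L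
  skew : ∀ x, TensorProduct.comm k L L (cobracket x) = - cobracket x
  coJacobi : (LinearMap.id + tensorCycle k L + tensorCycle k L ∘ₗ tensorCycle k L) ∘ₗ
    (cobracket.lTensor L) ∘ₗ cobracket = 0

namespace LieCoalgebra

variable {k L : Type*} [Field k] [AddCommGroup L] [Module k L] (𝓛 : LieCoalgebra k L)

/-- There is an increasing exhaustive filtration `F` with `F 0 = 0` and
`Δ (F i) ⊆ ∑_{p + q = i} F p ⊗ F q`. -/
def IsConilpotent : Prop :=
  ∃ F : ℕ → Submodule k L, Monotone F ∧ (⨆ i, F i) = ⊤ ∧ F 0 = ⊥ ∧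
    ∀ i, ∀ x ∈ F i, 𝓛.cobracket x ∈
      ⨆ (p : ℕ) (q : ℕ) (_ : p + q = i),
        LinearMap.range (TensorProduct.map (F p).subtype (F q).subtype)

/-- The product `L ⊗ L → Λ² L ⊆ Λ L`. -/
noncomputable def wedge (k L : Type*) [Field k] [AddCommGroup L] [Module k L] :
    L ⊗[k] L →ₗ[k] ExteriorAlgebra k L :=
  TensorProduct.lift ((LinearMap.mul k (ExteriorAlgebra k L)).compl₁₂
    (ExteriorAlgebra.ι k) (ExteriorAlgebra.ι k))

theorem wedge_tmul (a b : L) :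
    wedge k L (a ⊗ₜ b) = ExteriorAlgebra.ι k a * ExteriorAlgebra.ι k b := by
  simp [wedge]

theorem ι_mul_ι_swap (a b : L) : ExteriorAlgebra.ι k a * ExteriorAlgebra.ι k b =
    -(ExteriorAlgebra.ι k b * ExteriorAlgebra.ι k a) :=
  eq_neg_of_add_eq_zero_left (ExteriorAlgebra.ι_add_mul_swap a b)

theorem wedge_comm (t : L ⊗[k] L) :
    wedge k L (TensorProduct.comm k L L t) = - wedge k L t := by
  induction t with
  | zero => simp
  | add x y hx hy => rw [map_add, map_add, map_add, hx, hy]; abel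
  | tmul a b => rw [TensorProduct.comm_tmul, wedge_tmul, wedge_tmul, ι_mul_ι_swap]

theorem wedge_mul_ι (t : L ⊗[k] L) (x : L) :
    wedge k L t * ExteriorAlgebra.ι k x = ExteriorAlgebra.ι k x * wedge k L t := by
  induction t with
  | zero => simp
  | add x y hx hy => rw [map_add, add_mul, mul_add, hx, hy]
  | tmul a b =>
    rw [wedge_tmul, mul_assoc, ι_mul_ι_swap b x, mul_neg, ← mul_assoc, ι_mul_ι_swap a x, neg_mul,
      neg_neg, mul_assoc]

/-- The differential on generators. A skew-symmetric tensor `a ⊗ b - b ⊗ a` is identified with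
`a ∧ b`, whence the factor `1/2`. -/
noncomputable def diffGen : L →ₗ[k] ExteriorAlgebra k L :=
  (2⁻¹ : k) • (wedge k L ∘ₗ 𝓛.cobracket)

/-- The linear map `x ↦ !![-x, δ x; 0, x]`, whose extension to the exterior algebra is
`a ↦ !![(-1)^|a| a, δ a; 0, a]`. -/
noncomputable def diffMatrixGen : L →ₗ[k] Matrix (Fin 2) (Fin 2) (ExteriorAlgebra k L) where
  toFun x := !![-ExteriorAlgebra.ι k x, 𝓛.diffGen x; 0, ExteriorAlgebra.ι k x]
  map_add' x y := by
    ext i j; fin_cases i <;> fin_cases j <;> simp [add_comm]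
  map_smul' c x := by
    ext i j; fin_cases i <;> fin_cases j <;> simp

theorem diffMatrixGen_sq (x : L) : 𝓛.diffMatrixGen x * 𝓛.diffMatrixGen x = 0 := by
  have : 𝓛.diffGen x * ExteriorAlgebra.ι k x = ExteriorAlgebra.ι k x * 𝓛.diffGen x := by
    simp [diffGen, wedge_mul_ι]
  ext i j
  fin_cases i <;> fin_cases j <;> simp [diffMatrixGen, Matrix.mul_apply, Fin.sum_univ_two, this]

/-- The algebra map `a ↦ !![(-1)^|a| a, δ a; 0, a]`. -/
noncomputable def diffMatrix :
    ExteriorAlgebra k L →ₐ[k] Matrix (Fin 2) (Fin 2) (ExteriorAlgebra k L) :=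
  ExteriorAlgebra.lift k ⟨𝓛.diffMatrixGen, 𝓛.diffMatrixGen_sq⟩

/-- The Chevalley-Eilenberg differential: the derivation of `Λ L` extending the cobracket; see
`diff_ι` and `diff_mul`. -/
noncomputable def diff : ExteriorAlgebra k L →ₗ[k] ExteriorAlgebra k L where
  toFun a := 𝓛.diffMatrix a 0 1
  map_add' a b := by simp
  map_smul' c a := by simp

theorem diff_ι (x : L) : 𝓛.diff (ExteriorAlgebra.ι k x) = (2⁻¹ : k) • wedge k L (𝓛.cobracket x) := by
  simp [diff, diffMatrix, diffMatrixGen, diffGen]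

theorem diffMatrix_ι (x : L) : 𝓛.diffMatrix (ExteriorAlgebra.ι k x) =
    !![-ExteriorAlgebra.ι k x, 𝓛.diffGen x; 0, ExteriorAlgebra.ι k x] := by
  simp [diffMatrix, diffMatrixGen]

/-- The parity automorphism of `Λ L`. -/
noncomputable def parity (k L : Type*) [Field k] [AddCommGroup L] [Module k L] :
    ExteriorAlgebra k L →ₐ[k] ExteriorAlgebra k L :=
  ExteriorAlgebra.map (-LinearMap.id)

theorem diffMatrix_entries (a : ExteriorAlgebra k L) :
    𝓛.diffMatrix a 0 0 = parity k L a ∧ 𝓛.diffMatrix a 1 1 = a ∧ 𝓛.diffMatrix a 1 0 = 0 := by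
  induction a using ExteriorAlgebra.induction with
  | algebraMap r =>
    refine ⟨?_, ?_, ?_⟩ <;> simp [Matrix.algebraMap_matrix_apply]
  | ι x => simp [diffMatrix_ι, parity]
  | mul a b ha hb =>
    simp [Matrix.mul_apply, Fin.sum_univ_two, ha, hb]
  | add a b ha hb => simp [ha, hb]

theorem diff_mul' (a b : ExteriorAlgebra k L) :
    𝓛.diff (a * b) = 𝓛.diff a * b + parity k L a * 𝓛.diff b := by
  simp [diff, Matrix.mul_apply, Fin.sum_univ_two, (𝓛.diffMatrix_entries a).1,
    (𝓛.diffMatrix_entries b).2.1, add_comm]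

theorem diff_algebraMap (r : k) : 𝓛.diff (algebraMap k _ r) = 0 := by
  simp [diff, Matrix.algebraMap_matrix_apply]

theorem parity_apply {n : ℕ} {a : ExteriorAlgebra k L} (ha : a ∈ ⋀[k]^n L) :
    parity k L a = (-1 : ℤ) ^ n • a := by
  induction ha using Submodule.pow_induction_on_left' with
  | algebraMap r => simp
  | add x y i hx hy h1 h2 => rw [map_add, h1, h2, smul_add]
  | mem_mul m hm i x hx ih =>
    obtain ⟨v, rfl⟩ := hm
    rw [map_mul, ih, pow_succ, mul_smul_comm, mul_smul]
    simp [parity]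

/-- The graded Leibniz rule. -/
theorem diff_mul {n : ℕ} {a : ExteriorAlgebra k L} (ha : a ∈ ⋀[k]^n L) (b : ExteriorAlgebra k L) :
    𝓛.diff (a * b) = 𝓛.diff a * b + (-1 : ℤ) ^ n • (a * 𝓛.diff b) := by
  rw [diff_mul', parity_apply ha, smul_mul_assoc]

theorem wedge_mem (t : L ⊗[k] L) : wedge k L t ∈ ⋀[k]^2 L := by
  induction t with
  | zero => simp
  | add x y hx hy => rw [map_add]; exact add_mem hx hy
  | tmul a b =>
    rw [wedge_tmul, ExteriorAlgebra.exteriorPower, pow_two]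
    exact Submodule.mul_mem_mul ⟨a, rfl⟩ ⟨b, rfl⟩

theorem diff_mem {n : ℕ} {a : ExteriorAlgebra k L} (ha : a ∈ ⋀[k]^n L) :
    𝓛.diff a ∈ ⋀[k]^(n + 1) L := by
  induction ha using Submodule.pow_induction_on_left' with
  | algebraMap r => rw [diff_algebraMap]; exact zero_mem _
  | add x y i hx hy h1 h2 => rw [map_add]; exact add_mem h1 h2
  | mem_mul m hm i x hx ih =>
    obtain ⟨v, rfl⟩ := hm
    rw [diff_mul']
    refine add_mem ?_ ?_
    · rw [diff_ι, smul_mul_assoc, show i.succ + 1 = 2 + i by omega]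
      exact Submodule.smul_mem _ _ (SetLike.mul_mem_graded (wedge_mem _) hx)
    · rw [show i.succ + 1 = 1 + (i + 1) by omega]
      refine SetLike.mul_mem_graded (A := fun i : ℕ => ⋀[k]^i L) ?_ ih
      simp only [parity, ExteriorAlgebra.map_apply_ι, ExteriorAlgebra.exteriorPower, pow_one]
      exact ⟨_, rfl⟩

/-- The triple product `L ⊗ L ⊗ L → Λ L`. -/
noncomputable def wedge₃ (k L : Type*) [Field k] [AddCommGroup L] [Module k L] :
    L ⊗[k] (L ⊗[k] L) →ₗ[k] ExteriorAlgebra k L :=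
  TensorProduct.lift ((LinearMap.mul k (ExteriorAlgebra k L)).compl₁₂
    (ExteriorAlgebra.ι k) (wedge k L))

theorem wedge₃_cycle (t : L ⊗[k] (L ⊗[k] L)) :
    wedge₃ k L (tensorCycle k L t) = wedge₃ k L t := by
  have : wedge₃ k L ∘ₗ tensorCycle k L = wedge₃ k L := by
    apply TensorProduct.ext_threefold'
    intro a b c
    simp only [LinearMap.comp_apply, tensorCycle, LinearEquiv.coe_coe, TensorProduct.comm_tmul,
      TensorProduct.assoc_tmul, wedge₃, TensorProduct.lift.tmul, LinearMap.compl₁₂_apply,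
      LinearMap.mul_apply', wedge_tmul]
    rw [← mul_assoc, ← wedge_tmul, wedge_mul_ι, wedge_tmul]
  exact LinearMap.congr_fun this t

theorem diff_diff_ι [CharZero k] (x : L) : 𝓛.diff (𝓛.diff (ExteriorAlgebra.ι k x)) = 0 := by
  have h1 : ∀ t : L ⊗[k] L, 𝓛.diff (wedge k L t) =
      (2⁻¹ : k) • (wedge₃ k L (𝓛.cobracket.lTensor L (TensorProduct.comm k L L t)) -
        wedge₃ k L (𝓛.cobracket.lTensor L t)) := by
    intro t
    induction t with
    | zero => simp
    | add x y hx hy => simp only [map_add, hx, hy, ← smul_add]; congr 1; abel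
    | tmul a b =>
      rw [wedge_tmul, diff_mul', diff_ι, diff_ι]
      simp only [TensorProduct.comm_tmul, LinearMap.lTensor_tmul, wedge₃, TensorProduct.lift.tmul,
        LinearMap.compl₁₂_apply, LinearMap.mul_apply', smul_mul_assoc, wedge_mul_ι, parity,
        ExteriorAlgebra.map_apply_ι, LinearMap.neg_apply, LinearMap.id_apply, map_neg, neg_mul,
        mul_smul_comm, smul_sub, smul_neg]
      abel
  have h2 : wedge₃ k L (𝓛.cobracket.lTensor L (𝓛.cobracket x)) = 0 := by
    have := congrArg (wedge₃ k L) (LinearMap.congr_fun 𝓛.coJacobi x)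
    simp only [LinearMap.comp_apply, LinearMap.add_apply, LinearMap.id_apply, map_add,
      wedge₃_cycle, LinearMap.zero_apply, map_zero] at this
    have h3 : (3 : k) • wedge₃ k L (𝓛.cobracket.lTensor L (𝓛.cobracket x)) = 0 := by
      rw [← this, show (3 : k) = 1 + 1 + 1 by norm_num, add_smul, add_smul, one_smul]
    exact (smul_eq_zero.mp h3).resolve_left (by norm_num)
  rw [diff_ι, map_smul, h1, 𝓛.skew, map_neg, map_neg, h2]
  simp

theorem diff_diff [CharZero k] (a : ExteriorAlgebra k L) : 𝓛.diff (𝓛.diff a) = 0 := by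
  have hp : ∀ a, 𝓛.diff (parity k L a) = - parity k L (𝓛.diff a) := by
    intro a
    have hι : ∀ x, 𝓛.diff (parity k L (ExteriorAlgebra.ι k x)) =
        - parity k L (𝓛.diff (ExteriorAlgebra.ι k x)) := by
      intro x
      have : 𝓛.diff (ExteriorAlgebra.ι k x) ∈ ⋀[k]^2 L := by
        rw [diff_ι]; exact Submodule.smul_mem _ _ (wedge_mem _)
      rw [parity_apply this]
      simp [parity]
    induction a using ExteriorAlgebra.induction with
    | algebraMap r => simp [diff_algebraMap]
    | ι x => exact hι x
    | mul a b ha hb =>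
      simp only [map_mul, diff_mul', ha, hb, map_add, neg_mul, mul_neg]; abel
    | add a b ha hb => simp only [map_add, ha, hb]; abel
  induction a using ExteriorAlgebra.induction with
  | algebraMap r => simp [diff_algebraMap]
  | ι x => exact 𝓛.diff_diff_ι x
  | mul a b ha hb =>
    have hpp : parity k L (parity k L a) = a := by
      have : (parity k L).comp (parity k L) = AlgHom.id k _ := by
        apply ExteriorAlgebra.hom_ext
        ext x
        simp [parity]
      exact congrArg (fun f => f a) this
    simp only [diff_mul', map_add, ha, hb, hp, hpp, zero_mul, mul_zero, neg_mul]
    abel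
  | add a b ha hb => simp only [map_add, ha, hb, add_zero]

/-- The augmentation ideal of `Λ L`. -/
noncomputable def augIdeal (k L : Type*) [Field k] [AddCommGroup L] [Module k L] :
    Submodule k (ExteriorAlgebra k L) :=
  LinearMap.ker (ExteriorAlgebra.algebraMapInv : ExteriorAlgebra k L →ₐ[k] k).toLinearMap

theorem mem_augIdeal {a : ExteriorAlgebra k L} :
    a ∈ augIdeal k L ↔ ExteriorAlgebra.algebraMapInv a = 0 := Iff.rfl

theorem mem_augIdeal_of_mem {n : ℕ} (hn : n ≠ 0) {a : ExteriorAlgebra k L}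
    (ha : a ∈ ⋀[k]^n L) : a ∈ augIdeal k L := by
  obtain ⟨n, rfl⟩ := Nat.exists_eq_succ_of_ne_zero hn
  rw [mem_augIdeal]
  rw [ExteriorAlgebra.exteriorPower, Nat.succ_eq_add_one, pow_succ'] at ha
  induction ha using Submodule.mul_induction_on' with
  | mem_mul_mem x hx y hy =>
    obtain ⟨v, rfl⟩ := hx
    simp [ExteriorAlgebra.algebraMapInv]
  | add x _ y _ hx hy => rw [map_add, hx, hy, add_zero]

/-- The part of degree `n` of the augmentation ideal: `Λⁿ L` for `n > 0`, and zero otherwise. -/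
noncomputable def augDeg (k L : Type*) [Field k] [AddCommGroup L] [Module k L] (n : ℤ) :
    Submodule k (augIdeal k L) :=
  if 0 < n then (⋀[k]^n.toNat L).comap (augIdeal k L).subtype else ⊥

theorem mem_augDeg {n : ℤ} {a : augIdeal k L} :
    a ∈ augDeg k L n ↔ (∃ m : ℕ, n = m ∧ m ≠ 0 ∧ (a : ExteriorAlgebra k L) ∈ ⋀[k]^m L) ∨ a = 0 := by
  unfold augDeg
  split_ifs with h
  · constructor
    · intro ha; exact Or.inl ⟨n.toNat, by omega, by omega, ha⟩
    · rintro (⟨m, rfl, -, hm⟩ | rfl)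
      · simpa using hm
      · exact zero_mem _
  · rw [Submodule.mem_bot]
    constructor
    · exact Or.inr
    · rintro (⟨m, rfl, h0, -⟩ | h0)
      · omega
      · exact h0

theorem augDeg_isInternal (k L : Type*) [Field k] [AddCommGroup L] [Module k L] :
    DirectSum.IsInternal (augDeg k L) := by
  classical
  have hproj : ∀ (m : ℕ) (a : ExteriorAlgebra k L),
      GradedAlgebra.proj (fun i : ℕ => ⋀[k]^i L) m a ∈ ⋀[k]^m L := fun m a =>
    SetLike.coe_mem _
  constructor
  · have key : ∀ (f : DirectSum ℤ fun n => augDeg k L n) (m : ℕ),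
        GradedAlgebra.proj (fun i : ℕ => ⋀[k]^i L) m
          (DirectSum.coeAddMonoidHom (augDeg k L) f : ExteriorAlgebra k L) =
        ((f (m : ℤ) : augIdeal k L) : ExteriorAlgebra k L) := by
      intro f m
      rw [DirectSum.coeAddMonoidHom_eq_dfinsuppSum, DFinsupp.sum,
        AddSubmonoidClass.coe_finsetSum, map_sum, Finset.sum_eq_single (m : ℤ)]
      · rw [GradedAlgebra.proj_apply]
        rcases mem_augDeg.mp (f (m : ℤ)).2 with ⟨l, hl, -, hm⟩ | h0
        · obtain rfl : m = l := by exact_mod_cast hl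
          exact DirectSum.decompose_of_mem_same (fun i : ℕ => ⋀[k]^i L) hm
        · rw [h0]; simp
      · intro b _ hb
        rcases mem_augDeg.mp (f b).2 with ⟨l, rfl, -, hl⟩ | h0
        · rw [GradedAlgebra.proj_apply]
          exact DirectSum.decompose_of_mem_ne (fun i : ℕ => ⋀[k]^i L) hl
            (by intro h; exact hb (by rw [h]))
        · rw [h0]; simp
      · intro h
        rw [DFinsupp.notMem_support_iff] at h
        rw [h]; simp
    intro f g hfg
    ext n : 1
    apply Subtype.ext
    rcases mem_augDeg.mp (f n).2 with ⟨m, rfl, -, -⟩ | hf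
    · apply Subtype.ext
      rw [← key f m, ← key g m, hfg]
    · rcases mem_augDeg.mp (g n).2 with ⟨m, rfl, -, -⟩ | hg
      · apply Subtype.ext
        rw [← key f m, ← key g m, hfg]
      · rw [hf, hg]
  · intro x
    have hker : ∀ m, GradedAlgebra.proj (fun i : ℕ => ⋀[k]^i L) m (x : ExteriorAlgebra k L) ∈
        augIdeal k L := by
      have h0 : ∀ m ≠ 0, GradedAlgebra.proj (fun i : ℕ => ⋀[k]^i L) m (x : ExteriorAlgebra k L) ∈
        augIdeal k L := fun m hm => mem_augIdeal_of_mem hm (hproj m _)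
      intro m
      by_cases hm : m = 0
      · subst hm
        have hx : (x : ExteriorAlgebra k L) ∈ augIdeal k L := x.2
        rw [← DirectSum.sum_support_decompose (fun i : ℕ => ⋀[k]^i L) (x : ExteriorAlgebra k L)]
          at hx
        by_cases hs : 0 ∈ (DirectSum.decompose (fun i : ℕ => ⋀[k]^i L)
            (x : ExteriorAlgebra k L)).support
        · rw [← Finset.add_sum_erase _ _ hs] at hx
          refine (Submodule.add_mem_iff_left _ ?_).mp hx
          exact sum_mem fun i hi => h0 i (Finset.ne_of_mem_erase hi)
        · rw [DFinsupp.notMem_support_iff] at hs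
          rw [GradedAlgebra.proj_apply, hs]; simp
      · exact h0 m hm
    have hz : GradedAlgebra.proj (fun i : ℕ => ⋀[k]^i L) 0 (x : ExteriorAlgebra k L) = 0 := by
      have h1 := hproj 0 (x : ExteriorAlgebra k L)
      have h2 := mem_augIdeal.mp (hker 0)
      rw [ExteriorAlgebra.exteriorPower, pow_zero, Submodule.mem_one] at h1
      obtain ⟨r, hr⟩ := h1
      rw [← hr] at h2 ⊢
      rw [AlgHom.commutes] at h2
      simp only [Algebra.algebraMap_self, RingHom.id_apply] at h2
      rw [h2, map_zero]
    suffices h : x ∈ (⨆ n, augDeg k L n) by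
      rw [Submodule.mem_iSup_iff_exists_dfinsupp'] at h
      obtain ⟨f, hf⟩ := h
      refine ⟨f, ?_⟩
      rw [DirectSum.coeAddMonoidHom_eq_dfinsuppSum, ← hf]
    have hx : x = ∑ i ∈ (DirectSum.decompose (fun i : ℕ => ⋀[k]^i L)
        (x : ExteriorAlgebra k L)).support,
        (⟨GradedAlgebra.proj (fun i : ℕ => ⋀[k]^i L) i (x : ExteriorAlgebra k L), hker i⟩ :
          augIdeal k L) := by
      apply Subtype.ext
      rw [AddSubmonoidClass.coe_finsetSum]
      exact (DirectSum.sum_support_decompose (fun i : ℕ => ⋀[k]^i L)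
        (x : ExteriorAlgebra k L)).symm
    rw [hx]
    refine sum_mem fun i _ => ?_
    refine Submodule.mem_iSup_of_mem (i : ℤ) (mem_augDeg.mpr ?_)
    by_cases hi : i = 0
    · subst hi; exact Or.inr (Subtype.ext hz)
    · exact Or.inl ⟨i, rfl, hi, hproj i _⟩

theorem diff_mem_augIdeal (a : ExteriorAlgebra k L) : 𝓛.diff a ∈ augIdeal k L := by
  rw [mem_augIdeal]
  induction a using ExteriorAlgebra.induction with
  | algebraMap r => simp [diff_algebraMap]
  | ι x =>
    rw [diff_ι, map_smul, mem_augIdeal.mp (mem_augIdeal_of_mem two_ne_zero (wedge_mem _)),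
      smul_zero]
  | mul a b ha hb => rw [diff_mul', map_add, map_mul, map_mul, ha, hb]; simp
  | add a b ha hb => rw [map_add, map_add, ha, hb, add_zero]

/-- The reduced Chevalley-Eilenberg algebra `C^{>0}(L)`: the augmentation ideal of the dg algebra
`(Λ L, δ)`. -/
noncomputable def reducedCE [CharZero k] : NonUnitalDGAlgebra k where
  carrier := augIdeal k L
  deg := augDeg k L
  isInternal := augDeg_isInternal k L
  mul := LinearMap.mk₂ k
    (fun a b => ⟨(a : ExteriorAlgebra k L) * b, by
      rw [mem_augIdeal, map_mul, mem_augIdeal.mp a.2, zero_mul]⟩)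
    (by intros; ext; simp [add_mul]) (by intros; ext; simp)
    (by intros; ext; simp [mul_add]) (by intros; ext; simp)
  mul_assoc a b c := Subtype.ext (mul_assoc _ _ _)
  mul_mem m n a ha b hb := by
    rw [mem_augDeg] at ha hb ⊢
    rcases ha with ⟨p, rfl, hp, ha⟩ | rfl
    · rcases hb with ⟨q, rfl, hq, hb⟩ | rfl
      · exact Or.inl ⟨p + q, by push_cast; rfl, by omega,
          SetLike.mul_mem_graded (A := fun i : ℕ => ⋀[k]^i L) ha hb⟩
      · exact Or.inr (map_zero _)
    · exact Or.inr (LinearMap.map_zero₂ _ _)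
  d := (𝓛.diff ∘ₗ (augIdeal k L).subtype).codRestrict _ fun a => 𝓛.diff_mem_augIdeal a
  d_mem n a ha := by
    rw [mem_augDeg] at ha ⊢
    rcases ha with ⟨p, rfl, hp, ha⟩ | rfl
    · exact Or.inl ⟨p + 1, by push_cast; rfl, by omega, 𝓛.diff_mem ha⟩
    · exact Or.inr (map_zero _)
  d_d a := Subtype.ext (𝓛.diff_diff a)
  leibniz n a ha b := by
    rw [mem_augDeg] at ha
    rcases ha with ⟨p, rfl, hp, ha⟩ | rfl
    · apply Subtype.ext
      rw [Int.coe_negOnePow_natCast]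
      exact 𝓛.diff_mul ha (b : ExteriorAlgebra k L)
    · simp

end LieCoalgebra

/-! ### Lie coalgebras dual to Lie algebras -/

section Dual

variable {k 𝔤 L : Type*} [Field k] [LieRing 𝔤] [LieAlgebra k 𝔤] [AddCommGroup L] [Module k L]

/-- Evaluation at `x` of the functionals in `L`, where `e : L → 𝔤^*`. -/
def evalAt (e : L →ₗ[k] Module.Dual k 𝔤) (x : 𝔤) : L →ₗ[k] k := e.flip x

/-- Evaluation at `(x, y)` of a tensor in `L ⊗ L`, where `e : L → 𝔤^*`. -/
noncomputable def evalAt₂ (e : L →ₗ[k] Module.Dual k 𝔤) (x y : 𝔤) : L ⊗[k] L →ₗ[k] k :=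
  LinearMap.mul' k k ∘ₗ TensorProduct.map (evalAt e x) (evalAt e y)

/-- Evaluation at `(x, y, z)` of a tensor in `L ⊗ L ⊗ L`, where `e : L → 𝔤^*`. -/
noncomputable def evalAt₃ (e : L →ₗ[k] Module.Dual k 𝔤) (x y z : 𝔤) :
    L ⊗[k] (L ⊗[k] L) →ₗ[k] k :=
  LinearMap.mul' k k ∘ₗ TensorProduct.map (evalAt e x) (evalAt₂ e y z)

theorem evalAt₂_tmul (e : L →ₗ[k] Module.Dual k 𝔤) (x y : 𝔤) (a b : L) :
    evalAt₂ e x y (a ⊗ₜ b) = e a x * e b y := by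
  simp [evalAt₂, evalAt]

theorem evalAt₃_tmul (e : L →ₗ[k] Module.Dual k 𝔤) (x y z : 𝔤) (a : L) (t : L ⊗[k] L) :
    evalAt₃ e x y z (a ⊗ₜ t) = e a x * evalAt₂ e y z t := by
  simp [evalAt₃, evalAt]

/-- Functionals separating points of `L` and of `W` separate points of `L ⊗ W`. -/
theorem tensor_separation {W X : Type*} [AddCommGroup W] [Module k W]
    {e : L →ₗ[k] Module.Dual k 𝔤} (he : Function.Injective e) (φ : X → W →ₗ[k] k)
    (hφ : ∀ w, (∀ i, φ i w = 0) → w = 0) {t : L ⊗[k] W}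
    (ht : ∀ x i, LinearMap.mul' k k (TensorProduct.map (evalAt e x) (φ i) t) = 0) : t = 0 := by
  classical
  let b := Module.Basis.ofVectorSpace k W
  obtain ⟨c, rfl⟩ := (TensorProduct.equivFinsuppOfBasisRight b).symm.surjective t
  have h1 : ∀ x, c.sum (fun j l => e l x • b j) = 0 := by
    intro x
    apply hφ
    intro i
    have := ht x i
    rw [TensorProduct.equivFinsuppOfBasisRight_symm_apply] at this
    simpa [Finsupp.sum, map_sum, evalAt] using this
  have h2 : c = 0 := by
    ext j
    apply he
    ext x
    have h3 := congrArg (fun w => b.repr w j) (h1 x)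
    simp only [Finsupp.sum, map_sum, map_smul, Module.Basis.repr_self, map_zero,
      Finsupp.coe_zero, Pi.zero_apply, Finsupp.finsetSum_apply, Finsupp.smul_apply,
      Finsupp.single_apply, smul_eq_mul, mul_ite, mul_one, mul_zero, Finset.sum_ite_eq',
      Finsupp.mem_support_iff] at h3
    by_cases hj : c j = 0
    · simp [hj]
    · simpa [hj] using h3
  rw [h2, map_zero]

theorem evalAt_separation {e : L →ₗ[k] Module.Dual k 𝔤} (he : Function.Injective e) (a : L)
    (h : ∀ x, evalAt e x a = 0) : a = 0 :=
  he (by ext x; simpa [evalAt] using h x)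

theorem evalAt₂_separation {e : L →ₗ[k] Module.Dual k 𝔤} (he : Function.Injective e)
    (t : L ⊗[k] L) (h : ∀ x y, evalAt₂ e x y t = 0) : t = 0 :=
  tensor_separation he (evalAt e) (evalAt_separation he) h

theorem evalAt₃_separation {e : L →ₗ[k] Module.Dual k 𝔤} (he : Function.Injective e)
    (t : L ⊗[k] (L ⊗[k] L)) (h : ∀ x y z, evalAt₃ e x y z t = 0) : t = 0 :=
  tensor_separation (X := 𝔤 × 𝔤) he (fun p => evalAt₂ e p.1 p.2)
    (fun w hw => evalAt₂_separation he w fun x y => hw (x, y)) fun x p => h x p.1 p.2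

/-- The Lie coalgebra structure dual to the bracket of `𝔤` on a space `L` of linear functionals on
`𝔤`: the cobracket is determined by `(Δ ξ)(x, y) = ξ ⁅x, y⁆`. It exists provided that the
functionals `(x, y) ↦ ξ ⁅x, y⁆` are represented by tensors in `L ⊗ L`. -/
noncomputable def LieCoalgebra.ofFunctionals (e : L →ₗ[k] Module.Dual k 𝔤)
    (he : Function.Injective e)
    (h : ∀ ξ : L, ∃ t : L ⊗[k] L, ∀ x y, evalAt₂ e x y t = e ξ ⁅x, y⁆) : LieCoalgebra k L :=
  let Δ : L →ₗ[k] L ⊗[k] L :=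
    { toFun := fun ξ => (h ξ).choose
      map_add' := fun ξ η => sub_eq_zero.mp <| evalAt₂_separation he _ fun x y => by
        rw [map_sub, (h (ξ + η)).choose_spec, map_add (evalAt₂ e x y), (h ξ).choose_spec, (h η).choose_spec,
          map_add, LinearMap.add_apply, sub_self]
      map_smul' := fun c ξ => sub_eq_zero.mp <| evalAt₂_separation he _ fun x y => by
        rw [map_sub, RingHom.id_apply, (h (c • ξ)).choose_spec, map_smul (evalAt₂ e x y), (h ξ).choose_spec,
          map_smul, LinearMap.smul_apply, sub_self] }
  have hΔ : ∀ ξ x y, evalAt₂ e x y (Δ ξ) = e ξ ⁅x, y⁆ := fun ξ => (h ξ).choose_spec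
  { cobracket := Δ
    skew := fun ξ => by
      rw [← sub_eq_zero]
      refine evalAt₂_separation he _ fun x y => ?_
      have hc : ∀ t : L ⊗[k] L, evalAt₂ e x y (TensorProduct.comm k L L t) =
          evalAt₂ e y x t := by
        intro t
        induction t with
        | zero => simp
        | add a b ha hb => rw [map_add, map_add, map_add, ha, hb]
        | tmul a b => simp only [TensorProduct.comm_tmul, evalAt₂_tmul, mul_comm]
      rw [map_sub, map_neg, hc, hΔ, hΔ, ← lie_skew, map_neg, sub_neg_eq_add, neg_add_cancel]
    coJacobi := by
      ext ξ
      refine evalAt₃_separation he _ fun x y z => ?_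
      have hcyc : ∀ x y z, ∀ t : L ⊗[k] (L ⊗[k] L), evalAt₃ e x y z (tensorCycle k L t) =
          evalAt₃ e z x y t := by
        intro x y z t
        have : evalAt₃ e x y z ∘ₗ tensorCycle k L = evalAt₃ e z x y := by
          apply TensorProduct.ext_threefold'
          intro a b c
          simp only [LinearMap.comp_apply, tensorCycle, LinearEquiv.coe_coe,
            TensorProduct.comm_tmul, TensorProduct.assoc_tmul, evalAt₃_tmul, evalAt₂_tmul]
          ring
        exact LinearMap.congr_fun this t
      have hJ : ∀ x y z, ∀ t : L ⊗[k] L, evalAt₃ e x y z (Δ.lTensor L t) =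
          evalAt₂ e x ⁅y, z⁆ t := by
        intro x y z t
        induction t with
        | zero => simp
        | add a b ha hb => rw [map_add, map_add, map_add, ha, hb]
        | tmul a b => rw [LinearMap.lTensor_tmul, evalAt₃_tmul, evalAt₂_tmul, hΔ]
      simp only [LinearMap.comp_apply, LinearMap.add_apply, LinearMap.id_apply, map_add, hcyc, hJ,
        hΔ]
      rw [← map_add, ← map_add, add_right_comm, lie_jacobi]
      simp }

/-- On the dual of a finite-dimensional Lie algebra the transpose of the bracket exists. -/
theorem exists_tensor_of_finiteDimensional (k 𝔤 : Type*) [Field k] [LieRing 𝔤] [LieAlgebra k 𝔤]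
    [FiniteDimensional k 𝔤] (ξ : Module.Dual k 𝔤) :
    ∃ t : Module.Dual k 𝔤 ⊗[k] Module.Dual k 𝔤,
      ∀ x y, evalAt₂ LinearMap.id x y t = ξ ⁅x, y⁆ := by
  let b := Module.finBasis k 𝔤
  refine ⟨∑ i, ∑ j, ξ ⁅b i, b j⁆ • (b.coord i ⊗ₜ b.coord j), fun x y => ?_⟩
  conv_rhs => rw [← b.sum_repr x, ← b.sum_repr y]
  simp only [map_sum, map_smul, evalAt₂_tmul, sum_lie, lie_sum, smul_lie, lie_smul,
    LinearMap.id_apply, Module.Basis.coord_apply, smul_eq_mul]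
  rw [Finset.sum_comm]
  refine Finset.sum_congr rfl fun j _ => ?_
  rw [Finset.mul_sum]
  refine Finset.sum_congr rfl fun i _ => ?_
  ring

/-- The Lie coalgebra dual to a finite-dimensional Lie algebra. -/
noncomputable def LieCoalgebra.dual (k 𝔤 : Type*) [Field k] [LieRing 𝔤] [LieAlgebra k 𝔤]
    [FiniteDimensional k 𝔤] : LieCoalgebra k (Module.Dual k 𝔤) :=
  LieCoalgebra.ofFunctionals LinearMap.id Function.injective_id
    (exists_tensor_of_finiteDimensional k 𝔤)

/-- The open ideals of a topological Lie algebra with finite-dimensional nilpotent quotient. -/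
def IsFiniteNilpotentIdeal {k 𝔤 : Type*} [Field k] [LieRing 𝔤] [LieAlgebra k 𝔤]
    [TopologicalSpace 𝔤] (I : LieIdeal k 𝔤) : Prop :=
  IsOpen (I : Set 𝔤) ∧ FiniteDimensional k (𝔤 ⧸ I) ∧ LieRing.IsNilpotent (𝔤 ⧸ I)

/-- A pro-nilpotent Lie algebra, i.e. a topological Lie algebra which is the projective limit of
its discrete finite-dimensional nilpotent quotients `𝔤 ⧸ I`: the topology is the limit topology,
and the map from `𝔤` to the set of compatible families in the quotients is bijective. -/
structure IsProNilpotent (k 𝔤 : Type*) [Field k] [LieRing 𝔤] [LieAlgebra k 𝔤]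
    [TopologicalSpace 𝔤] : Prop where
  topologicalAddGroup : IsTopologicalAddGroup 𝔤
  basis : ∀ U ∈ nhds (0 : 𝔤), ∃ I : LieIdeal k 𝔤, IsFiniteNilpotentIdeal I ∧ (I : Set 𝔤) ⊆ U
  injective : ∀ x : 𝔤, (∀ I : LieIdeal k 𝔤, IsFiniteNilpotentIdeal I → x ∈ I) → x = 0
  surjective : ∀ x : LieIdeal k 𝔤 → 𝔤,
    (∀ I J, IsFiniteNilpotentIdeal I → IsFiniteNilpotentIdeal J → I ≤ J → x I - x J ∈ J) →
    ∃ y : 𝔤, ∀ I, IsFiniteNilpotentIdeal I → y - x I ∈ I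

/-- The space of continuous linear functionals, for the discrete topology on `k`. -/
def continuousDual (k 𝔤 : Type*) [Field k] [LieRing 𝔤] [LieAlgebra k 𝔤]
    [TopologicalSpace 𝔤] : Submodule k (Module.Dual k 𝔤) where
  carrier := {ξ | IsLocallyConstant (ξ : 𝔤 → k)}
  zero_mem' := IsLocallyConstant.const 0
  add_mem' h₁ h₂ := IsLocallyConstant.add h₁ h₂
  smul_mem' c _ h := h.comp (c • ·)

theorem IsProNilpotent.exists_tensor {k 𝔤 : Type*} [Field k] [LieRing 𝔤] [LieAlgebra k 𝔤]
    [TopologicalSpace 𝔤] (h : IsProNilpotent k 𝔤) (ξ : continuousDual k 𝔤) :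
    ∃ t : continuousDual k 𝔤 ⊗[k] continuousDual k 𝔤,
      ∀ x y, evalAt₂ (L := continuousDual k 𝔤) (continuousDual k 𝔤).subtype x y t = ξ.1 ⁅x, y⁆ := by
  have := h.topologicalAddGroup
  have hξ : IsLocallyConstant (ξ.1 : 𝔤 → k) := ξ.2
  obtain ⟨I, ⟨hI, hfin, -⟩, hsub⟩ := h.basis _
    ((hξ.isOpen_fiber (0 : k)).mem_nhds (map_zero ξ.1))
  let q : 𝔤 →ₗ[k] 𝔤 ⧸ I := (LieSubmodule.toSubmodule I).mkQ
  let ξ' : Module.Dual k (𝔤 ⧸ I) := (LieSubmodule.toSubmodule I).liftQ ξ.1 fun x hx => hsub hx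
  have hq : ∀ η : Module.Dual k (𝔤 ⧸ I), η ∘ₗ q ∈ continuousDual k 𝔤 := by
    intro η
    refine (IsLocallyConstant.iff_exists_open _).mpr fun x => ?_
    refine ⟨(fun y => y - x) ⁻¹' (I : Set 𝔤), hI.preimage (by fun_prop), by simp, ?_⟩
    intro y hy
    have : q y = q x := (Submodule.Quotient.eq _).mpr hy
    simp [this]
  let p : Module.Dual k (𝔤 ⧸ I) →ₗ[k] continuousDual k 𝔤 :=
    (LinearMap.lcomp k k q).codRestrict _ hq
  obtain ⟨t, ht⟩ := exists_tensor_of_finiteDimensional k (𝔤 ⧸ I) ξ'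
  refine ⟨TensorProduct.map p p t, fun x y => ?_⟩
  have h1 : ∀ t, evalAt₂ (L := continuousDual k 𝔤) (continuousDual k 𝔤).subtype x y (TensorProduct.map p p t) =
      evalAt₂ (k := k) (𝔤 := 𝔤 ⧸ I) LinearMap.id (q x) (q y) t := by
    intro t
    induction t with
    | zero => simp
    | add a b ha hb => rw [map_add, map_add, map_add, ha, hb]
    | tmul a b => simp only [TensorProduct.map_tmul, evalAt₂_tmul]; rfl
  rw [h1, ht]
  rfl

/-- The Lie coalgebra of continuous linear functionals on a pro-nilpotent Lie algebra. -/
noncomputable def LieCoalgebra.continuousDual {k 𝔤 : Type*} [Field k] [LieRing 𝔤] [LieAlgebra k 𝔤]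
    [TopologicalSpace 𝔤] (h : IsProNilpotent k 𝔤) : LieCoalgebra k (continuousDual k 𝔤) :=
  LieCoalgebra.ofFunctionals (L := _root_.continuousDual k 𝔤)
    (_root_.continuousDual k 𝔤).subtype
    (Submodule.injective_subtype _) h.exists_tensor

end Dual

universe u v

/-! ### Basic structure of the tensor coalgebra -/

section TensorBasics

variable {k A N : Type*} [Field k] [AddCommGroup A] [Module k A] [AddCommGroup N] [Module k N]

namespace TensorAlgebra

/-! The property carried along zigzags is `HasTrivialSuspension`: the cohomology of m₁ vanishes in
degrees ≤ 0, and every m₁-cocycle of degree at least 2, viewed as a one-letter word, is a coboundary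
in the bar construction. If m₁ = 0 this yields 1-generation (`HasTrivialSuspension.isOneGenerated`).
Generation by degree one then follows by induction on the degree
(`IsOneGenerated.isGeneratedInDegreeOne`). If a has degree p ≥ 2, then [a] = D y with y of bar
degree p - 2. All letters have degree at least 1, so those of y have degree at most p - 1, and the
linear component of D y is a sum of operations mₙ applied to them.

Invariance (`hasTrivialSuspension_iff`) is easy along a quasi-isomorphism f. Against its direction
it requires that f be injective on bar cohomology (`Hom.IsQuasiIso.exists_D_eq`). Modulo shorter
words, D and f are the extensions of m₁ and f₁ to the tensor algebra. Over a field f₁ has a homotopy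
inverse, read off from a contraction of its mapping cone. The homotopies extend to words, and an
induction over the tensor filtration (`exists_eq_of_filtered_homotopyEquiv`) corrects a cocycle step
by step.

It remains to see that the bar construction of C^{>0}(L) has no cohomology in positive degrees.
Conilpotency provides a vector space grading of L for which the cobracket strictly lowers the weight
(`IsConilpotent.exists_grading`). The codifferential is thus a product part preserving the weight
plus a part lowering it, and induction on the weight (`exists_barDiff_eq`) reduces the claim to the
Koszulness of ΛL (`exists_mulDiff_eq`).

Koszulness comes from the homotopy h : [c | w] ↦ ∑ [∂ᵢc | xᵢ ⧢ w], where ⧢ inserts a generator in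
all places. If c has exterior degree at least 2 and w is a cocycle formed by r generators, then Dh +
hD multiplies [c | w] by deg c + r. The Euler formula gives deg c (`mulDiff_homotopy`); the r
appears because a cocycle in generators is symmetric, so that reinserting its first letter
everywhere multiplies it by r (`topToRandom_eq_smul`). The scalar is invertible in characteristic 0.
Words with tails of positive degree are reduced to this case by a double induction, on the length
and on the degree of the tail.

For Lie algebras, the functionals vanishing on the terms of the lower central series form a
filtration with Δ(Gₘ₊₁) ⊆ Gₘ ⊗ Gₘ, which becomes conilpotent after logarithmic reindexing
(`ofFunctionals_isConilpotent`). -/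

theorem algebraMapInv_ι (a : A) : algebraMapInv (ι k a) = 0 := by
  simp [algebraMapInv]

theorem algebraMapInv_ι_mul (a : A) (w : TensorAlgebra k A) :
    algebraMapInv (ι k a * w) = 0 := by
  rw [map_mul, algebraMapInv_ι, zero_mul]

theorem ιInv_one : ιInv (1 : TensorAlgebra k A) = 0 := by
  -- The right action of k used in the definition of `ιInv` through `TrivSqZeroExt`; it has to be in
  -- scope before that definition can be unfolded.
  let : Module kᵐᵒᵖ A := Module.compHom _ ((RingHom.id k).fromOpposite mul_comm)
  have : IsCentralScalar k A := ⟨fun r m => rfl⟩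
  simp only [ιInv, LinearMap.comp_apply, AlgHom.toLinearMap_apply]
  rw [map_one]
  rfl

/-- In the trivial square-zero extension a product of two letters is zero, so only the constant term
of the tail survives. -/
theorem ιInv_ι_mul (a : A) (w : TensorAlgebra k A) :
    ιInv (ι k a * w) = algebraMapInv w • a := by
  let : Module kᵐᵒᵖ A := Module.compHom _ ((RingHom.id k).fromOpposite mul_comm)
  have : IsCentralScalar k A := ⟨fun r m => rfl⟩
  have h : ∀ w : TensorAlgebra k A,
      (toTrivSqZeroExt w : TrivSqZeroExt k A).fst = algebraMapInv w := by
    have : (TrivSqZeroExt.fstHom k k A).comp toTrivSqZeroExt =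
        (algebraMapInv : TensorAlgebra k A →ₐ[k] k) := by
      ext a; simp [algebraMapInv]
    exact fun w => DFunLike.congr_fun this w
  simp [ιInv, ← h]

/-- Linear recursion over words, with access to the tail of the word. -/
noncomputable def foldAux (F : A →ₗ[k] (TensorAlgebra k A × N →ₗ[k] N)) :
    A →ₗ[k] Module.End k (TensorAlgebra k A × N) where
  toFun a := (LinearMap.mulLeft k (ι k a) ∘ₗ LinearMap.fst k _ _).prod (F a)
  map_add' a b := by ext <;> simp [add_mul]
  map_smul' c a := by ext <;> simp

theorem foldAux_apply (F : A →ₗ[k] (TensorAlgebra k A × N →ₗ[k] N)) (a : A) (p) :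
    foldAux F a p = (ι k a * p.1, F a p) := rfl

/-- The linear map with `fold F n 1 = n` and `fold F n (a w) = F a (w, fold F n w)`. -/
noncomputable def fold (F : A →ₗ[k] (TensorAlgebra k A × N →ₗ[k] N)) (n : N) :
    TensorAlgebra k A →ₗ[k] N :=
  LinearMap.snd k _ _ ∘ₗ LinearMap.applyₗ ((1 : TensorAlgebra k A), n) ∘ₗ
    (lift k (foldAux F)).toLinearMap

theorem fold_one (F : A →ₗ[k] (TensorAlgebra k A × N →ₗ[k] N)) (n : N) : fold F n 1 = n := by
  simp [fold]

theorem fold_ι_mul (F : A →ₗ[k] (TensorAlgebra k A × N →ₗ[k] N)) (n : N) (a : A)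
    (w : TensorAlgebra k A) : fold F n (ι k a * w) = F a (w, fold F n w) := by
  -- The first component of the state reproduces the word already read; this is what gives each step
  -- access to the tail.
  have h : ∀ w : TensorAlgebra k A, (lift k (foldAux F) w (1, n)).1 = w := by
    have := ext_word (k := k) (A := A)
      (f := LinearMap.fst k _ _ ∘ₗ LinearMap.applyₗ ((1 : TensorAlgebra k A), n) ∘ₗ
        (lift k (foldAux F)).toLinearMap)
      (g := LinearMap.id) (by simp) (by
        intro v w hw
        simp only [LinearMap.comp_apply, LinearMap.applyₗ_apply_apply, AlgHom.toLinearMap_apply,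
          LinearMap.fst_apply, LinearMap.id_apply] at hw ⊢
        simp [foldAux_apply, hw])
    intro w
    exact LinearMap.congr_fun this w
  simp only [fold, LinearMap.comp_apply, LinearMap.applyₗ_apply_apply, AlgHom.toLinearMap_apply,
    LinearMap.snd_apply, map_mul, lift_ι_apply, Module.End.mul_apply, foldAux_apply]
  congr 1
  exact Prod.ext (h w) rfl

/-- Prepending a letter to a word. -/
noncomputable def cons (k A : Type*) [Field k] [AddCommGroup A] [Module k A] :
    A ⊗[k] TensorAlgebra k A →ₗ[k] TensorAlgebra k A :=
  TensorProduct.lift (LinearMap.mul k (TensorAlgebra k A) ∘ₗ ι k)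

@[simp] theorem cons_tmul (a : A) (w : TensorAlgebra k A) : cons k A (a ⊗ₜ w) = ι k a * w := by
  simp [cons]

/-- Splitting off the first letter of a word. -/
noncomputable def uncons (k A : Type*) [Field k] [AddCommGroup A] [Module k A] :
    TensorAlgebra k A →ₗ[k] A ⊗[k] TensorAlgebra k A :=
  ιInv.rTensor _ ∘ₗ deconcat

/-- Every term of the deconcatenation except 1 ⊗ w has a nonempty left factor, which the counit
kills. -/
theorem counit_deconcat (w : TensorAlgebra k A) :
    (algebraMapInv : TensorAlgebra k A →ₐ[k] k).toLinearMap.rTensor _ (deconcat w) = 1 ⊗ₜ w := by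
  have := ext_word (k := k) (A := A)
    (f := (algebraMapInv : TensorAlgebra k A →ₐ[k] k).toLinearMap.rTensor _ ∘ₗ deconcat)
    (g := TensorProduct.mk k _ _ 1) (by simp) (by
      intro v w _
      simp only [LinearMap.comp_apply, deconcat_ι_mul, map_add, LinearMap.rTensor_tmul,
        TensorProduct.mk_apply]
      have : ∀ z : TensorAlgebra k A ⊗[k] TensorAlgebra k A,
          (algebraMapInv : TensorAlgebra k A →ₐ[k] k).toLinearMap.rTensor _
            ((ι k v ⊗ₜ 1) * z) = 0 := by
        intro z
        induction z with
        | zero => simp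
        | add x y hx hy => rw [mul_add, map_add, hx, hy, add_zero]
        | tmul x y => simp [algebraMapInv_ι]
      rw [this, add_zero]; simp)
  exact LinearMap.congr_fun this w

@[simp] theorem uncons_one : uncons k A 1 = 0 := by
  simp [uncons, ιInv_one]

/-- Applying a map to the prefixes of a word which are longer than the first letter. -/
theorem rTensor_ι_mul (φ : TensorAlgebra k A →ₗ[k] N) (a : A)
    (z : TensorAlgebra k A ⊗[k] TensorAlgebra k A) :
    φ.rTensor _ ((ι k a ⊗ₜ 1) * z) = (φ ∘ₗ LinearMap.mulLeft k (ι k a)).rTensor _ z := by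
  induction z with
  | zero => simp
  | add x y hx hy => rw [mul_add, map_add, map_add, hx, hy]
  | tmul x y => simp

@[simp] theorem uncons_ι_mul (a : A) (w : TensorAlgebra k A) :
    uncons k A (ι k a * w) = a ⊗ₜ w := by
  -- On prefixes starting with a, `ιInv` sees only the prefix a itself: it is the counit of the
  -- remainder times a, and the counit axiom applies.
  have h : (ιInv ∘ₗ LinearMap.mulLeft k (ι k a) : TensorAlgebra k A →ₗ[k] A) =
      LinearMap.toSpanSingleton k A a ∘ₗ
        (algebraMapInv : TensorAlgebra k A →ₐ[k] k).toLinearMap := by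
    ext w; simp [ιInv_ι_mul]
  rw [uncons, LinearMap.comp_apply, deconcat_ι_mul, map_add, LinearMap.rTensor_tmul, ιInv_one,
    TensorProduct.zero_tmul, zero_add, rTensor_ι_mul, h, LinearMap.rTensor_comp,
    LinearMap.comp_apply, counit_deconcat]
  simp

theorem uncons_cons (t : A ⊗[k] TensorAlgebra k A) : uncons k A (cons k A t) = t := by
  induction t with
  | zero => simp
  | add x y hx hy => rw [map_add, map_add, hx, hy]
  | tmul x y => simp

/-- An element with zero counit is determined by splitting off its first letter. Coalgebra
identities become recursive formulas for coderivations and morphisms in this way. -/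
theorem cons_uncons (w : TensorAlgebra k A) :
    algebraMap k _ (algebraMapInv w) + cons k A (uncons k A w) = w := by
  have := ext_word (k := k) (A := A)
    (f := Algebra.linearMap k _ ∘ₗ (algebraMapInv : TensorAlgebra k A →ₐ[k] k).toLinearMap +
      cons k A ∘ₗ uncons k A) (g := LinearMap.id) (by simp) (by
        intro v w _
        simp [algebraMapInv_ι])
  exact LinearMap.congr_fun this w

end TensorAlgebra

open TensorAlgebra

theorem barHead_zero (τ d : A →ₗ[k] A) (v : A) : barHead τ d 0 v = 0 := by
  apply TensorAlgebra.ext_word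
  · simp [barHead_one]
  · intro u w _; simp [barHead_ι_mul]

/-- The twisted derivation `barDiff τ d 0` of the tensor algebra. -/
theorem barDiff_zero_ι_mul (τ d : A →ₗ[k] A) (v : A) (w : TensorAlgebra k A) :
    barDiff τ d 0 (ι k v * w) = ι k (d v) * w + ι k (τ v) * barDiff τ d 0 w := by
  rw [barDiff_ι_mul, barHead_zero, LinearMap.zero_apply, add_zero]

/-! The tensor filtration -/

theorem barFiltration_mono {m n : ℕ} (h : m ≤ n) : barFiltration k A m ≤ barFiltration k A n :=
  iSup₂_le fun i hi => le_iSup₂_of_le i (hi.trans h) le_rfl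

theorem algebraMap_mem_barFiltration (n : ℕ) (r : k) :
    algebraMap k (TensorAlgebra k A) r ∈ barFiltration k A n := by
  have : algebraMap k (TensorAlgebra k A) r ∈
      (LinearMap.range (ι k : A →ₗ[k] TensorAlgebra k A)) ^ 0 := by
    rw [pow_zero, Submodule.mem_one]; exact ⟨r, rfl⟩
  exact Submodule.mem_iSup_of_mem 0 (Submodule.mem_iSup_of_mem (Nat.zero_le n) this)

theorem one_mem_barFiltration (n : ℕ) : (1 : TensorAlgebra k A) ∈ barFiltration k A n := by
  simpa using algebraMap_mem_barFiltration (A := A) n (1 : k)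

theorem ι_mul_mem_barFiltration {n : ℕ} (a : A) {w : TensorAlgebra k A}
    (hw : w ∈ barFiltration k A n) : ι k a * w ∈ barFiltration k A (n + 1) := by
  have : barFiltration k A n ≤
      (barFiltration k A (n + 1)).comap (LinearMap.mulLeft k (ι k a)) := by
    refine iSup₂_le fun i hi x hx => ?_
    refine Submodule.mem_iSup_of_mem (i + 1) (Submodule.mem_iSup_of_mem (by omega) ?_)
    rw [pow_succ']
    exact Submodule.mul_mem_mul ⟨a, rfl⟩ hx
  exact this hw

/-- Induction on words that keeps track of a length bound. The clause `mono` lets summands of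
different lengths be compared at a common bound. -/
theorem barFiltration_induction {P : ℕ → TensorAlgebra k A → Prop}
    (algebraMap : ∀ n r, P n (algebraMap k _ r))
    (add : ∀ n x y, P n x → P n y → P n (x + y))
    (ι_mul : ∀ n a w, w ∈ barFiltration k A n → P n w → P (n + 1) (ι k a * w))
    (mono : ∀ m n w, m ≤ n → P m w → P n w) {n : ℕ} {w : TensorAlgebra k A}
    (hw : w ∈ barFiltration k A n) : P n w := by
  rw [barFiltration] at hw
  induction hw using Submodule.iSup_induction' with
  | zero => simpa using algebraMap n 0
  | add x y _ _ hx hy => exact add n x y hx hy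
  | mem i x hx =>
    induction hx using Submodule.iSup_induction' with
    | zero => simpa using algebraMap n 0
    | add x y _ _ hx hy => exact add n x y hx hy
    | mem hi x hx =>
      refine mono i n x hi ?_
      induction hx using Submodule.pow_induction_on_left' with
      | algebraMap r => exact algebraMap 0 r
      | add x y i _ _ h1 h2 => exact add i x y (h1 (by omega)) (h2 (by omega))
      | mem_mul m hm i x hx ih =>
        obtain ⟨a, rfl⟩ := hm
        exact ι_mul i a x (Submodule.mem_iSup_of_mem i (Submodule.mem_iSup_of_mem le_rfl hx))
          (ih (by omega))

theorem exists_mem_barFiltration (w : TensorAlgebra k A) : ∃ n, w ∈ barFiltration k A n := by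
  induction w using TensorAlgebra.induction with
  | algebraMap r => exact ⟨0, algebraMap_mem_barFiltration 0 r⟩
  | ι a => exact ⟨1, by simpa using ι_mul_mem_barFiltration a (one_mem_barFiltration (k := k) 0)⟩
  | add x y hx hy =>
    obtain ⟨m, hm⟩ := hx
    obtain ⟨n, hn⟩ := hy
    exact ⟨max m n, add_mem (barFiltration_mono (le_max_left _ _) hm)
      (barFiltration_mono (le_max_right _ _) hn)⟩
  | mul x y hx hy =>
    obtain ⟨m, hm⟩ := hx
    obtain ⟨n, hn⟩ := hy
    refine ⟨m + n, ?_⟩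
    refine barFiltration_induction (P := fun m x => x * y ∈ barFiltration k A (m + n))
      ?_ ?_ ?_ ?_ hm
    · intro m r
      rw [← Algebra.smul_def]
      exact Submodule.smul_mem _ _ (barFiltration_mono (by omega) hn)
    · intro m x y hx hy; rw [add_mul]; exact add_mem hx hy
    · intro m a w _ hw
      rw [mul_assoc, add_right_comm]
      exact ι_mul_mem_barFiltration a hw
    · intro m m' w h hw
      exact barFiltration_mono (by omega) hw

theorem barFiltration_zero {w : TensorAlgebra k A} (hw : w ∈ barFiltration k A 0) :
    w = algebraMap k _ (algebraMapInv w) := by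
  rw [barFiltration, Submodule.mem_iSup] at hw
  have := hw (1 : Submodule k (TensorAlgebra k A)) (fun i => iSup_le fun hi => by
    obtain rfl : i = 0 := by omega
    rw [pow_zero])
  obtain ⟨r, rfl⟩ := Submodule.mem_one.mp this
  rw [algebraMap_leftInverse A r]

/-- Elements of the step one of the tensor filtration. -/
theorem barFiltration_one {w : TensorAlgebra k A} (hw : w ∈ barFiltration k A 1) :
    w = algebraMap k _ (algebraMapInv w) + ι k (ιInv w) := by
  have := barFiltration_induction
    (P := fun n w => n ≤ 1 → w = algebraMap k _ (algebraMapInv w) + ι k (ιInv w)) ?_ ?_ ?_ ?_ hw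
  · exact this le_rfl
  · intro n r _
    rw [algebraMap_leftInverse A r, Algebra.algebraMap_eq_smul_one, map_smul, ιInv_one]
    simp
  · intro n x y hx hy hn
    conv_lhs => rw [hx hn, hy hn]
    simp only [map_add]; abel
  · intro n a w hw ih hn
    obtain rfl : n = 0 := by omega
    rw [barFiltration_zero hw, ιInv_ι_mul, algebraMapInv_ι_mul, algebraMap_leftInverse]
    simp [Algebra.algebraMap_eq_smul_one]
  · exact fun m n w h hw hn => hw (h.trans hn)

/-- Replacing the prefixes of a word by letters increases the length by at most one. -/
theorem cons_map_deconcat_mem {B : Type*} [AddCommGroup B] [Module k B]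
    (f : TensorAlgebra k A →ₗ[k] TensorAlgebra k B) {n : ℕ}
    (hf : ∀ m ≤ n, ∀ w ∈ barFiltration k A m, f w ∈ barFiltration k B m)
    (φ : TensorAlgebra k A →ₗ[k] B) {w : TensorAlgebra k A} (hw : w ∈ barFiltration k A n) :
    cons k B (TensorProduct.map φ f (deconcat w)) ∈ barFiltration k B (n + 1) := by
  -- The map φ is quantified inside the induction, since moving a first letter a into the prefix
  -- replaces φ by φ(a ·). The hypothesis on `f` is only demanded up to length n so that it can
  -- serve as an induction hypothesis.
  refine barFiltration_induction (P := fun m w => m ≤ n → ∀ φ : TensorAlgebra k A →ₗ[k] B,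
    cons k B (TensorProduct.map φ f (deconcat w)) ∈ barFiltration k B (m + 1))
    ?_ ?_ ?_ ?_ hw le_rfl φ
  · intro m r hm φ
    rw [Algebra.algebraMap_eq_smul_one]
    simp only [map_smul, deconcat_one, TensorProduct.map_tmul, cons_tmul]
    exact Submodule.smul_mem _ _ (ι_mul_mem_barFiltration _ (hf m hm 1 (one_mem_barFiltration m)))
  · intro m x y hx hy hm φ
    simp only [map_add]
    exact add_mem (hx hm φ) (hy hm φ)
  · intro m a w hw ih hm φ
    rw [deconcat_ι_mul, map_add, map_add, TensorProduct.map_tmul, cons_tmul]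
    refine add_mem (ι_mul_mem_barFiltration _ (hf _ hm _ (ι_mul_mem_barFiltration a hw))) ?_
    have : TensorProduct.map φ f ((ι k a ⊗ₜ 1) * deconcat w) =
        TensorProduct.map (φ ∘ₗ LinearMap.mulLeft k (ι k a)) f (deconcat w) := by
      generalize deconcat w = z
      induction z with
      | zero => simp
      | add x y hx hy => rw [mul_add, map_add, map_add, hx, hy]
      | tmul x y => simp
    rw [this]
    exact barFiltration_mono (by omega) (ih (by omega) _)
  · intro m m' w h hw hm φ
    by_cases h' : m = m'
    · subst h'; exact hw hm φ
    · exact barFiltration_mono (by omega) (hw (by omega) φ)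

end TensorBasics

/-! ### Homogeneous components -/

section Homogeneous

variable {k A : Type*} [Field k] [AddCommGroup A] [Module k A]

open TensorAlgebra

/-- The projection onto a component of a graded space. -/
noncomputable def gradedProj (deg : ℤ → Submodule k A) (h : DirectSum.IsInternal deg) (n : ℤ) :
    A →ₗ[k] A :=
  (deg n).subtype ∘ₗ DirectSum.component k ℤ (fun n => deg n) n ∘ₗ
    (LinearEquiv.ofBijective (DirectSum.coeLinearMap deg) h).symm.toLinearMap

theorem gradedProj_mem {deg : ℤ → Submodule k A} (h : DirectSum.IsInternal deg) (n : ℤ) (a : A) :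
    gradedProj deg h n a ∈ deg n := by
  simp [gradedProj]

theorem ofBijective_symm_of_mem {I : Type*} [DecidableEq I] {deg : I → Submodule k A}
    (h : DirectSum.IsInternal deg) {n : I} {a : A} (ha : a ∈ deg n) :
    (LinearEquiv.ofBijective (DirectSum.coeLinearMap deg) h).symm a =
      DirectSum.lof k I (fun n => deg n) n ⟨a, ha⟩ := by
  rw [LinearEquiv.symm_apply_eq]
  exact (DirectSum.coeLinearMap_lof deg n (⟨a, ha⟩ : deg n)).symm

theorem gradedProj_of_mem {deg : ℤ → Submodule k A} (h : DirectSum.IsInternal deg) {n : ℤ} {a : A}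
    (ha : a ∈ deg n) : gradedProj deg h n a = a := by
  simp [gradedProj, ofBijective_symm_of_mem h ha, DirectSum.component.lof_self]

theorem gradedProj_of_mem_ne {deg : ℤ → Submodule k A} (h : DirectSum.IsInternal deg) {m n : ℤ}
    {a : A} (ha : a ∈ deg m) (hmn : m ≠ n) : gradedProj deg h n a = 0 := by
  simp [gradedProj, ofBijective_symm_of_mem h ha, DirectSum.component.of, hmn]

/-- The diagonal map which acts on the `i`-th summand as multiplication by `c i`. -/
noncomputable def diagonalMap {I : Type*} [DecidableEq I] {g : I → Submodule k A}
    (h : DirectSum.IsInternal g) (c : I → k) : A →ₗ[k] A :=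
  DirectSum.toModule k I A (fun i => c i • (g i).subtype) ∘ₗ
    (LinearEquiv.ofBijective (DirectSum.coeLinearMap g) h).symm.toLinearMap

theorem diagonalMap_apply {I : Type*} [DecidableEq I] {g : I → Submodule k A}
    (h : DirectSum.IsInternal g) (c : I → k) {i : I} {a : A} (ha : a ∈ g i) :
    diagonalMap h c a = c i • a := by
  simp [diagonalMap, ofBijective_symm_of_mem h ha]

/-- A homogeneous map commutes with the projections onto components. -/
theorem gradedProj_comm {B : Type*} [AddCommGroup B] [Module k B] {deg : ℤ → Submodule k A}
    {deg' : ℤ → Submodule k B} (h : DirectSum.IsInternal deg) (h' : DirectSum.IsInternal deg')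
    {f : A →ₗ[k] B} {e : ℤ} (hf : ∀ n, ∀ a ∈ deg n, f a ∈ deg' (n + e)) (n : ℤ) (a : A) :
    gradedProj deg' h' (n + e) (f a) = f (gradedProj deg h n a) := by
  have := ext_homogeneous h (f := gradedProj deg' h' (n + e) ∘ₗ f)
    (g := f ∘ₗ gradedProj deg h n) (by
      intro m a ha
      simp only [LinearMap.comp_apply]
      by_cases hmn : m = n
      · subst hmn
        rw [gradedProj_of_mem h ha, gradedProj_of_mem h' (hf m a ha)]
      · rw [gradedProj_of_mem_ne h ha hmn, gradedProj_of_mem_ne h' (hf m a ha) (by omega),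
          map_zero])
  exact LinearMap.congr_fun this a

theorem shiftSign_shiftSign {deg : ℤ → Submodule k A} (h : DirectSum.IsInternal deg) (a : A) :
    shiftSign deg h (shiftSign deg h a) = a := by
  have := ext_homogeneous h (f := shiftSign deg h ∘ₗ shiftSign deg h) (g := LinearMap.id) (by
    intro n a ha
    rw [LinearMap.comp_apply, shiftSign_apply h ha, map_zsmul, shiftSign_apply h ha,
      NonUnitalDGAlgebra.negOnePow_smul_smul, LinearMap.id_apply])
  exact LinearMap.congr_fun this a

/-- A map of degree zero commutes with the parity operators. -/
theorem shiftSign_comm {B : Type*} [AddCommGroup B] [Module k B] {deg : ℤ → Submodule k A}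
    {deg' : ℤ → Submodule k B} (h : DirectSum.IsInternal deg) (h' : DirectSum.IsInternal deg')
    {f : A →ₗ[k] B} (hf : ∀ n, ∀ a ∈ deg n, f a ∈ deg' n) (a : A) :
    shiftSign deg' h' (f a) = f (shiftSign deg h a) := by
  have := ext_homogeneous h (f := shiftSign deg' h' ∘ₗ f) (g := f ∘ₗ shiftSign deg h) (by
    intro n a ha
    rw [LinearMap.comp_apply, LinearMap.comp_apply, shiftSign_apply h ha,
      shiftSign_apply h' (hf n a ha), map_zsmul])
  exact LinearMap.congr_fun this a

/-- A map of degree one anticommutes with the parity operator. -/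
theorem shiftSign_anticomm {deg : ℤ → Submodule k A} (h : DirectSum.IsInternal deg)
    {d : A →ₗ[k] A} (hd : ∀ n, ∀ a ∈ deg n, d a ∈ deg (n + 1)) (a : A) :
    shiftSign deg h (d a) = - d (shiftSign deg h a) := by
  have := ext_homogeneous h (f := shiftSign deg h ∘ₗ d) (g := -(d ∘ₗ shiftSign deg h)) (by
    intro n a ha
    rw [LinearMap.comp_apply, LinearMap.neg_apply, LinearMap.comp_apply, shiftSign_apply h ha,
      shiftSign_apply h (hd n a ha), map_zsmul, add_sub_right_comm, Int.negOnePow_succ]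
    simp)
  exact LinearMap.congr_fun this a

theorem algebraMapInv_of_mem_barDegree {deg : ℤ → Submodule k A} {n : ℤ} (hn : n ≠ 0)
    {w : TensorAlgebra k A} (hw : w ∈ barDegree deg n) : algebraMapInv w = 0 := by
  induction hw using Submodule.span_induction with
  | zero => simp
  | add x y _ _ hx hy => rw [map_add, hx, hy, add_zero]
  | smul c x _ hx => rw [map_smul, hx, smul_zero]
  | mem x hx =>
    cases hx with
    | nil => exact absurd rfl hn
    | cons ha hw => exact algebraMapInv_ι_mul _ _

theorem ιInv_mem_of_mem_barDegree {deg : ℤ → Submodule k A} {n : ℤ} {w : TensorAlgebra k A}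
    (hw : w ∈ barDegree deg n) : ιInv w ∈ deg (n + 1) := by
  induction hw using Submodule.span_induction with
  | zero => simp
  | add x y _ _ hx hy => rw [map_add]; exact add_mem hx hy
  | smul c x _ hx => rw [map_smul]; exact Submodule.smul_mem _ _ hx
  | mem x hx =>
    cases hx with
    | nil => rw [ιInv_one]; exact zero_mem _
    | @cons p m a w ha hw =>
      rw [ιInv_ι_mul]
      -- Only tails of bar degree 0 can have a nonzero constant term.
      by_cases hm : m = 0
      · subst hm
        rw [show p - 1 + 0 + 1 = p by ring]
        exact Submodule.smul_mem _ _ ha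
      · rw [algebraMapInv_of_mem_barDegree hm (Submodule.subset_span hw), zero_smul]
        exact zero_mem _

theorem ι_mem_barDegree {deg : ℤ → Submodule k A} {n : ℤ} {a : A} (ha : a ∈ deg n) :
    ι k a ∈ barDegree deg (n - 1) := by
  have := ι_mul_mem_barDegree ha (Submodule.subset_span IsBarWord.nil)
  simpa using this

theorem deconcat_counit (w : TensorAlgebra k A) :
    (algebraMapInv : TensorAlgebra k A →ₐ[k] k).toLinearMap.lTensor _ (deconcat w) = w ⊗ₜ 1 := by
  have := ext_word (k := k) (A := A)
    (f := (algebraMapInv : TensorAlgebra k A →ₐ[k] k).toLinearMap.lTensor _ ∘ₗ deconcat)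
    (g := (TensorProduct.mk k _ _).flip 1) (by simp) (by
      intro v w hw
      simp only [LinearMap.comp_apply, deconcat_ι_mul, map_add, LinearMap.lTensor_tmul,
        LinearMap.flip_apply, TensorProduct.mk_apply, AlgHom.toLinearMap_apply,
        algebraMapInv_ι_mul, TensorProduct.tmul_zero, zero_add] at hw ⊢
      have : ∀ z : TensorAlgebra k A ⊗[k] TensorAlgebra k A,
          (algebraMapInv : TensorAlgebra k A →ₐ[k] k).toLinearMap.lTensor _
            ((ι k v ⊗ₜ 1) * z) = (LinearMap.mulLeft k (ι k v)).rTensor _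
              ((algebraMapInv : TensorAlgebra k A →ₐ[k] k).toLinearMap.lTensor _ z) := by
        intro z
        induction z with
        | zero => simp
        | add x y hx hy => rw [mul_add, map_add, map_add, map_add, hx, hy]
        | tmul x y => simp
      rw [this, hw]; simp)
  exact LinearMap.congr_fun this w

theorem algebraMapInv_barSign (deg : ℤ → Submodule k A) (h : DirectSum.IsInternal deg)
    (w : TensorAlgebra k A) : algebraMapInv (barSign deg h w) = algebraMapInv w := by
  have : (algebraMapInv : TensorAlgebra k A →ₐ[k] k).comp
      (TensorAlgebra.lift k (TensorAlgebra.ι k ∘ₗ shiftSign deg h)) = algebraMapInv := by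
    ext a; simp [algebraMapInv]
  exact DFunLike.congr_fun this w

theorem barSign_one (deg : ℤ → Submodule k A) (h : DirectSum.IsInternal deg) :
    barSign deg h 1 = 1 := by
  simp [barSign]

theorem ιInv_barSign (deg : ℤ → Submodule k A) (h : DirectSum.IsInternal deg)
    (w : TensorAlgebra k A) : ιInv (barSign deg h w) = shiftSign deg h (ιInv w) := by
  have := ext_word (k := k) (A := A) (f := ιInv ∘ₗ barSign deg h) (g := shiftSign deg h ∘ₗ ιInv)
    (by simp [barSign_one, ιInv_one]) (by
      intro v w _
      simp [barSign_ι_mul, ιInv_ι_mul, algebraMapInv_barSign])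
  exact LinearMap.congr_fun this w

end Homogeneous

/-! ### Taylor expansions of codifferentials and morphisms -/

namespace AInfinityAlgebra


open TensorAlgebra

variable {k : Type u} [Field k]

/-- The parity operator of `A[1]`. -/
noncomputable def sign (A : AInfinityAlgebra.{u, v} k) : A.carrier →ₗ[k] A.carrier :=
  shiftSign A.deg A.isInternal

section Codifferential

variable (A : AInfinityAlgebra.{u, v} k)

/-- Applying the counit ε to the left factor of the coderivation identity gives 1 ⊗ Dw = (εD ⊗ id)Δw
+ 1 ⊗ Dw. Hence (εD ⊗ id)Δw = 0, and the counit on the right factor leaves εDw = 0. -/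
theorem algebraMapInv_D (w : TensorAlgebra k A.carrier) : algebraMapInv (A.D w) = 0 := by
  set ε := (algebraMapInv : TensorAlgebra k A.carrier →ₐ[k] k).toLinearMap with hε
  have h1 := congrArg (ε.rTensor _) (LinearMap.congr_fun A.coderivation w)
  have h2 : ε.rTensor _ ∘ₗ (TensorProduct.map A.D LinearMap.id +
      TensorProduct.map (barSign A.deg A.isInternal) A.D) =
      (ε ∘ₗ A.D).rTensor _ + A.D.lTensor _ ∘ₗ ε.rTensor _ := by
    apply TensorProduct.ext'
    intro x y
    simp [hε, algebraMapInv_barSign]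
  have h2w := LinearMap.congr_fun h2 (deconcat w)
  simp only [LinearMap.comp_apply] at h1 h2w
  rw [h2w, LinearMap.add_apply, LinearMap.comp_apply, hε,
    counit_deconcat, counit_deconcat, LinearMap.lTensor_tmul, right_eq_add, ← hε] at h1
  have h3 := congrArg (ε.lTensor _) h1
  have h4 : ε.lTensor _ ∘ₗ (ε ∘ₗ A.D).rTensor _ = (ε ∘ₗ A.D).rTensor _ ∘ₗ ε.lTensor _ := by
    apply TensorProduct.ext'
    intro x y
    simp
  rw [← LinearMap.comp_apply, h4, LinearMap.comp_apply, hε, deconcat_counit, map_zero] at h3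
  simpa using congrArg (TensorProduct.lid k k) h3

/-- The Taylor expansion of the codifferential. -/
theorem D_ι_mul (v : A.carrier) (w : TensorAlgebra k A.carrier) :
    A.D (ι k v * w) = ι k (A.sign v) * A.D w +
      cons k _ ((ιInv ∘ₗ A.D ∘ₗ LinearMap.mulLeft k (ι k v)).rTensor _ (deconcat w)) := by
  -- Projecting the left factor of the coderivation identity to letters computes the first letter of
  -- D(v w); since the counit of D vanishes, this determines D(v w).
  have h1 := congrArg (ιInv.rTensor _) (LinearMap.congr_fun A.coderivation (ι k v * w))
  have h2 : ιInv.rTensor _ ∘ₗ (TensorProduct.map A.D LinearMap.id +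
      TensorProduct.map (barSign A.deg A.isInternal) A.D) =
      (ιInv ∘ₗ A.D).rTensor _ + TensorProduct.map A.sign A.D ∘ₗ ιInv.rTensor _ := by
    apply TensorProduct.ext'
    intro x y
    simp [ιInv_barSign, sign]
  have h2w := LinearMap.congr_fun h2 (deconcat (ι k v * w))
  simp only [LinearMap.comp_apply] at h1 h2w
  rw [h2w, LinearMap.add_apply, LinearMap.comp_apply] at h1
  change uncons k _ _ = _ + TensorProduct.map A.sign A.D (uncons k _ _) at h1
  rw [uncons_ι_mul, deconcat_ι_mul, map_add, LinearMap.rTensor_tmul, LinearMap.comp_apply, A.D_one,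
    map_zero, TensorProduct.zero_tmul, zero_add, rTensor_ι_mul] at h1
  have h3 := cons_uncons (A.D (ι k v * w))
  rw [A.algebraMapInv_D, map_zero, zero_add, h1, map_add, TensorProduct.map_tmul, cons_tmul] at h3
  rw [← h3, add_comm]
  rfl

theorem D_ι (a : A.carrier) : A.D (ι k a) = ι k (A.m₁ a) := by
  have := A.D_ι_mul a 1
  simpa [A.D_one, m₁] using this

/-- The linear part of the codifferential, as a derivation of the tensor algebra. -/
noncomputable def linearPart : TensorAlgebra k A.carrier →ₗ[k] TensorAlgebra k A.carrier :=
  barDiff A.sign A.m₁ 0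

/-- The operations with at least two inputs shorten words, so modulo shorter words only m₁ acts. At
n = 0 the truncated n - 1 is harmless because both maps kill constants. -/
theorem D_sub_linearPart_mem {n : ℕ} {w : TensorAlgebra k A.carrier}
    (hw : w ∈ barFiltration k A.carrier n) :
    A.D w - A.linearPart w ∈ barFiltration k A.carrier (n - 1) := by
  -- Among the prefixes starting with v, the prefix v alone contributes m₁(v) w; every longer one
  -- replaces at least two letters by one.
  have key : ∀ (n : ℕ) (v : A.carrier) (w : TensorAlgebra k A.carrier),
      w ∈ barFiltration k A.carrier n →
      cons k _ ((ιInv ∘ₗ A.D ∘ₗ LinearMap.mulLeft k (ι k v)).rTensor _ (deconcat w)) -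
        ι k (A.m₁ v) * w ∈ barFiltration k A.carrier n := by
    intro n v w hw
    refine barFiltration_induction (P := fun n w => cons k _ ((ιInv ∘ₗ A.D ∘ₗ
      LinearMap.mulLeft k (ι k v)).rTensor _ (deconcat w)) - ι k (A.m₁ v) * w ∈
        barFiltration k A.carrier n) ?_ ?_ ?_ ?_ hw
    · intro n r
      simp [Algebra.algebraMap_eq_smul_one, m₁]
    · intro n x y hx hy
      simp only [map_add, mul_add, add_sub_add_comm]
      exact add_mem hx hy
    · intro n u w hw _
      rw [deconcat_ι_mul, map_add, LinearMap.rTensor_tmul, map_add, cons_tmul, rTensor_ι_mul]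
      rw [show (ιInv ∘ₗ A.D ∘ₗ LinearMap.mulLeft k (ι k v)) 1 = A.m₁ v by simp [m₁],
        add_sub_cancel_left]
      exact cons_map_deconcat_mem LinearMap.id (fun _ _ _ h => h) _ hw
    · intro m n w h hw
      exact barFiltration_mono h hw
  refine barFiltration_induction (P := fun n w => A.D w - A.linearPart w ∈
      barFiltration k A.carrier (n - 1)) ?_ ?_ ?_ ?_ hw
  · intro n r
    simp [Algebra.algebraMap_eq_smul_one, A.D_one, linearPart, barDiff_one]
  · intro n x y hx hy
    simp only [map_add, add_sub_add_comm]
    exact add_mem hx hy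
  · intro n v w hw ih
    have h1 : A.D (ι k v * w) - A.linearPart (ι k v * w) =
        ι k (A.sign v) * (A.D w - A.linearPart w) +
        (cons k _ ((ιInv ∘ₗ A.D ∘ₗ LinearMap.mulLeft k (ι k v)).rTensor _ (deconcat w)) -
          ι k (A.m₁ v) * w) := by
      rw [A.D_ι_mul, linearPart, barDiff_zero_ι_mul, mul_sub]; abel
    rw [h1]
    refine add_mem ?_ (key n v w hw)
    -- For n = 0 the subtraction is truncated and n - 1 + 1 ≠ n; there w is a constant.
    rcases Nat.eq_zero_or_pos n with rfl | hn
    · rw [barFiltration_zero hw]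
      simp [Algebra.algebraMap_eq_smul_one, A.D_one, linearPart, barDiff_one]
    · have := ι_mul_mem_barFiltration (A.sign v) ih
      exact barFiltration_mono (by omega) this
  · intro m n w h hw
    exact barFiltration_mono (by omega) hw

theorem m₁_mem (n : ℤ) (a : A.carrier) (ha : a ∈ A.deg n) : A.m₁ a ∈ A.deg (n + 1) := by
  have := ιInv_mem_of_mem_barDegree (A.D_mem _ _ (ι_mem_barDegree ha))
  rwa [A.D_ι, ι_leftInverse, show n - 1 + 1 + 1 = n + 1 by ring] at this

theorem m₁_m₁ (a : A.carrier) : A.m₁ (A.m₁ a) = 0 := by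
  have := A.D_D (ι k a)
  rwa [A.D_ι, A.D_ι, map_eq_zero_iff _ (ι_leftInverse (R := k)).injective] at this

theorem sign_sign (a : A.carrier) : A.sign (A.sign a) = a :=
  shiftSign_shiftSign A.isInternal a

theorem sign_m₁ (a : A.carrier) : A.sign (A.m₁ a) = - A.m₁ (A.sign a) :=
  shiftSign_anticomm A.isInternal A.m₁_mem a

end Codifferential

section Morphism

variable {A B : AInfinityAlgebra.{u, v} k} (f : Hom A B)

/-- The Taylor expansion of a morphism. -/
theorem Hom.map_ι_mul (v : A.carrier) (w : TensorAlgebra k A.carrier) :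
    f.toFun (ι k v * w) = cons k _ (TensorProduct.map
      (ιInv ∘ₗ f.toFun ∘ₗ LinearMap.mulLeft k (ι k v)) f.toFun (deconcat w)) := by
  have h1 := congrArg (ιInv.rTensor _) (LinearMap.congr_fun f.comul (ι k v * w))
  simp only [LinearMap.comp_apply] at h1
  change uncons k _ _ = _ at h1
  rw [deconcat_ι_mul, map_add, TensorProduct.map_tmul, map_add, LinearMap.rTensor_tmul, f.map_one,
    ιInv_one, TensorProduct.zero_tmul, zero_add] at h1
  have h2 : ∀ z, ιInv.rTensor _ (TensorProduct.map f.toFun f.toFun ((ι k v ⊗ₜ 1) * z)) =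
      TensorProduct.map (ιInv ∘ₗ f.toFun ∘ₗ LinearMap.mulLeft k (ι k v)) f.toFun z := by
    intro z
    induction z with
    | zero => simp
    | add x y hx hy => rw [mul_add, map_add, map_add, map_add, hx, hy]
    | tmul x y => simp
  have h3 := cons_uncons (f.toFun (ι k v * w))
  rwa [f.counit, algebraMapInv_ι_mul, map_zero, zero_add, h1, h2, eq_comm] at h3

theorem Hom.map_ι (a : A.carrier) : f.toFun (ι k a) = ι k (f.f₁ a) := by
  have := f.map_ι_mul a 1
  simpa [f.map_one, f₁] using this

/-- The Taylor expansion replaces a nonempty prefix by one letter and applies f to a strictly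
shorter remainder, so strong induction on the length applies. -/
theorem Hom.map_mem_barFiltration {n : ℕ} {w : TensorAlgebra k A.carrier}
    (hw : w ∈ barFiltration k A.carrier n) : f.toFun w ∈ barFiltration k B.carrier n := by
  induction n using Nat.strong_induction_on generalizing w with
  | _ n IH =>
  refine barFiltration_induction (P := fun m w => m ≤ n → f.toFun w ∈ barFiltration k B.carrier m)
    ?_ ?_ ?_ ?_ hw le_rfl
  · intro m r _
    rw [Algebra.algebraMap_eq_smul_one, map_smul, f.map_one]
    exact Submodule.smul_mem _ _ (one_mem_barFiltration m)
  · intro m x y hx hy hm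
    rw [map_add]; exact add_mem (hx hm) (hy hm)
  · intro m v w hw _ hm
    rw [f.map_ι_mul]
    exact cons_map_deconcat_mem f.toFun (fun l hl x hx => IH l (by omega) hx) _ hw
  · intro m m' w h hw hm
    exact barFiltration_mono h (hw (h.trans hm))

/-- The higher Taylor components merge at least two letters into one; modulo shorter words, f
applies f₁ to each letter. -/
theorem Hom.map_sub_map_f₁_mem {n : ℕ} {w : TensorAlgebra k A.carrier}
    (hw : w ∈ barFiltration k A.carrier n) :
    f.toFun w - TensorAlgebra.lift k (ι k ∘ₗ f.f₁) w ∈ barFiltration k B.carrier (n - 1) := by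
  have key : ∀ (n : ℕ) (v : A.carrier) (w : TensorAlgebra k A.carrier),
      w ∈ barFiltration k A.carrier n →
      f.toFun (ι k v * w) - ι k (f.f₁ v) * f.toFun w ∈ barFiltration k B.carrier n := by
    intro n v w hw
    refine barFiltration_induction (P := fun n w => f.toFun (ι k v * w) -
      ι k (f.f₁ v) * f.toFun w ∈ barFiltration k B.carrier n) ?_ ?_ ?_ ?_ hw
    · intro n r
      simp [Algebra.algebraMap_eq_smul_one, f.map_one, f.map_ι]
    · intro n x y hx hy
      simp only [map_add, mul_add, add_sub_add_comm]
      exact add_mem hx hy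
    · intro n u w hw _
      rw [f.map_ι_mul, deconcat_ι_mul, map_add, TensorProduct.map_tmul, map_add, cons_tmul]
      rw [show (ιInv ∘ₗ f.toFun ∘ₗ LinearMap.mulLeft k (ι k v)) 1 = f.f₁ v by simp [f₁],
        add_sub_cancel_left]
      have h2 : ∀ z, TensorProduct.map (ιInv ∘ₗ f.toFun ∘ₗ LinearMap.mulLeft k (ι k v)) f.toFun
          ((ι k u ⊗ₜ 1) * z) = TensorProduct.map ((ιInv ∘ₗ f.toFun ∘ₗ
            LinearMap.mulLeft k (ι k v)) ∘ₗ LinearMap.mulLeft k (ι k u)) f.toFun z := by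
        intro z
        induction z with
        | zero => simp
        | add x y hx hy => rw [mul_add, map_add, map_add, hx, hy]
        | tmul x y => simp
      rw [h2]
      exact cons_map_deconcat_mem f.toFun (fun _ _ _ h => f.map_mem_barFiltration h) _ hw
    · intro m n w h hw
      exact barFiltration_mono h hw
  refine barFiltration_induction (P := fun n w => f.toFun w -
      TensorAlgebra.lift k (ι k ∘ₗ f.f₁) w ∈ barFiltration k B.carrier (n - 1)) ?_ ?_ ?_ ?_ hw
  · intro n r
    simp [Algebra.algebraMap_eq_smul_one, f.map_one]
  · intro n x y hx hy
    simp only [map_add, add_sub_add_comm]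
    exact add_mem hx hy
  · intro n v w hw ih
    have h1 : f.toFun (ι k v * w) - TensorAlgebra.lift k (ι k ∘ₗ f.f₁) (ι k v * w) =
        ι k (f.f₁ v) * (f.toFun w - TensorAlgebra.lift k (ι k ∘ₗ f.f₁) w) +
        (f.toFun (ι k v * w) - ι k (f.f₁ v) * f.toFun w) := by
      rw [map_mul (TensorAlgebra.lift k (ι k ∘ₗ f.f₁)), lift_ι_apply, mul_sub,
        LinearMap.comp_apply]
      abel
    rw [h1]
    refine add_mem ?_ (key n v w hw)
    rcases Nat.eq_zero_or_pos n with rfl | hn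
    · rw [barFiltration_zero hw]
      simp [Algebra.algebraMap_eq_smul_one, f.map_one]
    · have := ι_mul_mem_barFiltration (f.f₁ v) ih
      exact barFiltration_mono (by omega) this
  · intro m n w h hw
    exact barFiltration_mono (by omega) hw

theorem Hom.f₁_mem (n : ℤ) (a : A.carrier) (ha : a ∈ A.deg n) : f.f₁ a ∈ B.deg n := by
  have := ιInv_mem_of_mem_barDegree (f.map_mem _ _ (ι_mem_barDegree ha))
  rwa [f.map_ι, ι_leftInverse, show n - 1 + 1 = n by ring] at this

theorem Hom.f₁_m₁ (a : A.carrier) : f.f₁ (A.m₁ a) = B.m₁ (f.f₁ a) := by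
  have := f.map_D (ι k a)
  rw [A.D_ι, f.map_ι, f.map_ι, B.D_ι] at this
  exact (ι_leftInverse (R := k)).injective this

theorem Hom.f₁_sign (a : A.carrier) : B.sign (f.f₁ a) = f.f₁ (A.sign a) :=
  shiftSign_comm A.isInternal B.isInternal f.f₁_mem a

end Morphism

end AInfinityAlgebra

/-! ### Contractions and homotopy inverses over a field -/

section Homotopy

variable {k A B C : Type*} [Field k] [AddCommGroup A] [Module k A] [AddCommGroup B] [Module k B]
  [AddCommGroup C] [Module k C]

/-- An exact differential on a vector space has a contracting homotopy. -/
theorem exists_contraction (δ : C →ₗ[k] C) (hδ : ∀ c, δ (δ c) = 0)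
    (hex : ∀ c, δ c = 0 → ∃ c', δ c' = c) :
    ∃ s : C →ₗ[k] C, ∀ c, s (δ c) + δ (s c) = c := by
  -- A section σ₀ of δ over its image and a projection p onto that image, both available because k
  -- is a field.
  obtain ⟨σ₀, hσ₀⟩ := LinearMap.exists_rightInverse_of_surjective δ.rangeRestrict
    δ.range_rangeRestrict
  obtain ⟨p, hp⟩ := LinearMap.exists_leftInverse_of_injective (LinearMap.range δ).subtype
    (Submodule.ker_subtype _)
  have hσ : ∀ c, δ (σ₀ (p (δ c))) = δ c := by
    intro c
    have h1 : p (δ c) = ⟨δ c, c, rfl⟩ := LinearMap.congr_fun hp (⟨δ c, c, rfl⟩ : LinearMap.range δ)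
    rw [h1]
    exact congrArg Subtype.val
      (LinearMap.congr_fun hσ₀ (⟨δ c, c, rfl⟩ : LinearMap.range δ))
  -- The factor id - σ₀pδ projects onto the cocycles, which are coboundaries by exactness and are
  -- lifted by σ₀p. So δs = id - σ₀pδ, while sδ = σ₀pδ.
  refine ⟨σ₀ ∘ₗ p ∘ₗ (LinearMap.id - σ₀ ∘ₗ p ∘ₗ δ), fun c => ?_⟩
  obtain ⟨c', hc'⟩ := hex (c - σ₀ (p (δ c))) (by rw [map_sub, hσ, sub_self])
  have h2 : δ (σ₀ (p (c - σ₀ (p (δ c))))) = c - σ₀ (p (δ c)) := by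
    rw [← hc', hσ]
  simp only [LinearMap.comp_apply, LinearMap.sub_apply, LinearMap.id_apply, hδ, map_zero,
    sub_zero] at h2 ⊢
  rw [h2]
  abel

/-- A contracting homotopy may be chosen to anticommute with a parity operator. -/
theorem exists_odd_contraction [CharZero k] (δ σ : C →ₗ[k] C) (hδ : ∀ c, δ (δ c) = 0)
    (hσ : ∀ c, σ (σ c) = c) (hσδ : ∀ c, σ (δ c) = - δ (σ c))
    (hex : ∀ c, δ c = 0 → ∃ c', δ c' = c) :
    ∃ s : C →ₗ[k] C, (∀ c, s (δ c) + δ (s c) = c) ∧ ∀ c, s (σ c) = - σ (s c) := by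
  obtain ⟨s, hs⟩ := exists_contraction δ hδ hex
  -- As σ anticommutes with δ, the map -σsσ is again a contraction; the average of the two is odd.
  refine ⟨(2⁻¹ : k) • (s - σ ∘ₗ s ∘ₗ σ), fun c => ?_, fun c => ?_⟩
  · have h1 := hs c
    have h2 := congrArg σ (hs (σ c))
    rw [map_add, hσ, hσδ] at h2
    simp only [LinearMap.smul_apply, LinearMap.sub_apply, LinearMap.comp_apply, map_smul, map_sub,
      hσδ, map_neg, ← smul_add] at h2 ⊢
    linear_combination (norm := module) (2⁻¹ : k) • h1 + (2⁻¹ : k) • h2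
  · simp only [LinearMap.smul_apply, LinearMap.sub_apply, LinearMap.comp_apply, map_smul, map_sub,
      hσ, ← smul_neg, neg_sub]

/-- A quasi-isomorphism of complexes of vector spaces has a homotopy inverse, compatible with the
parity operators. -/
theorem exists_homotopyInverse [CharZero k] (dA τA : A →ₗ[k] A) (dB τB : B →ₗ[k] B)
    (f : A →ₗ[k] B) (hdA : ∀ a, dA (dA a) = 0) (hdB : ∀ b, dB (dB b) = 0)
    (hτA : ∀ a, τA (τA a) = a) (hτB : ∀ b, τB (τB b) = b)
    (hτdA : ∀ a, τA (dA a) = - dA (τA a)) (hτdB : ∀ b, τB (dB b) = - dB (τB b))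
    (hf : ∀ a, f (dA a) = dB (f a)) (hτf : ∀ a, τB (f a) = f (τA a))
    (hinj : ∀ a, dA a = 0 → f a ∈ LinearMap.range dB → a ∈ LinearMap.range dA)
    (hsurj : ∀ b, dB b = 0 → ∃ a, dA a = 0 ∧ f a - b ∈ LinearMap.range dB) :
    ∃ (g : B →ₗ[k] A) (hA : A →ₗ[k] A) (hB : B →ₗ[k] B),
      (∀ b, g (dB b) = dA (g b)) ∧ (∀ b, τA (g b) = g (τB b)) ∧
      (∀ a, τA (hA a) = - hA (τA a)) ∧ (∀ b, τB (hB b) = - hB (τB b)) ∧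
      (∀ a, dA (hA a) + hA (dA a) = g (f a) - a) ∧
      (∀ b, dB (hB b) + hB (dB b) = f (g b) - b) := by
  -- The mapping cone of f with its differential and parity operator. It is exact because f is a
  -- quasi-isomorphism, and the components of an odd contraction provide the inverse and both
  -- homotopies.
  let δ : A × B →ₗ[k] A × B :=
    (-(dA ∘ₗ LinearMap.fst k A B)).prod (f ∘ₗ LinearMap.fst k A B + dB ∘ₗ LinearMap.snd k A B)
  let σ : A × B →ₗ[k] A × B := (-(τA ∘ₗ LinearMap.fst k A B)).prod (τB ∘ₗ LinearMap.snd k A B)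
  have δ_apply : ∀ a b, δ (a, b) = (- dA a, f a + dB b) := fun a b => rfl
  have σ_apply : ∀ a b, σ (a, b) = (- τA a, τB b) := fun a b => rfl
  obtain ⟨s, hs, hsσ⟩ := exists_odd_contraction δ σ
    (by rintro ⟨a, b⟩; simp [δ_apply, hdA, hdB, hf])
    (by rintro ⟨a, b⟩; simp [σ_apply, hτA, hτB])
    (by rintro ⟨a, b⟩; simp [δ_apply, σ_apply, hτdA, hτdB, hτf, add_comm])
    (by
      rintro ⟨a, b⟩ hab
      rw [δ_apply, Prod.mk_eq_zero, neg_eq_zero] at hab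
      -- A cocycle (a, b) satisfies da = 0 and f a = -db. Injectivity gives a = d a₀; surjectivity
      -- then writes the cocycle b + f a₀ as f c - d e.
      obtain ⟨a₀, rfl⟩ := hinj a hab.1 ⟨-b, by rw [map_neg, ← add_eq_zero_iff_neg_eq', hab.2]⟩
      obtain ⟨c, hc, e, he⟩ := hsurj (b + f a₀) (by rw [map_add, ← hf, add_comm]; exact hab.2)
      refine ⟨(c - a₀, -e), ?_⟩
      rw [δ_apply, map_sub, map_sub, hc, map_neg, he]
      ext
      · simp
      · simp)
  have hsA : ∀ a, s (- dA a, f a) + δ (s (a, 0)) = (a, 0) := by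
    intro a; simpa [δ_apply] using hs (a, 0)
  have hsB : ∀ b, s (0, dB b) + δ (s (0, b)) = (0, b) := by
    intro b; simpa [δ_apply] using hs (0, b)
  have split : ∀ a b, s (a, b) = s (a, 0) + s (0, b) := by
    intro a b; rw [← map_add]; simp
  have sneg : ∀ a, s (-a, 0) = - s (a, 0) := by
    intro a; rw [← map_neg]; simp
  have hσ1 : ∀ p : A × B, (σ p).1 = - τA p.1 := fun p => rfl
  have hσ2 : ∀ p : A × B, (σ p).2 = τB p.2 := fun p => rfl
  have hδ1 : ∀ p : A × B, (δ p).1 = - dA p.1 := fun p => rfl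
  have hδ2 : ∀ p : A × B, (δ p).2 = f p.1 + dB p.2 := fun p => rfl
  -- The inverse is the component of s from B to A; the homotopies are its diagonal components, with
  -- a sign on B because the cone carries -dA and +dB.
  refine ⟨LinearMap.fst k A B ∘ₗ s ∘ₗ LinearMap.inr k A B,
    LinearMap.fst k A B ∘ₗ s ∘ₗ LinearMap.inl k A B,
    -(LinearMap.snd k A B ∘ₗ s ∘ₗ LinearMap.inr k A B), ?_, ?_, ?_, ?_, ?_, ?_⟩
  · intro b
    have := congrArg Prod.fst (hsB b)
    simp only [Prod.fst_add, hδ1] at this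
    simpa using sub_eq_zero.mp (by rw [sub_eq_add_neg]; exact this)
  · intro b
    have := congrArg Prod.fst (hsσ (0, b))
    rw [σ_apply, map_zero, neg_zero, Prod.fst_neg, hσ1, neg_neg] at this
    exact this.symm
  · intro a
    have := congrArg Prod.fst (hsσ (a, 0))
    rw [σ_apply, map_zero, sneg, Prod.fst_neg, Prod.fst_neg, hσ1, neg_neg] at this
    exact this.symm
  · intro b
    have := congrArg Prod.snd (hsσ (0, b))
    rw [σ_apply, map_zero, neg_zero, Prod.snd_neg, hσ2] at this
    simp only [LinearMap.comp_apply, LinearMap.inr_apply, LinearMap.snd_apply, LinearMap.neg_apply,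
      map_neg, neg_neg]
    exact this.symm
  · intro a
    have := congrArg Prod.fst (hsA a)
    rw [split, sneg, Prod.fst_add, Prod.fst_add, hδ1, Prod.fst_neg] at this
    simp only [LinearMap.comp_apply, LinearMap.inl_apply, LinearMap.inr_apply,
      LinearMap.fst_apply] at this ⊢
    linear_combination (norm := module) (-1 : k) • this
  · intro b
    have := congrArg Prod.snd (hsB b)
    rw [Prod.snd_add, hδ2] at this
    simp only [LinearMap.comp_apply, LinearMap.inr_apply, LinearMap.fst_apply, LinearMap.snd_apply,
      LinearMap.neg_apply, map_neg] at this ⊢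
    linear_combination (norm := module) (-1 : k) • this

open TensorAlgebra

/-- Extension of a homotopy between `p` and the identity to the tensor algebra. -/
theorem barDiff_homotopy (d τ p h : A →ₗ[k] A) (hττ : ∀ a, τ (τ a) = a)
    (hτd : ∀ a, τ (d a) = - d (τ a)) (hτp : ∀ a, τ (p a) = p (τ a)) (hpd : ∀ a, p (d a) = d (p a))
    (hτh : ∀ a, τ (h a) = - h (τ a)) (hh : ∀ a, d (h a) + h (d a) = p a - a)
    (w : TensorAlgebra k A) :
    barDiff τ d 0 (barDiff (τ ∘ₗ p) h 0 w) + barDiff (τ ∘ₗ p) h 0 (barDiff τ d 0 w) =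
      TensorAlgebra.lift k (ι k ∘ₗ p) w - w := by
  -- The extended homotopy sends v₁ ⋯ vₙ to the sum of the words τp(v₁) ⋯ τp(vᵢ₋₁) h(vᵢ) vᵢ₊₁ ⋯ vₙ.
  -- Letters before position i already carry p and later ones do not, so the differences p - id
  -- telescope.
  have := ext_word (k := k) (A := A)
    (f := barDiff τ d 0 ∘ₗ barDiff (τ ∘ₗ p) h 0 + barDiff (τ ∘ₗ p) h 0 ∘ₗ barDiff τ d 0)
    (g := (TensorAlgebra.lift k (ι k ∘ₗ p)).toLinearMap - LinearMap.id)
    (by simp [barDiff_one]) (by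
      intro v w hw
      simp only [LinearMap.add_apply, LinearMap.comp_apply, LinearMap.sub_apply,
        AlgHom.toLinearMap_apply, LinearMap.id_apply] at hw ⊢
      simp only [barDiff_zero_ι_mul, map_add, LinearMap.comp_apply, map_mul, lift_ι_apply]
      have e1 : τ (p (τ v)) = p v := by rw [← hτp, hττ]
      have e2 : τ (p (d v)) = - d (τ (p v)) := by rw [hpd, hτd]
      rw [hττ, e1, e2, hτh]
      have h1 : TensorAlgebra.lift k (ι k ∘ₗ p) w = w +
          (barDiff τ d 0 (barDiff (τ ∘ₗ p) h 0 w) +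
            barDiff (τ ∘ₗ p) h 0 (barDiff τ d 0 w)) := by rw [hw]; abel
      have h2 : ι k (p v) * w = ι k v * w + ι k (d (h v)) * w + ι k (h (d v)) * w := by
        rw [← add_mul, ← add_mul, ← map_add, ← map_add, add_assoc, hh]; simp
      rw [h1, mul_add, mul_add, h2]
      simp only [map_neg, neg_mul]
      abel)
  exact LinearMap.congr_fun this w

theorem lift_barDiff (dA τA : A →ₗ[k] A) (dB τB : B →ₗ[k] B) (f : A →ₗ[k] B)
    (hf : ∀ a, f (dA a) = dB (f a)) (hτf : ∀ a, τB (f a) = f (τA a)) (w : TensorAlgebra k A) :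
    TensorAlgebra.lift k (ι k ∘ₗ f) (barDiff τA dA 0 w) =
      barDiff τB dB 0 (TensorAlgebra.lift k (ι k ∘ₗ f) w) := by
  have := ext_word (k := k) (A := A)
    (f := (TensorAlgebra.lift k (ι k ∘ₗ f)).toLinearMap ∘ₗ barDiff τA dA 0)
    (g := barDiff τB dB 0 ∘ₗ (TensorAlgebra.lift k (ι k ∘ₗ f)).toLinearMap)
    (by simp [barDiff_one]) (by
      intro v w hw
      simp only [LinearMap.comp_apply, AlgHom.toLinearMap_apply] at hw ⊢
      simp [barDiff_zero_ι_mul, hf, hτf, hw])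
  exact LinearMap.congr_fun this w

theorem lift_lift (f : A →ₗ[k] B) (g : B →ₗ[k] C) (w : TensorAlgebra k A) :
    TensorAlgebra.lift k (ι k ∘ₗ g) (TensorAlgebra.lift k (ι k ∘ₗ f) w) =
      TensorAlgebra.lift k (ι k ∘ₗ g ∘ₗ f) w := by
  have : (TensorAlgebra.lift k (ι k ∘ₗ g)).comp (TensorAlgebra.lift k (ι k ∘ₗ f)) =
      TensorAlgebra.lift k (ι k ∘ₗ g ∘ₗ f) := by
    ext a; simp
  exact DFunLike.congr_fun this w

theorem lift_mem_barFiltration (f : A →ₗ[k] B) {n : ℕ} {w : TensorAlgebra k A}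
    (hw : w ∈ barFiltration k A n) :
    TensorAlgebra.lift k (ι k ∘ₗ f) w ∈ barFiltration k B n := by
  refine barFiltration_induction (P := fun n w => TensorAlgebra.lift k (ι k ∘ₗ f) w ∈
    barFiltration k B n) ?_ ?_ ?_ ?_ hw
  · intro n r; rw [AlgHom.commutes]; exact algebraMap_mem_barFiltration n r
  · intro n x y hx hy; rw [map_add]; exact add_mem hx hy
  · intro n a w _ hw
    rw [map_mul, lift_ι_apply]
    exact ι_mul_mem_barFiltration _ hw
  · intro m n w h hw; exact barFiltration_mono h hw

theorem barDiff_zero_mem_barFiltration (τ d : A →ₗ[k] A) {n : ℕ} {w : TensorAlgebra k A}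
    (hw : w ∈ barFiltration k A n) : barDiff τ d 0 w ∈ barFiltration k A n := by
  refine barFiltration_induction (P := fun n w => barDiff τ d 0 w ∈ barFiltration k A n)
    ?_ ?_ ?_ ?_ hw
  · intro n r; simp [Algebra.algebraMap_eq_smul_one, barDiff_one]
  · intro n x y hx hy; rw [map_add]; exact add_mem hx hy
  · intro n a w h hw
    rw [barDiff_zero_ι_mul]
    exact add_mem (ι_mul_mem_barFiltration _ h) (ι_mul_mem_barFiltration _ hw)
  · intro m n w h hw; exact barFiltration_mono h hw

end Homotopy

/-! ### Comparison of cohomology along a filtration -/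

section Filtered

variable {k M N : Type*} [Field k] [AddCommGroup M] [Module k M] [AddCommGroup N] [Module k N]

/-- A filtered map whose leading part is a homotopy equivalence is injective on cohomology. -/
theorem exists_eq_of_filtered_homotopyEquiv {FM : ℕ → Submodule k M} {FN : ℕ → Submodule k N}
    {DM dM KM : M →ₗ[k] M} {DN dN KN : N →ₗ[k] N} {f φ : M →ₗ[k] N} {G : N →ₗ[k] M}
    (h0 : ∀ x ∈ FM 0, ∀ y, f x = DN y → x = 0)
    (hDM : ∀ x, DM (DM x) = 0) (hDN : ∀ y, DN (DN y) = 0) (hf : ∀ x, f (DM x) = DN (f x))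
    (hdM : ∀ n, ∀ x ∈ FM n, DM x - dM x ∈ FM (n - 1))
    (hdN : ∀ n, ∀ y ∈ FN n, DN y - dN y ∈ FN (n - 1))
    (hφ : ∀ n, ∀ x ∈ FM n, f x - φ x ∈ FN (n - 1))
    (φd : ∀ x, φ (dM x) = dN (φ x)) (Gd : ∀ y, G (dN y) = dM (G y))
    (hKM : ∀ x, dM (KM x) + KM (dM x) = G (φ x) - x)
    (hKN : ∀ y, dN (KN y) + KN (dN y) = φ (G y) - y)
    (φF : ∀ n, ∀ x ∈ FM n, φ x ∈ FN n) (GF : ∀ n, ∀ y ∈ FN n, G y ∈ FM n)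
    (KMF : ∀ n, ∀ x ∈ FM n, KM x ∈ FM n) (KNF : ∀ n, ∀ y ∈ FN n, KN y ∈ FN n)
    (n : ℕ) (x : M) (y : N) (hxF : x ∈ FM n) (hyF : y ∈ FN n) (hx : DM x = 0) (hxy : f x = DN y) :
    ∃ x', DM x' = x := by
  induction n generalizing x y with
  -- On the lowest step the only element whose image is a coboundary is 0.
  | zero => exact ⟨0, by rw [h0 x hxF y hxy, map_zero]⟩
  | succ n ih =>
    have e1 : dM x ∈ FM n := by
      have := hdM _ x hxF
      rwa [hx, zero_sub, neg_mem_iff] at this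
    have e2 : φ x - dN y ∈ FN n := by
      have := sub_mem (hdN _ y hyF) (hφ _ x hxF)
      rw [hxy] at this
      have h3 : DN y - dN y - (DN y - φ x) = φ x - dN y := by abel
      rwa [← h3]
    -- The homotopies need not commute with φ; e measures the failure. It is a cocycle for the
    -- leading differential modulo the lower step.
    obtain ⟨e, he⟩ : ∃ e, e = φ (KM x) - KN (φ x) := ⟨_, rfl⟩
    have heF : e ∈ FN (n + 1) := he ▸ sub_mem (φF _ _ (KMF _ _ hxF)) (KNF _ _ (φF _ _ hxF))
    have hde : dN e ∈ FN n := by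
      have h1 : dN e = KN (φ (dM x)) - φ (KM (dM x)) := by
        have a1 := congrArg φ (hKM x)
        have a2 := hKN (φ x)
        rw [map_add, map_sub, φd] at a1
        rw [← φd] at a2
        rw [he, map_sub]
        linear_combination (norm := module) (1 : k) • a1 - (1 : k) • a2
      rw [h1]
      exact sub_mem (KNF _ _ (φF _ _ e1)) (φF _ _ (KMF _ _ e1))
    -- To leading order Gy - KM x is a primitive of x. The summand Ge leaves this true and also
    -- makes y - f x' a leading-order coboundary, with primitive y'.
    obtain ⟨x', hx'⟩ : ∃ x', x' = G y - KM x + G e := ⟨_, rfl⟩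
    have hx'F : x' ∈ FM (n + 1) :=
      hx' ▸ add_mem (sub_mem (GF _ _ hyF) (KMF _ _ hxF)) (GF _ _ heF)
    obtain ⟨y', hy'⟩ : ∃ y', y' = -(KN y + KN e) := ⟨_, rfl⟩
    have hy'F : y' ∈ FN (n + 1) := hy' ▸ neg_mem (add_mem (KNF _ _ hyF) (KNF _ _ heF))
    have hx1 : x - DM x' ∈ FM n := by
      have h1 : x - DM x' = G (φ x - dN y) - KM (dM x) - G (dN e) - (DM x' - dM x') := by
        have a1 := hKM x
        have a2 : dM x' = G (dN y) - dM (KM x) + G (dN e) := by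
          simp only [hx', map_add, map_sub, Gd]
        rw [a2, map_sub]
        linear_combination (norm := module) (1 : k) • a1
      rw [h1]
      exact sub_mem (sub_mem (sub_mem (GF _ _ e2) (KMF _ _ e1)) (GF _ _ hde)) (hdM _ _ hx'F)
    have hy1 : y - f x' - DN y' ∈ FN n := by
      have h1 : y - f x' - DN y' = KN (φ x - dN y) - KN (dN e) - (f x' - φ x') -
          (DN y' - dN y') := by
        have a1 := hKN y
        have a2 := hKN e
        have a3 : φ x' = φ (G y) - φ (KM x) + φ (G e) := by simp only [hx', map_add, map_sub]
        have a4 : dN y' = -(dN (KN y) + dN (KN e)) := by simp only [hy', map_neg, map_add]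
        rw [a3, a4, map_sub]
        linear_combination (norm := module) (1 : k) • a1 + (1 : k) • a2 - (1 : k) • he
      rw [h1]
      exact sub_mem (sub_mem (sub_mem (KNF _ _ e2) (KNF _ _ hde)) (hφ _ _ hx'F)) (hdN _ _ hy'F)
    -- The corrected pair lies one step lower and is again admissible: f(x - Dx') = D(y - fx' -
    -- Dy').
    obtain ⟨x'', hx''⟩ := ih _ _ hx1 hy1 (by rw [map_sub, hx, hDM, sub_zero])
      (by rw [map_sub, map_sub, map_sub, hDN, sub_zero, hxy, hf])
    exact ⟨x' + x'', by rw [map_add, hx'']; abel⟩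

end Filtered

namespace AInfinityAlgebra


open TensorAlgebra

variable {k : Type u} [Field k]

/-! ### Invariance under quasi-isomorphisms -/

/-- A quasi-isomorphism is injective on the cohomology of bar constructions. -/
theorem Hom.IsQuasiIso.exists_D_eq [CharZero k] {A B : AInfinityAlgebra.{u, v} k} {f : Hom A B}
    (hf : f.IsQuasiIso) (x : TensorAlgebra k A.carrier) (y : TensorAlgebra k B.carrier)
    (hx : A.D x = 0) (hxy : f.toFun x = B.D y) : ∃ x', A.D x' = x := by
  obtain ⟨g, hA, hB, hg, hτg, hτA, hτB, hhA, hhB⟩ := exists_homotopyInverse A.m₁ A.sign B.m₁ B.sign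
    f.f₁ A.m₁_m₁ B.m₁_m₁ A.sign_sign B.sign_sign A.sign_m₁ B.sign_m₁ f.f₁_m₁ f.f₁_sign hf.1 hf.2
  let φ := (TensorAlgebra.lift k (ι k ∘ₗ f.f₁)).toLinearMap
  let G := (TensorAlgebra.lift k (ι k ∘ₗ g)).toLinearMap
  let KA := barDiff (A.sign ∘ₗ g ∘ₗ f.f₁) hA 0
  let KB := barDiff (B.sign ∘ₗ f.f₁ ∘ₗ g) hB 0
  have φd : ∀ w, φ (A.linearPart w) = B.linearPart (φ w) :=
    lift_barDiff A.m₁ A.sign B.m₁ B.sign f.f₁ f.f₁_m₁ f.f₁_sign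
  have Gd : ∀ w, G (B.linearPart w) = A.linearPart (G w) :=
    lift_barDiff B.m₁ B.sign A.m₁ A.sign g hg hτg
  have hKA : ∀ w, A.linearPart (KA w) + KA (A.linearPart w) = G (φ w) - w := by
    intro w
    have := barDiff_homotopy A.m₁ A.sign (g ∘ₗ f.f₁) hA A.sign_sign A.sign_m₁
      (fun a => by rw [LinearMap.comp_apply, LinearMap.comp_apply, hτg, f.f₁_sign])
      (fun a => by rw [LinearMap.comp_apply, LinearMap.comp_apply, f.f₁_m₁, hg]) hτA hhA w
    rw [← lift_lift] at this
    exact this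
  have hKB : ∀ w, B.linearPart (KB w) + KB (B.linearPart w) = φ (G w) - w := by
    intro w
    have := barDiff_homotopy B.m₁ B.sign (f.f₁ ∘ₗ g) hB B.sign_sign B.sign_m₁
      (fun a => by rw [LinearMap.comp_apply, LinearMap.comp_apply, f.f₁_sign, hτg])
      (fun a => by rw [LinearMap.comp_apply, LinearMap.comp_apply, hg, f.f₁_m₁]) hτB hhB w
    rw [← lift_lift] at this
    exact this
  have key := exists_eq_of_filtered_homotopyEquiv (FM := barFiltration k A.carrier)
    (FN := barFiltration k B.carrier) (DM := A.D) (dM := A.linearPart) (DN := B.D)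
    (dN := B.linearPart) (f := f.toFun) (φ := φ) (G := G) (KM := KA) (KN := KB)
    -- The base case: f preserves the counit and D has zero counit, so a constant whose image is a
    -- coboundary is zero.
    (fun x hx y hxy => by
      have h1 := congrArg algebraMapInv hxy
      rw [f.counit, B.algebraMapInv_D] at h1
      rw [barFiltration_zero hx, h1, map_zero])
    A.D_D B.D_D f.map_D (fun n x hx => A.D_sub_linearPart_mem hx)
    (fun n x hx => B.D_sub_linearPart_mem hx) (fun n x hx => f.map_sub_map_f₁_mem hx)
    φd Gd hKA hKB (fun n x hx => lift_mem_barFiltration f.f₁ hx)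
    (fun n x hx => lift_mem_barFiltration g hx)
    (fun n x hx => barDiff_zero_mem_barFiltration _ _ hx)
    (fun n x hx => barDiff_zero_mem_barFiltration _ _ hx)
  obtain ⟨m, hm⟩ := exists_mem_barFiltration x
  obtain ⟨n, hn⟩ := exists_mem_barFiltration y
  exact key (max m n) x y (barFiltration_mono (le_max_left _ _) hm)
    (barFiltration_mono (le_max_right _ _) hn) hx hxy

/-- The cohomology of `m₁` vanishes in degrees `≤ 0`, and every cocycle of degree `≥ 2` for `m₁`
becomes a coboundary in the bar construction. -/
def HasTrivialSuspension (A : AInfinityAlgebra.{u, v} k) : Prop :=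
  (∀ n ≤ 0, ∀ a ∈ A.deg n, A.m₁ a = 0 → a ∈ LinearMap.range A.m₁) ∧
  ∀ n, 2 ≤ n → ∀ a ∈ A.deg n, A.m₁ a = 0 → ∃ y, A.D y = ι k a

/-- Surjectivity on cohomology is given without regard to degrees. The structure maps are
homogeneous, so the components of the right degree satisfy the same relations. -/
theorem Hom.IsQuasiIso.exists_homogeneous {A B : AInfinityAlgebra.{u, v} k} {f : Hom A B}
    (hf : f.IsQuasiIso) {n : ℤ} {b : B.carrier} (hb : b ∈ B.deg n) (hmb : B.m₁ b = 0) :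
    ∃ a ∈ A.deg n, A.m₁ a = 0 ∧ ∃ c, B.m₁ c = f.f₁ a - b := by
  obtain ⟨a, ha, c, hc⟩ := hf.2 b hmb
  refine ⟨gradedProj A.deg A.isInternal n a, gradedProj_mem _ _ _, ?_,
    gradedProj B.deg B.isInternal (n - 1) c, ?_⟩
  · rw [← gradedProj_comm A.isInternal A.isInternal A.m₁_mem, ha, map_zero]
  · rw [← gradedProj_comm B.isInternal B.isInternal B.m₁_mem, hc, map_sub, sub_add_cancel,
      gradedProj_of_mem B.isInternal hb]
    have := gradedProj_comm A.isInternal B.isInternal (f := f.f₁) (e := 0)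
      (by simpa using f.f₁_mem) n a
    rw [add_zero] at this
    rw [this]

/-- From A to B one lifts a class along f, pushes a primitive forward and corrects it by a
one-letter word. From B to A no inverse of f as a morphism is constructed; injectivity of f on bar
cohomology takes its place. -/
theorem hasTrivialSuspension_iff [CharZero k] {A B : AInfinityAlgebra.{u, v} k} {f : Hom A B}
    (hf : f.IsQuasiIso) : A.HasTrivialSuspension ↔ B.HasTrivialSuspension := by
  constructor
  · rintro ⟨h1, h2⟩
    constructor
    · intro n hn b hb hmb
      obtain ⟨a, ha, hma, c, hc⟩ := hf.exists_homogeneous hb hmb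
      obtain ⟨a', rfl⟩ := h1 n hn a ha hma
      exact ⟨f.f₁ a' - c, by rw [map_sub, hc, f.f₁_m₁]; abel⟩
    · intro n hn b hb hmb
      obtain ⟨a, ha, hma, c, hc⟩ := hf.exists_homogeneous hb hmb
      obtain ⟨y, hy⟩ := h2 n hn a ha hma
      exact ⟨f.toFun y - ι k c, by
        rw [map_sub, ← f.map_D, hy, f.map_ι, B.D_ι, hc, map_sub]; abel⟩
  · rintro ⟨h1, h2⟩
    constructor
    · intro n hn a ha hma
      exact hf.1 a hma (h1 n hn _ (f.f₁_mem n a ha) (by rw [← f.f₁_m₁, hma, map_zero]))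
    · intro n hn a ha hma
      obtain ⟨y, hy⟩ := h2 n hn _ (f.f₁_mem n a ha) (by rw [← f.f₁_m₁, hma, map_zero])
      exact hf.exists_D_eq (ι k a) y (by rw [A.D_ι, hma, map_zero]) (by rw [f.map_ι, hy])

theorem QuasiIsomorphic.hasTrivialSuspension_iff [CharZero k] {A B : AInfinityAlgebra.{u, v} k}
    (h : QuasiIsomorphic A B) : A.HasTrivialSuspension ↔ B.HasTrivialSuspension := by
  induction h with
  | rel A B h => exact AInfinityAlgebra.hasTrivialSuspension_iff h.choose_spec
  | refl A => rfl
  | symm A B _ ih => exact ih.symm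
  | trans A B C _ _ h1 h2 => exact h1.trans h2

end AInfinityAlgebra

/-! ### Homogeneous preimages -/

section Independence

variable {k M N : Type*} [Field k] [AddCommGroup M] [Module k M] [AddCommGroup N] [Module k N]

/-- The component of y of index i suffices: the other components map into the sum of the other G' j,
which meets G' i only in zero. -/
theorem exists_homogeneous_preimage {I : Type*} {G : I → Submodule k M} {G' : I → Submodule k N}
    {D : M →ₗ[k] N} (hD : ∀ i, ∀ x ∈ G i, D x ∈ G' i) (hG' : iSupIndep G') {y : M}
    (hy : y ∈ ⨆ i, G i) {i : I} (hDy : D y ∈ G' i) : ∃ y' ∈ G i, D y' = D y := by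
  rw [iSup_split_single G i] at hy
  obtain ⟨a, ha, b, hb, rfl⟩ := Submodule.mem_sup.mp hy
  refine ⟨a, ha, ?_⟩
  have h1 : D b ∈ ⨆ (j) (_ : j ≠ i), G' j := by
    have : (⨆ (j) (_ : j ≠ i), G j) ≤ (⨆ (j) (_ : j ≠ i), G' j).comap D :=
      iSup₂_le fun j hj x hx => Submodule.mem_iSup_of_mem j
        (Submodule.mem_iSup_of_mem hj (hD j x hx))
    exact this hb
  have h2 : D b ∈ G' i := by
    rw [map_add] at hDy
    exact (Submodule.add_mem_iff_right _ (hD i a ha)).mp hDy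
  rw [map_add, Submodule.disjoint_def.mp (hG' i) _ h2 h1, add_zero]

/-- Eigenspaces for distinct eigenvalues are independent. Degree, weight and length on the bar
construction are all separated in this way, by suitable derivations. -/
theorem iSupIndep_of_apply_eq_smul {I : Type*} {G : I → Submodule k M} (E : M →ₗ[k] M) (c : I → k)
    (hc : Function.Injective c) (hE : ∀ i, ∀ x ∈ G i, E x = c i • x) : iSupIndep G :=
  ((Module.End.eigenspaces_iSupIndep E).comp hc).mono fun i x hx =>
    Module.End.mem_eigenspace_iff.mpr (hE i x hx)

variable {A : Type*} [AddCommGroup A] [Module k A]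

open TensorAlgebra

/-- The bar degree is the eigenvalue of the derivation that multiplies a letter of degree n by n -
1; characteristic 0 keeps distinct integers distinct in k. -/
theorem iSupIndep_barDegree [CharZero k] {deg : ℤ → Submodule k A} (h : DirectSum.IsInternal deg) :
    iSupIndep (barDegree deg) := by
  refine iSupIndep_of_apply_eq_smul
    (barDiff LinearMap.id (diagonalMap h fun n => ((n - 1 : ℤ) : k)) 0) (fun n => (n : k))
    Int.cast_injective ?_
  intro n w hw
  induction hw using Submodule.span_induction with
  | zero => simp
  | add x y _ _ hx hy => rw [map_add, hx, hy, smul_add]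
  | smul c x _ hx => rw [map_smul, hx, smul_comm]
  | mem x hx =>
    replace hx : IsBarWord deg n x := hx
    induction hx with
    | nil => simp [barDiff_one]
    | cons ha hw ih =>
      rw [barDiff_zero_ι_mul, ih, diagonalMap_apply h _ ha]
      simp only [map_smul, smul_mul_assoc, LinearMap.id_apply, mul_smul_comm, ← add_smul]
      push_cast
      rfl

theorem iSup_barDegree {deg : ℤ → Submodule k A} (h : DirectSum.IsInternal deg) :
    ⨆ n, barDegree deg n = ⊤ := by
  rw [eq_top_iff]
  have key : ∀ a : A, ∀ w ∈ ⨆ n, barDegree deg n, ι k a * w ∈ ⨆ n, barDegree deg n := by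
    intro a w hw
    have ha : a ∈ ⨆ n, deg n := by rw [h.submodule_iSup_eq_top]; trivial
    induction ha using Submodule.iSup_induction' with
    | zero => simp
    | add x y _ _ hx hy => rw [map_add, add_mul]; exact add_mem hx hy
    | mem p a ha =>
      induction hw using Submodule.iSup_induction' with
      | zero => simp
      | add x y _ _ hx hy => rw [mul_add]; exact add_mem hx hy
      | mem n w hw => exact Submodule.mem_iSup_of_mem _ (ι_mul_mem_barDegree ha hw)
  have key2 : ∀ x w : TensorAlgebra k A, w ∈ ⨆ n, barDegree deg n →
      x * w ∈ ⨆ n, barDegree deg n := by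
    intro x
    induction x using TensorAlgebra.induction with
    | algebraMap r => intro w hw; rw [← Algebra.smul_def]; exact Submodule.smul_mem _ _ hw
    | ι a => exact key a
    | add x y hx hy => intro w hw; rw [add_mul]; exact add_mem (hx w hw) (hy w hw)
    | mul x y hx hy => intro w hw; rw [mul_assoc]; exact hx _ (hy w hw)
  intro x _
  simpa using key2 x 1 (Submodule.mem_iSup_of_mem 0 (Submodule.subset_span IsBarWord.nil))

/-- A nonzero word in letters of positive degree is a product of letters of bounded degree. -/
theorem IsBarWord.exists_letters {deg : ℤ → Submodule k A} (h0 : ∀ n ≤ 0, deg n = ⊥) {n : ℤ}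
    {w : TensorAlgebra k A} (hw : IsBarWord deg n w) :
    w = 0 ∨ (0 ≤ n ∧ ∃ (r : ℕ) (a : Fin r → A), w = tprod k A r a ∧
      ∀ i, ∃ p ≤ n + 1, a i ∈ deg p) := by
  induction hw with
  | nil => exact Or.inr ⟨le_rfl, 0, Fin.elim0, by simp [tprod_apply], fun i => i.elim0⟩
  | @cons p n a w ha hw ih =>
    rcases le_or_gt p 0 with hp | hp
    · rw [h0 p hp, Submodule.mem_bot] at ha
      exact Or.inl (by simp [ha])
    rcases ih with rfl | ⟨hn, r, b, rfl, hb⟩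
    · exact Or.inl (by simp)
    -- The bar degree is the sum of the nonnegative numbers p - 1 over the letters, so no single p -
    -- 1 exceeds it.
    · refine Or.inr ⟨by omega, r + 1, Fin.cons a b, ?_, ?_⟩
      · rw [tprod_apply, tprod_apply, List.ofFn_succ, List.prod_cons]
        simp
      · intro i
        refine Fin.cases ⟨p, by omega, by simpa using ha⟩ (fun i => ?_) i
        obtain ⟨q, hq, hq'⟩ := hb i
        exact ⟨q, by omega, by simpa using hq'⟩

end Independence

/-! ### Minimal algebras with trivial suspension -/

namespace AInfinityAlgebra


open TensorAlgebra

variable {k : Type u} [Field k] {A : AInfinityAlgebra.{u, v} k}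

theorem IsMinimal.m₁_eq_zero (hA : A.IsMinimal) (a : A.carrier) : A.m₁ a = 0 := by
  have h1 : ι k a ∈ barFiltration k A.carrier (0 + 1) := by
    simpa using ι_mul_mem_barFiltration a (one_mem_barFiltration (k := k) 0)
  have h2 := barFiltration_zero (hA 0 _ h1)
  rw [A.algebraMapInv_D, map_zero, A.D_ι] at h2
  exact (map_eq_zero_iff _ (ι_leftInverse (R := k)).injective).mp h2

/-- An element of F₁ of bar degree j ≥ 1 has no constant term, so it is one letter of degree j + 1 ≥
2, automatically an m₁-cocycle. -/
theorem HasTrivialSuspension.isOneGenerated [CharZero k] (h : A.HasTrivialSuspension)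
    (hA : A.IsMinimal) : A.IsOneGenerated := by
  constructor
  · intro n hn
    rw [eq_bot_iff]
    intro a ha
    obtain ⟨b, rfl⟩ := h.1 n hn a ha (hA.m₁_eq_zero a)
    exact hA.m₁_eq_zero b
  · rintro j hj w ⟨hw1, hwj⟩ -
    have h1 := barFiltration_one hw1
    rw [algebraMapInv_of_mem_barDegree (by omega) hwj, map_zero, zero_add] at h1
    obtain ⟨y, hy⟩ := h.2 (j + 1) (by omega) _ (ιInv_mem_of_mem_barDegree hwj)
      (hA.m₁_eq_zero _)
    rw [← h1] at hy
    -- The primitive may be inhomogeneous; its component of degree j - 1 has the same image, as D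
    -- raises the degree by one.
    have hind : iSupIndep fun n => barDegree A.deg (n + 1) :=
      (iSupIndep_barDegree A.isInternal).comp (add_left_injective 1)
    obtain ⟨y', hy', hDy'⟩ := exists_homogeneous_preimage (i := j - 1) A.D_mem hind
      (y := y) (by rw [iSup_barDegree A.isInternal]; trivial)
      (by rw [hy, sub_add_cancel]; exact hwj)
    exact ⟨y', hy', hDy'.trans hy⟩

/-- Induction on the degree: for p ≥ 2 the word [a] is D of something of bar degree p - 2, whose
letters have smaller degree than a. The linear component of D on words consists of the operations
mₙ. -/
theorem IsOneGenerated.isGeneratedInDegreeOne (h : A.IsOneGenerated) (hA : A.IsMinimal) :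
    A.IsGeneratedInDegreeOne := by
  rw [IsGeneratedInDegreeOne, generated, eq_top_iff]
  refine le_sInf ?_
  rintro W ⟨hW1, hW⟩
  have key : ∀ n : ℕ, ∀ p : ℤ, p ≤ n → A.deg p ≤ W := by
    intro n
    induction n with
    | zero =>
      intro p hp
      rw [h.1 p (by simpa using hp)]
      exact bot_le
    | succ n ih =>
      intro p hp a ha
      rcases le_or_gt p n with hpn | hpn
      · exact ih p hpn ha
      by_cases hp1 : p = 1
      · subst hp1; exact hW1 ha
      have hp2 : p = n + 1 := by push_cast at hp; omega
      have haF : ι k a ∈ barFiltration k A.carrier 1 := by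
        simpa using ι_mul_mem_barFiltration a (one_mem_barFiltration (k := k) 0)
      obtain ⟨y, hy, hDy⟩ := h.2 (p - 1) (by omega) (ι k a) ⟨haF, ι_mem_barDegree ha⟩
        (by rw [A.D_ι, hA.m₁_eq_zero, map_zero])
      -- Letters of words of bar degree p - 2 have degree at most p - 1, so the induction hypothesis
      -- covers them.
      have hy2 : ∀ w ∈ barDegree A.deg (p - 1 - 1), ιInv (A.D w) ∈ W := by
        intro w hw
        induction hw using Submodule.span_induction with
        | zero => simp
        | add x y _ _ hx hy => rw [map_add, map_add]; exact add_mem hx hy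
        | smul c x _ hx => rw [map_smul, map_smul]; exact Submodule.smul_mem _ _ hx
        | mem x hx =>
          rcases IsBarWord.exists_letters h.1 hx with rfl | ⟨-, r, b, rfl, hb⟩
          · simp
          · refine hW r b fun i => ?_
            obtain ⟨q, hq, hbq⟩ := hb i
            exact ih q (by omega) hbq
      have := hy2 y hy
      rwa [hDy, ι_leftInverse] at this
  rw [← A.isInternal.submodule_iSup_eq_top]
  exact iSup_le fun p => key p.toNat p (Int.self_le_toNat p)

end AInfinityAlgebra

/-! ### Koszulness of exterior algebras -/

namespace Koszul

open LieCoalgebra TensorAlgebra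

variable (k L : Type*) [Field k] [AddCommGroup L] [Module k L]

/-- The tensor algebra generated by the augmentation ideal of `Λ L`. -/
abbrev Bar := TensorAlgebra k (augIdeal k L)

/-- The parity operator of the shifted augmentation ideal. -/
noncomputable abbrev sgn : augIdeal k L →ₗ[k] augIdeal k L :=
  shiftSign (augDeg k L) (augDeg_isInternal k L)

/-- The product of the augmentation ideal. -/
noncomputable def augMul : augIdeal k L →ₗ[k] augIdeal k L →ₗ[k] augIdeal k L :=
  LinearMap.mk₂ k
    (fun a b => ⟨(a : ExteriorAlgebra k L) * b, by
      rw [mem_augIdeal, map_mul, mem_augIdeal.mp a.2, zero_mul]⟩)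
    (by intros; ext; simp [add_mul]) (by intros; ext; simp)
    (by intros; ext; simp [mul_add]) (by intros; ext; simp)

set_option maxSynthPendingDepth 5 in
/-- The product of the augmentation ideal as an operation on the shifted space. -/
noncomputable def augMulShift : augIdeal k L →ₗ[k] augIdeal k L →ₗ[k] augIdeal k L :=
  -(augMul k L ∘ₗ sgn k L)

/-- The part of the codifferential which comes from the product. -/
noncomputable abbrev mulDiff : Bar k L →ₗ[k] Bar k L :=
  barDiff (sgn k L) 0 (augMulShift k L)

/-- Multiplication of the first letter of a word. -/
noncomputable abbrev head (a : augIdeal k L) : Bar k L →ₗ[k] Bar k L :=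
  barHead (sgn k L) 0 (augMulShift k L) a

/-- The part `Λ^(i+1) L` of the augmentation ideal. -/
noncomputable def augPart (i : ℕ) : Submodule k (augIdeal k L) :=
  (⋀[k]^(i + 1) L).comap (augIdeal k L).subtype

/-- Generators as elements of the augmentation ideal. -/
noncomputable def gen : L →ₗ[k] augIdeal k L :=
  (ExteriorAlgebra.ι k).codRestrict _ fun x =>
    mem_augIdeal_of_mem one_ne_zero (by
      rw [ExteriorAlgebra.exteriorPower, pow_one]; exact ⟨x, rfl⟩)

variable {k L}

/-- The index i is the degree in the shifted space, so the sum of the indices of the letters is the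
bar degree of a word, and generators have index 0. -/
theorem augDeg_natCast_add_one (i : ℕ) : augDeg k L ((i : ℤ) + 1) = augPart k L i := by
  rw [augDeg, if_pos (by omega), augPart]
  congr

theorem mem_augPart {i : ℕ} {a : augIdeal k L} :
    a ∈ augPart k L i ↔ (a : ExteriorAlgebra k L) ∈ ⋀[k]^(i + 1) L := Iff.rfl

@[simp] theorem coe_gen (x : L) : (gen k L x : ExteriorAlgebra k L) = ExteriorAlgebra.ι k x := rfl

theorem gen_mem (x : L) : gen k L x ∈ augPart k L 0 := by
  rw [mem_augPart, coe_gen, ExteriorAlgebra.exteriorPower, zero_add, pow_one]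
  exact ⟨x, rfl⟩

theorem exists_gen_of_mem {a : augIdeal k L} (ha : a ∈ augPart k L 0) : ∃ x, gen k L x = a := by
  rw [mem_augPart, ExteriorAlgebra.exteriorPower, zero_add, pow_one] at ha
  obtain ⟨x, hx⟩ := ha
  exact ⟨x, Subtype.ext hx⟩

theorem iSup_augPart : ⨆ i, augPart k L i = ⊤ := by
  rw [eq_top_iff, ← (augDeg_isInternal k L).submodule_iSup_eq_top]
  refine iSup_le fun n => ?_
  rcases le_or_gt n 0 with hn | hn
  · rw [augDeg, if_neg (by omega)]; exact bot_le
  · refine le_iSup_of_le (n.toNat - 1) ?_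
    rw [← augDeg_natCast_add_one, show (((n.toNat - 1 : ℕ) : ℤ) + 1) = n by omega]

/-- Linear maps on the augmentation ideal agree if they agree on homogeneous elements. -/
theorem ext_augPart {M : Type*} [AddCommGroup M] [Module k M] {f g : augIdeal k L →ₗ[k] M}
    (h : ∀ i, ∀ a ∈ augPart k L i, f a = g a) : f = g := by
  have : (⨆ i, augPart k L i) ≤ LinearMap.eqLocus f g := iSup_le fun i a ha => h i a ha
  rw [iSup_augPart] at this
  ext1 a
  exact this (Submodule.mem_top (x := a))

theorem coe_sgn (a : augIdeal k L) :
    (sgn k L a : ExteriorAlgebra k L) = - parity k L (a : ExteriorAlgebra k L) := by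
  have := ext_augPart (f := (augIdeal k L).subtype ∘ₗ sgn k L)
    (g := -((parity k L).toLinearMap ∘ₗ (augIdeal k L).subtype)) (by
      intro i a ha
      have h1 : a ∈ augDeg k L ((i : ℤ) + 1) := by rwa [augDeg_natCast_add_one]
      rw [LinearMap.comp_apply, sgn, shiftSign_apply (augDeg_isInternal k L) h1, map_zsmul]
      simp only [Submodule.subtype_apply, LinearMap.neg_apply, LinearMap.comp_apply,
        AlgHom.toLinearMap_apply, parity_apply (mem_augPart.mp ha), add_sub_cancel_right,
        Int.coe_negOnePow_natCast]
      rw [pow_succ]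
      simp)
  exact LinearMap.congr_fun this a

theorem sgn_mem {i : ℕ} {a : augIdeal k L} (ha : a ∈ augPart k L i) :
    sgn k L a ∈ augPart k L i := by
  rw [mem_augPart, coe_sgn, parity_apply (mem_augPart.mp ha)]
  exact neg_mem (zsmul_mem (mem_augPart.mp ha) _)

theorem sgn_sgn (a : augIdeal k L) : sgn k L (sgn k L a) = a :=
  shiftSign_shiftSign _ a

theorem sgn_gen (x : L) : sgn k L (gen k L x) = gen k L x := by
  apply Subtype.ext
  rw [coe_sgn]
  simp [parity]

set_option maxSynthPendingDepth 5 in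
theorem coe_augMulShift (a b : augIdeal k L) :
    (augMulShift k L a b : ExteriorAlgebra k L) =
      parity k L (a : ExteriorAlgebra k L) * (b : ExteriorAlgebra k L) := by
  have : (augMulShift k L a b : ExteriorAlgebra k L) =
      - ((sgn k L a : ExteriorAlgebra k L) * (b : ExteriorAlgebra k L)) := rfl
  rw [this, coe_sgn, neg_mul, neg_neg]

theorem augMulShift_mem {i j : ℕ} {a b : augIdeal k L} (ha : a ∈ augPart k L i)
    (hb : b ∈ augPart k L j) : augMulShift k L a b ∈ augPart k L (i + j + 1) := by
  rw [mem_augPart, coe_augMulShift, parity_apply (mem_augPart.mp ha), smul_mul_assoc,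
    show i + j + 1 + 1 = (i + 1) + (j + 1) by ring]
  exact zsmul_mem (SetLike.mul_mem_graded (A := fun i : ℕ => ⋀[k]^i L) ha hb) _

theorem parity_mul_ι (c : ExteriorAlgebra k L) (x : L) :
    parity k L c * ExteriorAlgebra.ι k x = ExteriorAlgebra.ι k x * c := by
  induction c using ExteriorAlgebra.induction with
  | algebraMap r => rw [AlgHom.commutes, Algebra.commutes]
  | ι y => simp [parity, ι_mul_ι_swap x y]
  | mul a b ha hb => rw [map_mul, mul_assoc, hb, ← mul_assoc, ha, mul_assoc]
  | add a b ha hb => rw [map_add, add_mul, mul_add, ha, hb]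

/-- The sign in the shifted product is exactly the one needed to move a generator past c. -/
theorem coe_augMulShift_gen (c : augIdeal k L) (x : L) :
    (augMulShift k L c (gen k L x) : ExteriorAlgebra k L) =
      ExteriorAlgebra.ι k x * (c : ExteriorAlgebra k L) := by
  rw [coe_augMulShift, coe_gen, parity_mul_ι]

/-- Graded commutativity of ΛL, read on the shifted space. This antisymmetry makes inserting a
generator compatible with the product part of the codifferential. -/
theorem augMulShift_gen_left (x : L) (c : augIdeal k L) :
    augMulShift k L (gen k L x) c = - augMulShift k L c (gen k L x) := by
  apply Subtype.ext
  rw [Submodule.coe_neg, coe_augMulShift_gen, coe_augMulShift]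
  simp [parity]

theorem mulDiff_ι_mul (a : augIdeal k L) (w : Bar k L) :
    mulDiff k L (ι k a * w) = ι k (sgn k L a) * mulDiff k L w + head k L a w := by
  rw [mulDiff, barDiff_ι_mul]
  simp

/-! The antiderivation `∂ : Λ L → L ⊗ Λ L`. -/

variable (k L) in
/-- One step of the recursion defining `partialTensor`. -/
noncomputable def partialStep :
    L →ₗ[k] ExteriorAlgebra k L × (L ⊗[k] ExteriorAlgebra k L) →ₗ[k] L ⊗[k] ExteriorAlgebra k L :=
  LinearMap.mk₂ k
    (fun x p => x ⊗ₜ p.1 - (LinearMap.mulLeft k (ExteriorAlgebra.ι k x)).lTensor L p.2)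
    (by
      intro x y p
      have : LinearMap.mulLeft k (ExteriorAlgebra.ι k (x + y)) =
          LinearMap.mulLeft k (ExteriorAlgebra.ι k x) +
            LinearMap.mulLeft k (ExteriorAlgebra.ι k y) :=
        LinearMap.ext fun c => by simp [add_mul]
      simp only [TensorProduct.add_tmul, this, LinearMap.lTensor_add, LinearMap.add_apply]
      abel)
    (by
      intro c x p
      have : LinearMap.mulLeft k (ExteriorAlgebra.ι k (c • x)) =
          c • LinearMap.mulLeft k (ExteriorAlgebra.ι k x) :=
        LinearMap.ext fun c => by simp
      simp only [this, LinearMap.lTensor_smul, LinearMap.smul_apply,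
        TensorProduct.smul_tmul', smul_sub])
    (by intro x p q; simp only [Prod.fst_add, Prod.snd_add, TensorProduct.tmul_add, map_add]; abel)
    (by intro c x p; simp only [Prod.smul_fst, Prod.smul_snd, TensorProduct.tmul_smul, map_smul,
          smul_sub])

theorem partialStep_apply (x : L) (c : ExteriorAlgebra k L) (t : L ⊗[k] ExteriorAlgebra k L) :
    partialStep k L x (c, t) =
      x ⊗ₜ c - (LinearMap.mulLeft k (ExteriorAlgebra.ι k x)).lTensor L t := rfl

variable (k L) in
/-- The universal antiderivation `c ↦ ∑ xᵢ ⊗ ∂ᵢ c`. -/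
noncomputable def partialTensor : ExteriorAlgebra k L →ₗ[k] L ⊗[k] ExteriorAlgebra k L :=
  CliffordAlgebra.foldr' 0 (partialStep k L) (by
    -- The recursion must respect x ∧ x = 0: the two terms x ⊗ xc cancel and the remaining one
    -- contains x ∧ x.
    intro x c t
    change partialStep k L x (ExteriorAlgebra.ι k x * c, partialStep k L x (c, t)) = _
    rw [partialStep_apply, partialStep_apply, map_sub, LinearMap.lTensor_tmul,
      LinearMap.mulLeft_apply, ← LinearMap.comp_apply, ← LinearMap.lTensor_comp,
      ← LinearMap.mulLeft_mul, ExteriorAlgebra.ι_sq_zero]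
    simp) 0

theorem partialTensor_algebraMap (r : k) : partialTensor k L (algebraMap k _ r) = 0 :=
  (CliffordAlgebra.foldr'_algebraMap 0 _ _ _ _).trans (smul_zero _)

theorem partialTensor_one : partialTensor k L 1 = 0 := by
  simpa using partialTensor_algebraMap (k := k) (L := L) 1

theorem partialTensor_ι_mul (x : L) (c : ExteriorAlgebra k L) :
    partialTensor k L (ExteriorAlgebra.ι k x * c) =
      x ⊗ₜ c - (LinearMap.mulLeft k (ExteriorAlgebra.ι k x)).lTensor L (partialTensor k L c) :=
  CliffordAlgebra.foldr'_ι_mul 0 _ _ _ _ _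

variable (k L) in
/-- The multiplication `L ⊗ Λ L → Λ L`. -/
noncomputable def mulTensor : L ⊗[k] ExteriorAlgebra k L →ₗ[k] ExteriorAlgebra k L :=
  TensorProduct.lift (LinearMap.mul k (ExteriorAlgebra k L) ∘ₗ ExteriorAlgebra.ι k)

theorem mulTensor_tmul (x : L) (c : ExteriorAlgebra k L) :
    mulTensor k L (x ⊗ₜ c) = ExteriorAlgebra.ι k x * c := by
  simp [mulTensor]

theorem mulTensor_mulLeft (x : L) (t : L ⊗[k] ExteriorAlgebra k L) :
    mulTensor k L ((LinearMap.mulLeft k (ExteriorAlgebra.ι k x)).lTensor L t) =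
      -(ExteriorAlgebra.ι k x * mulTensor k L t) := by
  induction t with
  | zero => simp
  | add s t hs ht => rw [map_add, map_add, map_add, hs, ht, mul_add]; abel
  | tmul y c =>
    rw [LinearMap.lTensor_tmul, mulTensor_tmul, mulTensor_tmul, LinearMap.mulLeft_apply,
      ← mul_assoc, ι_mul_ι_swap y x, neg_mul, mul_assoc]

/-- The Euler formula. -/
theorem mulTensor_partialTensor {n : ℕ} {c : ExteriorAlgebra k L} (hc : c ∈ ⋀[k]^n L) :
    mulTensor k L (partialTensor k L c) = (n : k) • c := by
  induction hc using Submodule.pow_induction_on_left' with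
  | algebraMap r => rw [partialTensor_algebraMap]; simp
  | add x y i hx hy h1 h2 => rw [map_add, map_add, h1, h2, smul_add]
  | mem_mul m hm i x hx ih =>
    obtain ⟨v, rfl⟩ := hm
    rw [partialTensor_ι_mul, map_sub, mulTensor_tmul, mulTensor_mulLeft, ih]
    push_cast
    rw [add_smul, one_smul, mul_smul_comm]
    abel

theorem partialTensor_mem {n : ℕ} {c : ExteriorAlgebra k L} (hc : c ∈ ⋀[k]^(n + 1) L) :
    partialTensor k L c ∈ LinearMap.range ((⋀[k]^n L).subtype.lTensor L) := by
  have key : ∀ m, ∀ c ∈ ⋀[k]^m L, ∀ n, m = n + 1 → partialTensor k L c ∈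
      LinearMap.range ((⋀[k]^n L).subtype.lTensor L) := by
    intro m c hc
    induction hc using Submodule.pow_induction_on_left' with
    | algebraMap r => intro n hn; omega
    | add x y i hx hy h1 h2 => intro n hn; rw [map_add]; exact add_mem (h1 n hn) (h2 n hn)
    | mem_mul m hm i x hx ih =>
      obtain ⟨v, rfl⟩ := hm
      intro n hn
      obtain rfl : i = n := by omega
      rw [partialTensor_ι_mul]
      refine sub_mem ⟨v ⊗ₜ ⟨x, hx⟩, by simp⟩ ?_
      rcases i with _ | i
      · change _ ∈ LinearMap.range (ExteriorAlgebra.ι k) ^ 0 at hx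
        rw [pow_zero, Submodule.mem_one] at hx
        obtain ⟨r, rfl⟩ := hx
        rw [partialTensor_algebraMap, map_zero]
        exact zero_mem _
      · obtain ⟨t, ht⟩ := ih i rfl
        rw [← ht]
        clear ht ih
        induction t with
        | zero => simp
        | add s t hs ht => rw [map_add, map_add]; exact add_mem hs ht
        | tmul y c =>
          refine ⟨y ⊗ₜ ⟨ExteriorAlgebra.ι k v * c, ?_⟩, by simp⟩
          change _ ∈ LinearMap.range (ExteriorAlgebra.ι k) ^ (i + 1)
          rw [pow_succ']
          exact Submodule.mul_mem_mul ⟨v, rfl⟩ c.2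
  exact key _ c hc n rfl

/-! Insertion of a generator into a word. -/

variable (k L) in
/-- One step of the recursion defining `insertGen`. -/
noncomputable def insertStep :
    augIdeal k L →ₗ[k] (Bar k L × (L →ₗ[k] Bar k L) →ₗ[k] (L →ₗ[k] Bar k L)) :=
  LinearMap.mk₂ k
    (fun a p => LinearMap.mulRight k (ι k a * p.1) ∘ₗ ι k ∘ₗ gen k L +
      LinearMap.mulLeft k (ι k a) ∘ₗ p.2)
    (by intros; ext; simp only [add_mul, mul_add, map_add, LinearMap.comp_apply,
          LinearMap.add_apply, LinearMap.mulRight_apply, LinearMap.mulLeft_apply]; abel)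
    (by intros; ext; simp only [smul_mul_assoc, mul_smul_comm, map_smul, LinearMap.comp_apply,
          LinearMap.add_apply, LinearMap.smul_apply, LinearMap.mulRight_apply,
          LinearMap.mulLeft_apply, smul_add])
    (by intros; ext; simp only [mul_add, Prod.fst_add, Prod.snd_add, LinearMap.comp_apply,
          LinearMap.add_apply, LinearMap.mulRight_apply, LinearMap.mulLeft_apply]; abel)
    (by intros; ext; simp only [mul_smul_comm, Prod.smul_fst, Prod.smul_snd, LinearMap.comp_apply,
          LinearMap.add_apply, LinearMap.smul_apply, LinearMap.mulRight_apply,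
          LinearMap.mulLeft_apply, smul_add])

variable (k L) in
/-- The sum `insertGen w x` over all ways of inserting the generator `x` into the word `w`. -/
noncomputable def insertGen : Bar k L →ₗ[k] (L →ₗ[k] Bar k L) :=
  fold (insertStep k L) (ι k ∘ₗ gen k L)

theorem insertGen_one (x : L) : insertGen k L 1 x = ι k (gen k L x) := by
  simp [insertGen, fold_one]

theorem insertGen_ι_mul (a : augIdeal k L) (w : Bar k L) (x : L) :
    insertGen k L (ι k a * w) x =
      ι k (gen k L x) * (ι k a * w) + ι k a * insertGen k L w x := by
  rw [insertGen, fold_ι_mul]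
  rfl

/-- On the right, the insertion of x directly in front of w gives the product of a and x, which is
cancelled by the middle term; the other insertions correspond. -/
theorem insertGen_head (a : augIdeal k L) (w : Bar k L) (x : L) :
    insertGen k L (head k L a w) x = ι k (gen k L x) * head k L a w +
      ι k (augMulShift k L (gen k L x) a) * w + head k L a (insertGen k L w x) := by
  have := ext_word (k := k) (A := augIdeal k L)
    (f := LinearMap.applyₗ x ∘ₗ insertGen k L ∘ₗ head k L a)
    (g := LinearMap.mulLeft k (ι k (gen k L x)) ∘ₗ head k L a +
      LinearMap.mulLeft k (ι k (augMulShift k L (gen k L x) a)) +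
      head k L a ∘ₗ LinearMap.applyₗ x ∘ₗ insertGen k L) ?_ ?_
  · exact LinearMap.congr_fun this w
  · simp only [LinearMap.comp_apply, barHead_one, map_zero, LinearMap.add_apply,
      LinearMap.mulLeft_apply, LinearMap.applyₗ_apply_apply, insertGen_one, mul_one,
      zero_add]
    rw [← mul_one (ι k (gen k L x)), barHead_ι_mul, augMulShift_gen_left]
    simp
  · intro c w _
    simp only [LinearMap.comp_apply, barHead_ι_mul, LinearMap.add_apply, LinearMap.mulLeft_apply,
      LinearMap.applyₗ_apply_apply, insertGen_ι_mul, map_add, augMulShift_gen_left, map_neg,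
      neg_mul]
    abel

/-- Insertion is the shuffle product with the one-letter cocycle x. Because ΛL is graded
commutative, the product part of the codifferential is a derivation of the shuffle product. -/
theorem mulDiff_insertGen (w : Bar k L) (x : L) :
    mulDiff k L (insertGen k L w x) = insertGen k L (mulDiff k L w) x := by
  have := ext_word (k := k) (A := augIdeal k L)
    (f := mulDiff k L ∘ₗ LinearMap.applyₗ x ∘ₗ insertGen k L)
    (g := LinearMap.applyₗ x ∘ₗ insertGen k L ∘ₗ mulDiff k L) ?_ ?_
  · exact LinearMap.congr_fun this w
  · simp only [LinearMap.comp_apply, LinearMap.applyₗ_apply_apply, insertGen_one, barDiff_one,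
      map_zero]
    rw [← mul_one (ι k (gen k L x)), mulDiff_ι_mul, barHead_one, barDiff_one]
    simp
  · intro a w hw
    simp only [LinearMap.comp_apply, LinearMap.applyₗ_apply_apply] at hw ⊢
    rw [insertGen_ι_mul, map_add, mulDiff_ι_mul, mulDiff_ι_mul, mulDiff_ι_mul, sgn_gen,
      barHead_ι_mul, map_add, LinearMap.add_apply, insertGen_ι_mul, insertGen_head, hw, mul_add]
    abel

end Koszul

/-! ### Spans of words -/

section WordSpan

variable {k R I : Type*} [Field k] [Ring R] [Algebra k R] [AddCommMonoid I]

/-- The span of the products `v₁ ⋯ vᵣ` with `vᵢ ∈ V aᵢ` and `∑ aᵢ = s`. -/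
def wordSpan (V : I → Submodule k R) : ℕ → I → Submodule k R
  | 0, s => ⨆ (_ : s = 0), 1
  | r + 1, s => ⨆ (a : I) (b : I) (_ : a + b = s), V a * wordSpan V r b

variable {V : I → Submodule k R}

theorem algebraMap_mem_wordSpan (c : k) : algebraMap k R c ∈ wordSpan V 0 0 :=
  Submodule.mem_iSup_of_mem rfl (Submodule.mem_one.mpr ⟨c, rfl⟩)

theorem mul_mem_wordSpan {r : ℕ} {a b : I} {v w : R} (hv : v ∈ V a) (hw : w ∈ wordSpan V r b) :
    v * w ∈ wordSpan V (r + 1) (a + b) :=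
  Submodule.mem_iSup_of_mem a (Submodule.mem_iSup_of_mem b (Submodule.mem_iSup_of_mem rfl
    (Submodule.mul_mem_mul hv hw)))

theorem wordSpan_succ_le {r : ℕ} {s : I} {W : Submodule k R}
    (h : ∀ a b, a + b = s → ∀ v ∈ V a, ∀ w ∈ wordSpan V r b, v * w ∈ W) :
    wordSpan V (r + 1) s ≤ W :=
  iSup₂_le fun a b => iSup_le fun hab => Submodule.mul_le.mpr fun v hv w hw => h a b hab v hv w hw

theorem wordSpan_induction {P : ℕ → I → R → Prop} (zero : ∀ r s, P r s 0)
    (add : ∀ r s x y, P r s x → P r s y → P r s (x + y))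
    (algebraMap : ∀ c, P 0 0 (algebraMap k R c))
    (mul : ∀ r a b, ∀ v ∈ V a, ∀ w ∈ wordSpan V r b, P r b w → P (r + 1) (a + b) (v * w))
    {r : ℕ} {s : I} {x : R} (hx : x ∈ wordSpan V r s) : P r s x := by
  induction r generalizing s x with
  | zero =>
    by_cases hs : s = 0
    · subst hs
      simp only [wordSpan, iSup_pos] at hx
      obtain ⟨c, rfl⟩ := Submodule.mem_one.mp hx
      exact algebraMap c
    · simp only [wordSpan, hs, iSup_false, Submodule.mem_bot] at hx
      rw [hx]; exact zero _ _
  | succ r ih =>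
    rw [wordSpan] at hx
    refine Submodule.iSup_induction _ (motive := P (r + 1) s) hx (fun a x hx => ?_) (zero _ _)
      (fun x y => add _ _ x y)
    refine Submodule.iSup_induction _ (motive := P (r + 1) s) hx (fun b x hx => ?_) (zero _ _)
      (fun x y => add _ _ x y)
    refine Submodule.iSup_induction _ (motive := P (r + 1) s) hx (fun hab z hz => ?_) (zero _ _)
      (fun x y => add _ _ x y)
    subst hab
    exact Submodule.mul_induction_on (C := P (r + 1) (a + b)) hz
      (fun v hv w hw => mul r a b v hv w hw (ih hw)) (fun x y => add _ _ x y)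

theorem wordSpan_mul_mem {r r' : ℕ} {s s' : I} {x y : R} (hx : x ∈ wordSpan V r s)
    (hy : y ∈ wordSpan V r' s') : x * y ∈ wordSpan V (r + r') (s + s') := by
  refine wordSpan_induction (P := fun r s x => x * y ∈ wordSpan V (r + r') (s + s')) ?_ ?_ ?_ ?_ hx
  · intro r s; rw [zero_mul]; exact zero_mem _
  · intro r s x y hx hy; rw [add_mul]; exact add_mem hx hy
  · intro c
    rw [← Algebra.smul_def, zero_add, zero_add]
    exact Submodule.smul_mem _ _ hy
  · intro r a b v hv w _ hw
    rw [mul_assoc, add_right_comm, add_assoc a b]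
    exact mul_mem_wordSpan hv hw

theorem pow_le_iSup_wordSpan (r : ℕ) : (⨆ a, V a) ^ r ≤ ⨆ s, wordSpan V r s := by
  induction r with
  | zero =>
    rw [pow_zero]
    intro x hx
    obtain ⟨c, rfl⟩ := Submodule.mem_one.mp hx
    exact Submodule.mem_iSup_of_mem 0 (algebraMap_mem_wordSpan c)
  | succ r ih =>
    rw [pow_succ']
    refine (mul_le_mul' le_rfl ih).trans ?_
    rw [Submodule.iSup_mul]
    refine iSup_le fun a => ?_
    rw [Submodule.mul_iSup]
    refine iSup_le fun b => ?_
    exact (Submodule.mul_le.mpr fun v hv w hw => mul_mem_wordSpan hv hw).trans (le_iSup _ (a + b))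

theorem wordSpan_le_pow (r : ℕ) (s : I) : wordSpan V r s ≤ (⨆ a, V a) ^ r := by
  intro x hx
  refine wordSpan_induction (P := fun r s x => x ∈ (⨆ a, V a) ^ r) ?_ ?_ ?_ ?_ hx
  · exact fun r s => zero_mem _
  · exact fun r s x y => add_mem
  · intro c; rw [pow_zero]; exact Submodule.mem_one.mpr ⟨c, rfl⟩
  · intro r a b v hv w _ hw
    rw [pow_succ']
    exact Submodule.mul_mem_mul (Submodule.mem_iSup_of_mem a hv) hw

end WordSpan

/-! ### Words in the tensor algebra with graded letters -/

section BarWords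

open TensorAlgebra

variable {k A I : Type*} [Field k] [AddCommGroup A] [Module k A] [AddCommMonoid I]

/-- The span of the words in the tensor algebra with letters in `V aᵢ` and `∑ aᵢ = s`. -/
noncomputable def barWords (V : I → Submodule k A) (r : ℕ) (s : I) :
    Submodule k (TensorAlgebra k A) :=
  wordSpan (fun i => (V i).map (ι k)) r s

variable {V : I → Submodule k A}

theorem ι_mul_mem_barWords {r : ℕ} {a b : I} {v : A} {w : TensorAlgebra k A} (hv : v ∈ V a)
    (hw : w ∈ barWords V r b) : ι k v * w ∈ barWords V (r + 1) (a + b) :=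
  mul_mem_wordSpan (Submodule.mem_map_of_mem hv) hw

theorem one_mem_barWords : (1 : TensorAlgebra k A) ∈ barWords V 0 0 := by
  rw [← map_one (algebraMap k (TensorAlgebra k A))]
  exact algebraMap_mem_wordSpan 1

theorem ι_mem_barWords {a : I} {v : A} (hv : v ∈ V a) : ι k v ∈ barWords V 1 a := by
  simpa using ι_mul_mem_barWords hv (one_mem_barWords (V := V))

theorem barWords_induction {P : ℕ → I → TensorAlgebra k A → Prop} (zero : ∀ r s, P r s 0)
    (add : ∀ r s x y, P r s x → P r s y → P r s (x + y))
    (smul_one : ∀ c : k, P 0 0 (c • 1))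
    (ι_mul : ∀ r a b, ∀ v ∈ V a, ∀ w ∈ barWords V r b, P r b w → P (r + 1) (a + b) (ι k v * w))
    {r : ℕ} {s : I} {x : TensorAlgebra k A} (hx : x ∈ barWords V r s) : P r s x := by
  refine wordSpan_induction (P := P) zero add ?_ ?_ hx
  · intro c; rw [Algebra.algebraMap_eq_smul_one]; exact smul_one c
  · rintro r a b _ ⟨v, hv, rfl⟩ w hw h
    exact ι_mul r a b v hv w hw h

theorem barWords_zero_of_ne {s : I} (hs : s ≠ 0) : barWords V 0 s = ⊥ := by
  simp [barWords, wordSpan, hs]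

/-- The derivation extending a diagonal map is diagonal. -/
theorem barDiff_id_of_mem_barWords (E : A →ₗ[k] A) (c : I →+ k) (e : k)
    (hE : ∀ s, ∀ a ∈ V s, E a = (c s + e) • a) {r : ℕ} {s : I} {w : TensorAlgebra k A}
    (hw : w ∈ barWords V r s) : barDiff LinearMap.id E 0 w = (c s + r * e) • w := by
  refine barWords_induction (P := fun r s w => barDiff LinearMap.id E 0 w = (c s + r * e) • w)
    ?_ ?_ ?_ ?_ hw
  · simp
  · intro r s x y hx hy; rw [map_add, hx, hy, smul_add]
  · intro a; simp [barDiff_one]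
  · intro r a b v hv w _ ih
    rw [barDiff_zero_ι_mul, hE a v hv, ih, map_smul, smul_mul_assoc, LinearMap.id_apply,
      mul_smul_comm, ← add_smul, map_add]
    push_cast
    congr 1
    ring

/-- Refining the letters of words. -/
theorem barWords_le_iSup {J : Type*} [AddCommMonoid J] {V' : I × J → Submodule k A}
    (h : ∀ i, V i ≤ ⨆ j, V' (i, j)) (r : ℕ) (s : I) :
    barWords V r s ≤ ⨆ j, barWords V' r (s, j) := by
  intro w hw
  refine barWords_induction (P := fun r s w => w ∈ ⨆ j, barWords V' r (s, j)) ?_ ?_ ?_ ?_ hw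
  · exact fun r s => zero_mem _
  · exact fun r s x y => add_mem
  · intro c
    exact Submodule.smul_mem _ _ (Submodule.mem_iSup_of_mem 0 one_mem_barWords)
  · intro r a b v hv w _ hw
    have : ι k v * w ∈ (⨆ j, V' (a, j)).map (ι k) * ⨆ j, barWords V' r (b, j) :=
      Submodule.mul_mem_mul (Submodule.mem_map_of_mem (h a hv)) hw
    rw [Submodule.map_iSup, Submodule.iSup_mul] at this
    refine Set.mem_of_mem_of_subset this (SetLike.coe_subset_coe.mpr (iSup_le fun j => ?_))
    rw [Submodule.mul_iSup]
    refine iSup_le fun j' => Submodule.mul_le.mpr ?_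
    rintro _ ⟨x, hx, rfl⟩ y hy
    have h1 := ι_mul_mem_barWords hx hy
    rw [Prod.mk_add_mk] at h1
    exact Submodule.mem_iSup_of_mem (j + j') h1

/-- Splitting off the first letter of the elements of a span of words. -/
theorem exists_tensor_of_mem_mul {U : Submodule k A} {S : Submodule k (TensorAlgebra k A)}
    {z : TensorAlgebra k A} (hz : z ∈ U.map (ι k) * S) :
    ∃ t : U ⊗[k] S, cons k A (TensorProduct.map U.subtype S.subtype t) = z := by
  induction hz using Submodule.mul_induction_on' with
  | mem_mul_mem m hm w hw =>
    obtain ⟨v, hv, rfl⟩ := hm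
    exact ⟨⟨v, hv⟩ ⊗ₜ ⟨w, hw⟩, by simp⟩
  | add x _ y _ hx hy =>
    obtain ⟨s, rfl⟩ := hx
    obtain ⟨t, rfl⟩ := hy
    exact ⟨s + t, by simp⟩

/-- Vector spaces are flat, so tensoring with U keeps ker ψ → N → M exact. -/
theorem exists_lTensor_ker_subtype {U N M : Type*} [AddCommGroup U] [Module k U] [AddCommGroup N]
    [Module k N] [AddCommGroup M] [Module k M] (ψ : N →ₗ[k] M) {t : U ⊗[k] N}
    (h : ψ.lTensor U t = 0) : ∃ s, (LinearMap.ker ψ).subtype.lTensor U s = t :=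
  (Module.Flat.lTensor_exact U (LinearMap.exact_subtype_ker_map ψ) t).mp h

/-- A combination of words whose tails are annihilated by `φ` is a combination of words with tails
in the kernel of `φ`. -/
theorem mem_mul_inf_ker {M : Type*} [AddCommGroup M] [Module k M] {U : Submodule k A}
    {S : Submodule k (TensorAlgebra k A)} (φ : TensorAlgebra k A →ₗ[k] M)
    {z : TensorAlgebra k A} (hz : z ∈ U.map (ι k) * S) (h : φ.lTensor A (uncons k A z) = 0) :
    z ∈ U.map (ι k) * (S ⊓ LinearMap.ker φ) := by
  obtain ⟨t, rfl⟩ := exists_tensor_of_mem_mul hz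
  rw [uncons_cons] at h
  -- The vanishing is known in A ⊗ M only; flatness makes U ⊗ M embed there.
  have h1 : U.subtype.rTensor M ((φ ∘ₗ S.subtype).lTensor U t) = 0 := by
    rw [← h]
    simp only [LinearMap.rTensor, LinearMap.lTensor, ← LinearMap.comp_apply,
      ← TensorProduct.map_comp]
    simp
  have h2 : (φ ∘ₗ S.subtype).lTensor U t = 0 :=
    Module.Flat.rTensor_preserves_injective_linearMap _ U.injective_subtype
      (h1.trans (map_zero _).symm)
  obtain ⟨s, rfl⟩ := exists_lTensor_ker_subtype (φ ∘ₗ S.subtype) h2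
  clear h h1 h2 hz
  induction s with
  | zero => simp
  | add x y hx hy => simp only [map_add]; exact add_mem hx hy
  | tmul u w =>
    simp only [LinearMap.lTensor_tmul, TensorProduct.map_tmul, cons_tmul]
    exact Submodule.mul_mem_mul (Submodule.mem_map_of_mem u.2) ⟨w.1.2, w.2⟩

end BarWords

/-! ### Exactness of the codifferential of an exterior algebra -/

namespace Koszul

open LieCoalgebra TensorAlgebra

variable {k L : Type*} [Field k] [AddCommGroup L] [Module k L]

variable (k L) in
/-- The projection of the exterior algebra to its augmentation ideal. -/
noncomputable def augProj : ExteriorAlgebra k L →ₗ[k] augIdeal k L :=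
  (LinearMap.id - Algebra.linearMap k (ExteriorAlgebra k L) ∘ₗ
    (ExteriorAlgebra.algebraMapInv : ExteriorAlgebra k L →ₐ[k] k).toLinearMap).codRestrict _
    fun c => by
      rw [mem_augIdeal]
      simp

theorem augProj_coe (a : augIdeal k L) : augProj k L a = a := by
  apply Subtype.ext
  simp [augProj, mem_augIdeal.mp a.2]

theorem augProj_ι_mul (x : L) (c : augIdeal k L) :
    augProj k L (ExteriorAlgebra.ι k x * (c : ExteriorAlgebra k L)) =
      augMulShift k L c (gen k L x) := by
  rw [← coe_augMulShift_gen, augProj_coe]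

variable (k L) in
/-- The operation `x ⊗ c, w ↦ [c | x ⧢ w]`. -/
noncomputable def insertAfter : L ⊗[k] ExteriorAlgebra k L →ₗ[k] Bar k L →ₗ[k] Bar k L :=
  TensorProduct.lift (LinearMap.mk₂ k
    (fun x c => LinearMap.mulLeft k (ι k (augProj k L c)) ∘ₗ (insertGen k L).flip x)
    (by intros; ext1; simp only [map_add, LinearMap.comp_apply, LinearMap.add_apply])
    (by intros; ext1; simp only [map_smul, LinearMap.comp_apply, LinearMap.smul_apply])
    (by intros; ext1; simp only [map_add, LinearMap.comp_apply, LinearMap.add_apply,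
          LinearMap.mulLeft_apply, add_mul])
    (by intros; ext1; simp only [map_smul, LinearMap.comp_apply, LinearMap.smul_apply,
          LinearMap.mulLeft_apply, smul_mul_assoc]))

theorem insertAfter_tmul (x : L) (c : ExteriorAlgebra k L) (w : Bar k L) :
    insertAfter k L (x ⊗ₜ c) w = ι k (augProj k L c) * insertGen k L w x := rfl

variable (k L) in
/-- The homotopy `[c | w] ↦ ∑ [∂ᵢ c | xᵢ ⧢ w]`. -/
noncomputable def homotopy : Bar k L →ₗ[k] Bar k L :=
  TensorProduct.lift (insertAfter k L ∘ₗ partialTensor k L ∘ₗ (augIdeal k L).subtype) ∘ₗ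
    uncons k (augIdeal k L)

theorem homotopy_ι_mul (c : augIdeal k L) (w : Bar k L) :
    homotopy k L (ι k c * w) = insertAfter k L (partialTensor k L c) w := by
  simp [homotopy]

variable (k L) in
/-- The operator which shuffles a first letter `x ∈ L` into the rest of the word. -/
noncomputable def topToRandom : Bar k L →ₗ[k] Bar k L :=
  TensorProduct.lift ((insertGen k L).flip ∘ₗ ExteriorAlgebra.ιInv ∘ₗ (augIdeal k L).subtype) ∘ₗ
    uncons k (augIdeal k L)

theorem topToRandom_one : topToRandom k L 1 = 0 := by
  simp [topToRandom]

theorem topToRandom_gen_mul (x : L) (w : Bar k L) :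
    topToRandom k L (ι k (gen k L x) * w) = insertGen k L w x := by
  simp [topToRandom, ExteriorAlgebra.ι_leftInverse x]

/-- The differential of `[c | x ⧢ w]`. -/
theorem mulDiff_insertAfter (t : L ⊗[k] augIdeal k L) (y : L) (w : Bar k L) :
    mulDiff k L (insertAfter k L ((augIdeal k L).subtype.lTensor L t) (ι k (gen k L y) * w)) +
      insertAfter k L ((parity k L).toLinearMap.lTensor L ((augIdeal k L).subtype.lTensor L t))
        (mulDiff k L (ι k (gen k L y) * w)) =
    ι k (augProj k L (mulTensor k L ((augIdeal k L).subtype.lTensor L t))) *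
        (ι k (gen k L y) * w) +
      insertAfter k L ((LinearMap.mulLeft k (ExteriorAlgebra.ι k y)).lTensor L
        ((augIdeal k L).subtype.lTensor L t)) w := by
  have hp : ∀ c : augIdeal k L, augProj k L (parity k L (c : ExteriorAlgebra k L)) =
      - sgn k L c := by
    intro c
    rw [← neg_neg (parity k L (c : ExteriorAlgebra k L)), ← coe_sgn, map_neg, augProj_coe]
  induction t with
  | zero => simp
  | add s t hs ht =>
    simp only [map_add, LinearMap.add_apply, add_mul] at hs ht ⊢
    linear_combination (norm := module) (1 : k) • hs + (1 : k) • ht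
  | tmul x c =>
    simp only [LinearMap.lTensor_tmul, Submodule.subtype_apply, insertAfter_tmul, mulTensor_tmul,
      LinearMap.mulLeft_apply, AlgHom.toLinearMap_apply, augProj_ι_mul, hp,
      augProj_coe]
    -- Multiplying c into x ⧢ yw gives two terms: x in front yields x ∧ c followed by yw, the other
    -- insertions yield y ∧ c followed by x ⧢ w.
    rw [mulDiff_ι_mul, mulDiff_insertGen, insertGen_ι_mul, map_add (head k L c), barHead_ι_mul,
      barHead_ι_mul, map_neg, neg_mul]
    abel

theorem mulDiff_insertAfter_one (t : L ⊗[k] augIdeal k L) :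
    mulDiff k L (insertAfter k L ((augIdeal k L).subtype.lTensor L t) 1) =
    ι k (augProj k L (mulTensor k L ((augIdeal k L).subtype.lTensor L t))) := by
  induction t with
  | zero => simp
  | add s t hs ht =>
    simp only [map_add, LinearMap.add_apply] at hs ht ⊢
    rw [hs, ht]
  | tmul x c =>
    simp only [LinearMap.lTensor_tmul, Submodule.subtype_apply, insertAfter_tmul, mulTensor_tmul,
      augProj_ι_mul, augProj_coe]
    rw [mulDiff_ι_mul, mulDiff_insertGen, barDiff_one, map_zero, LinearMap.zero_apply, mul_zero,
      zero_add, insertGen_one, ← mul_one (ι k (gen k L x)), barHead_ι_mul, mul_one]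

/-- Linear maps agree on words in the generators if they agree on such words with a given first
letter. -/
theorem eq_of_mem_barWords_zero {M : Type*} [AddCommGroup M] [Module k M] {f g : Bar k L →ₗ[k] M}
    (one : f 1 = g 1) (gen_mul : ∀ y w, f (ι k (gen k L y) * w) = g (ι k (gen k L y) * w))
    {r : ℕ} {w : Bar k L} (hw : w ∈ barWords (augPart k L) r 0) : f w = g w := by
  refine barWords_induction (V := augPart k L) (P := fun r s w => s = 0 → f w = g w)
    ?_ ?_ ?_ ?_ hw rfl
  · intro r s _; simp
  · intro r s x y hx hy hs; rw [map_add, map_add, hx hs, hy hs]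
  · intro c _; simp [one]
  · intro r a b v hv w _ _ hs
    obtain rfl : a = 0 := by omega
    obtain ⟨y, rfl⟩ := exists_gen_of_mem hv
    exact gen_mul y w

/-- Exterior degree at least 2 is essential: for a generator, ∂x = x ⊗ 1 leaves the augmentation
ideal. -/
theorem partialTensor_mem_aug {i : ℕ} {c : augIdeal k L} (hc : c ∈ augPart k L (i + 1)) :
    ∃ t : L ⊗[k] augPart k L i, (augIdeal k L).subtype.lTensor L
      ((augPart k L i).subtype.lTensor L t) = partialTensor k L c := by
  obtain ⟨t, ht⟩ := partialTensor_mem (mem_augPart.mp hc)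
  let f : ⋀[k]^(i + 1) L →ₗ[k] augPart k L i :=
    ((⋀[k]^(i + 1) L).subtype.codRestrict (augIdeal k L)
      fun c => mem_augIdeal_of_mem (Nat.succ_ne_zero i) c.2).codRestrict _ fun c => c.2
  refine ⟨f.lTensor L t, ?_⟩
  rw [← ht, ← LinearMap.comp_apply, ← LinearMap.comp_apply, ← LinearMap.lTensor_comp,
    ← LinearMap.lTensor_comp]
  rfl

/-- The homotopy formula for words whose first letter is of degree at least two and whose other
letters are generators. -/
theorem mulDiff_homotopy {i : ℕ} {c : augIdeal k L} (hc : c ∈ augPart k L (i + 1)) {r : ℕ}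
    {w : Bar k L} (hw : w ∈ barWords (augPart k L) r 0) (hD : mulDiff k L w = 0) :
    mulDiff k L (homotopy k L (ι k c * w)) + homotopy k L (head k L c w) =
      ((i : k) + 2) • (ι k c * w) + ι k c * topToRandom k L w := by
  obtain ⟨t, ht⟩ := partialTensor_mem_aug hc
  -- The Euler formula; i + 2 is the exterior degree of c.
  have hE : augProj k L (mulTensor k L (partialTensor k L c)) = ((i : k) + 2) • c := by
    rw [mulTensor_partialTensor (mem_augPart.mp hc), map_smul, augProj_coe]
    push_cast
    ring_nf
  -- With the parity term involving D w included, the identity holds for all words in generators and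
  -- need only be checked on 1 and on y w; D w = 0 removes that term afterwards.
  have := eq_of_mem_barWords_zero
    (f := mulDiff k L ∘ₗ insertAfter k L (partialTensor k L c) +
      insertAfter k L ((parity k L).toLinearMap.lTensor L (partialTensor k L c)) ∘ₗ mulDiff k L +
      homotopy k L ∘ₗ head k L c)
    (g := ((i : k) + 2) • LinearMap.mulLeft k (ι k c) +
      LinearMap.mulLeft k (ι k c) ∘ₗ topToRandom k L) ?_ ?_ hw
  · simp only [LinearMap.add_apply, LinearMap.comp_apply, hD, map_zero, add_zero] at this
    rw [homotopy_ι_mul, this]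
    simp
  · simp only [LinearMap.add_apply, LinearMap.comp_apply, barDiff_one, map_zero, barHead_one,
      add_zero, topToRandom_one, LinearMap.smul_apply, LinearMap.mulLeft_apply, mul_one]
    rw [← ht, mulDiff_insertAfter_one, ht, hE, map_smul]
  · intro y w
    simp only [LinearMap.add_apply, LinearMap.comp_apply, LinearMap.smul_apply,
      LinearMap.mulLeft_apply, topToRandom_gen_mul]
    rw [← ht, mulDiff_insertAfter, ht, hE, barHead_ι_mul, homotopy_ι_mul, coe_augMulShift_gen,
      partialTensor_ι_mul, map_sub, LinearMap.sub_apply, insertAfter_tmul, augProj_coe, map_smul,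
      smul_mul_assoc]
    abel

/-- The homotopy formula for words in the generators. -/
theorem topToRandom_gen_mul_eq (x : L) {r : ℕ} {w : Bar k L}
    (hw : w ∈ barWords (augPart k L) r 0) :
    topToRandom k L (ι k (gen k L x) * w) + homotopy k L (head k L (gen k L x) w) =
      ι k (gen k L x) * w + ι k (gen k L x) * topToRandom k L w := by
  have := eq_of_mem_barWords_zero
    (f := topToRandom k L ∘ₗ LinearMap.mulLeft k (ι k (gen k L x)) +
      homotopy k L ∘ₗ head k L (gen k L x))
    (g := LinearMap.mulLeft k (ι k (gen k L x)) +
      LinearMap.mulLeft k (ι k (gen k L x)) ∘ₗ topToRandom k L) ?_ ?_ hw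
  · exact this
  · simp only [LinearMap.add_apply, LinearMap.comp_apply, LinearMap.mulLeft_apply, barHead_one,
      map_zero, add_zero, topToRandom_one]
    rw [topToRandom_gen_mul, insertGen_one, mul_one]
  · intro y w
    simp only [LinearMap.add_apply, LinearMap.comp_apply, LinearMap.mulLeft_apply,
      topToRandom_gen_mul, insertGen_ι_mul, barHead_ι_mul, homotopy_ι_mul, coe_augMulShift_gen,
      coe_gen]
    -- Here ∂(y ∧ x) = y ⊗ x - x ⊗ y, so the homotopy gives [x | y ⧢ w] - [y | x ⧢ w]. The last term
    -- cancels the insertions of x behind y.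
    rw [← mul_one (ExteriorAlgebra.ι k x), partialTensor_ι_mul, partialTensor_ι_mul, mul_one,
      partialTensor_one, map_zero, sub_zero, LinearMap.lTensor_tmul, map_sub, LinearMap.sub_apply,
      insertAfter_tmul, insertAfter_tmul, LinearMap.mulLeft_apply, mul_one, ← coe_gen, ← coe_gen,
      augProj_coe, augProj_coe]
    abel

/-- A product with a letter of index i' has index at least i' + 1, hence greater than i. -/
theorem gradedProj_augMulShift {i i' : ℕ} (h : i ≤ i') {c : augIdeal k L}
    (hc : c ∈ augPart k L i') (b : augIdeal k L) :
    gradedProj (augDeg k L) (augDeg_isInternal k L) ((i : ℤ) + 1) (augMulShift k L c b) = 0 := by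
  have := ext_augPart (f := gradedProj (augDeg k L) (augDeg_isInternal k L) ((i : ℤ) + 1) ∘ₗ
    augMulShift k L c) (g := 0) (by
      intro j b hb
      have := augMulShift_mem hc hb
      rw [← augDeg_natCast_add_one] at this
      exact gradedProj_of_mem_ne _ this (by push_cast; omega))
  exact LinearMap.congr_fun this b

/-- The product does not contribute to the lowest degree of the first letter. -/
theorem gradedProj_head {i i' : ℕ} (h : i ≤ i') {c : augIdeal k L} (hc : c ∈ augPart k L i')
    (w : Bar k L) : (gradedProj (augDeg k L) (augDeg_isInternal k L) ((i : ℤ) + 1)).rTensor _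
      (uncons k _ (head k L c w)) = 0 := by
  have := ext_word (k := k) (A := augIdeal k L) (B := augIdeal k L ⊗[k] Bar k L)
    (f := (gradedProj (augDeg k L) (augDeg_isInternal k L) ((i : ℤ) + 1)).rTensor
      (TensorAlgebra k (augIdeal k L)) ∘ₗ uncons k _ ∘ₗ head k L c) (g := 0)
    (by simp [barHead_one]) (by
      intro b w _
      simp only [LinearMap.comp_apply, barHead_ι_mul, uncons_ι_mul, LinearMap.rTensor_tmul,
        gradedProj_augMulShift h hc, TensorProduct.zero_tmul, LinearMap.zero_apply])
  exact LinearMap.congr_fun this w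

/-- In a cocycle, the tails of the words whose first letter is of lowest degree are cocycles. -/
theorem mem_mul_inf_ker_mulDiff {i : ℕ} {S : Submodule k (Bar k L)} {z z' : Bar k L}
    (hz : z ∈ (augPart k L i).map (ι k) * S)
    (hz' : z' ∈ (⨆ (i' : ℕ) (_ : i < i'), augPart k L i').map (ι k) * (⊤ : Submodule k (Bar k L)))
    (h : mulDiff k L (z + z') = 0) :
    z ∈ (augPart k L i).map (ι k) * (S ⊓ LinearMap.ker (mulDiff k L)) := by
  set p := gradedProj (augDeg k L) (augDeg_isInternal k L) ((i : ℤ) + 1) with hp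
  have hp1 : ∀ c ∈ augPart k L i, p c = c := fun c hc =>
    gradedProj_of_mem _ (by rwa [augDeg_natCast_add_one])
  have hp2 : ∀ i', i < i' → ∀ c ∈ augPart k L i', p c = 0 := fun i' hi c hc =>
    gradedProj_of_mem_ne (m := (i' : ℤ) + 1) _ (by rwa [augDeg_natCast_add_one]) (by omega)
  -- Neither a sign nor a product lowers the degree of a first letter, so z' contributes nothing
  -- with first letter of degree i.
  have h1 : p.rTensor _ (uncons k _ (mulDiff k L z')) = 0 := by
    have : (⨆ (i' : ℕ) (_ : i < i'), augPart k L i').map (ι k) * (⊤ : Submodule k (Bar k L)) ≤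
        LinearMap.ker (p.rTensor _ ∘ₗ uncons k _ ∘ₗ mulDiff k L) := by
      simp only [Submodule.map_iSup, Submodule.iSup_mul]
      refine iSup₂_le fun i' hi => Submodule.mul_le.mpr ?_
      rintro _ ⟨c, hc, rfl⟩ w -
      rw [LinearMap.mem_ker, LinearMap.comp_apply, LinearMap.comp_apply, mulDiff_ι_mul, map_add,
        map_add, gradedProj_head hi.le hc, uncons_ι_mul, LinearMap.rTensor_tmul,
        hp2 i' hi _ (sgn_mem hc), TensorProduct.zero_tmul, zero_add]
    exact this hz'
  -- On z the product raises the degree of the first letter; only the codifferential of the tail,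
  -- with a sign on the first letter, survives.
  have h2 : p.rTensor _ (uncons k _ (mulDiff k L z)) =
      TensorProduct.map (sgn k L) (mulDiff k L) (uncons k _ z) := by
    have : (augPart k L i).map (ι k) * S ≤
        LinearMap.eqLocus (p.rTensor _ ∘ₗ uncons k _ ∘ₗ mulDiff k L)
          (TensorProduct.map (sgn k L) (mulDiff k L) ∘ₗ uncons k _) := by
      refine Submodule.mul_le.mpr ?_
      rintro _ ⟨c, hc, rfl⟩ w -
      rw [LinearMap.mem_eqLocus, LinearMap.comp_apply, LinearMap.comp_apply, LinearMap.comp_apply,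
        mulDiff_ι_mul, map_add, map_add, gradedProj_head le_rfl hc, uncons_ι_mul,
        LinearMap.rTensor_tmul, hp1 _ (sgn_mem hc), add_zero, uncons_ι_mul,
        TensorProduct.map_tmul]
    exact this hz
  refine mem_mul_inf_ker (mulDiff k L) hz ?_
  have h3 : TensorProduct.map (sgn k L) (mulDiff k L) (uncons k _ z) = 0 := by
    have h4 := congrArg (fun w => p.rTensor _ (uncons k _ w)) h
    simp only [map_add, h1, add_zero, h2, map_zero] at h4
    exact h4
  have h4 := congrArg ((sgn k L).rTensor _) h3
  rw [map_zero, ← LinearMap.comp_apply, LinearMap.rTensor_comp_map] at h4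
  rw [← h4, LinearMap.lTensor]
  congr 2
  exact LinearMap.ext fun a => (sgn_sgn a).symm

theorem insertGen_mem {r s : ℕ} {w : Bar k L} (hw : w ∈ barWords (augPart k L) r s) (x : L) :
    insertGen k L w x ∈ barWords (augPart k L) (r + 1) s := by
  refine barWords_induction (V := augPart k L)
    (P := fun r s w => insertGen k L w x ∈ barWords (augPart k L) (r + 1) s) ?_ ?_ ?_ ?_ hw
  · intro r s; simp
  · intro r s x y hx hy; rw [map_add]; exact add_mem hx hy
  · intro c
    rw [map_smul, LinearMap.smul_apply, insertGen_one]
    exact Submodule.smul_mem _ _ (ι_mem_barWords (gen_mem x))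
  · intro r a b v hv w hw ih
    rw [insertGen_ι_mul]
    refine add_mem ?_ (ι_mul_mem_barWords hv ih)
    have := ι_mul_mem_barWords (gen_mem x) (ι_mul_mem_barWords hv hw)
    rwa [zero_add] at this

theorem homotopy_mem {i r s : ℕ} {c : augIdeal k L} (hc : c ∈ augPart k L (i + 1)) {w : Bar k L}
    (hw : w ∈ barWords (augPart k L) r s) :
    homotopy k L (ι k c * w) ∈ barWords (augPart k L) (r + 2) (i + s) := by
  obtain ⟨t, ht⟩ := partialTensor_mem_aug hc
  rw [homotopy_ι_mul, ← ht]
  clear ht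
  induction t with
  | zero => simp
  | add s t hs ht => simp only [map_add, LinearMap.add_apply]; exact add_mem hs ht
  | tmul x c =>
    simp only [LinearMap.lTensor_tmul, Submodule.subtype_apply, insertAfter_tmul, augProj_coe]
    exact ι_mul_mem_barWords c.2 (insertGen_mem hw x)

/-- Cocycles which are words in the generators are symmetric. -/
theorem topToRandom_eq_smul {r : ℕ} {u : Bar k L} (hu : u ∈ barWords (augPart k L) r 0)
    (hD : mulDiff k L u = 0) : topToRandom k L u = (r : k) • u := by
  induction r generalizing u with
  | zero =>
    rw [barWords, wordSpan, iSup_pos rfl] at hu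
    obtain ⟨c, rfl⟩ := Submodule.mem_one.mp hu
    simp [Algebra.algebraMap_eq_smul_one, topToRandom_one]
  | succ r ih =>
    have h0 : u ∈ (augPart k L 0).map (ι k) * barWords (augPart k L) r 0 := by
      refine wordSpan_succ_le ?_ hu
      intro a b hab v hv w hw
      obtain ⟨rfl, rfl⟩ : a = 0 ∧ b = 0 := by omega
      exact Submodule.mul_mem_mul hv hw
    have h1 := mem_mul_inf_ker_mulDiff h0 (zero_mem _) (by rwa [add_zero])
    -- By the previous lemma each summand x w has tail a cocycle; the homotopy formula and the
    -- induction hypothesis on w give x w + r x w.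
    have h2 : topToRandom k L u + homotopy k L (mulDiff k L u) = ((r + 1 : ℕ) : k) • u := by
      have : (augPart k L 0).map (ι k) *
          (barWords (augPart k L) r 0 ⊓ LinearMap.ker (mulDiff k L)) ≤
          LinearMap.eqLocus (topToRandom k L + homotopy k L ∘ₗ mulDiff k L)
            (((r + 1 : ℕ) : k) • LinearMap.id) := by
        refine Submodule.mul_le.mpr ?_
        rintro _ ⟨v, hv, rfl⟩ w ⟨hw, hw'⟩
        obtain ⟨x, rfl⟩ := exists_gen_of_mem hv
        replace hw' : mulDiff k L w = 0 := hw'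
        rw [LinearMap.mem_eqLocus, LinearMap.add_apply, LinearMap.comp_apply, mulDiff_ι_mul, hw',
          mul_zero, zero_add, topToRandom_gen_mul_eq x hw, ih hw hw']
        push_cast
        rw [mul_smul_comm, LinearMap.smul_apply, LinearMap.id_apply, add_smul, one_smul, add_comm]
      exact this h1
    rwa [hD, map_zero, add_zero] at h2

variable (k L) in
/-- The words `[c | w]` of total degree `J` for which `w` is of degree at most `d`. -/
noncomputable def tailSpan (r J d : ℕ) : Submodule k (Bar k L) :=
  ⨆ (a : ℕ) (b : ℕ) (_ : a + b = J ∧ b ≤ d),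
    (augPart k L a).map (ι k) * barWords (augPart k L) r b

theorem ι_mul_mem_tailSpan {r J d a b : ℕ} (h : a + b = J ∧ b ≤ d) {c : augIdeal k L}
    (hc : c ∈ augPart k L a) {w : Bar k L} (hw : w ∈ barWords (augPart k L) r b) :
    ι k c * w ∈ tailSpan k L r J d :=
  Submodule.mem_iSup_of_mem a (Submodule.mem_iSup_of_mem b (Submodule.mem_iSup_of_mem h
    (Submodule.mul_mem_mul (Submodule.mem_map_of_mem hc) hw)))

theorem tailSpan_le {r J d : ℕ} {W : Submodule k (Bar k L)}
    (h : ∀ a b, a + b = J → b ≤ d → ∀ c ∈ augPart k L a, ∀ w ∈ barWords (augPart k L) r b,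
      ι k c * w ∈ W) : tailSpan k L r J d ≤ W := by
  refine iSup₂_le fun a b => iSup_le fun hab => Submodule.mul_le.mpr ?_
  rintro _ ⟨c, hc, rfl⟩ w hw
  exact h a b hab.1 hab.2 c hc w hw

theorem barWords_succ_le_tailSpan (r J : ℕ) :
    barWords (augPart k L) (r + 1) J ≤ tailSpan k L r J J := by
  refine wordSpan_succ_le ?_
  rintro a b hab _ ⟨c, hc, rfl⟩ w hw
  exact ι_mul_mem_tailSpan (by omega) hc hw

/-- The multiplication of the first letters of words. -/
theorem head_mem {r a m : ℕ} {c : augIdeal k L} (hc : c ∈ augPart k L a) {w : Bar k L}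
    (hw : w ∈ barWords (augPart k L) (r + 1) m) :
    head k L c w ∈ tailSpan k L r (a + m + 1) m := by
  have : barWords (augPart k L) (r + 1) m ≤
      (tailSpan k L r (a + m + 1) m).comap (head k L c) := by
    refine wordSpan_succ_le ?_
    rintro i j hij _ ⟨v, hv, rfl⟩ w hw
    rw [Submodule.mem_comap, barHead_ι_mul]
    exact ι_mul_mem_tailSpan (by omega) (augMulShift_mem hc hv) hw
  exact this hw

variable (k L) in
/-- An abelian Lie coalgebra. -/
def abelian : LieCoalgebra k L where
  cobracket := 0
  skew x := by simp
  coJacobi := by simp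

/-- This is the codifferential for the zero cobracket. The product identities needed do not involve
the differential and are taken from the abelian Lie coalgebra. -/
theorem mulDiff_mulDiff [CharZero k] (w : Bar k L) : mulDiff k L (mulDiff k L w) = 0 :=
  barDiff_barDiff (sgn k L) 0 (augMulShift k L) (by simp) (by simp) sgn_sgn
    (abelian k L).reducedCE.sign_shiftedMul (by simp)
    (abelian k L).reducedCE.shiftedMul_shiftedMul w

/-- The tails are cocycles in r generators, on which `topToRandom` is multiplication by r. With the
Euler term j + 2, the homotopy h satisfies Dh + hD = j + 2 + r, which is invertible in
characteristic 0. -/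
theorem exists_mulDiff_eq_of_tail_zero [CharZero k] {r j : ℕ} {z : Bar k L}
    (hz : z ∈ (augPart k L (j + 1)).map (ι k) * barWords (augPart k L) r 0)
    (hD : mulDiff k L z = 0) :
    ∃ y ∈ barWords (augPart k L) (r + 2) j, mulDiff k L y = z := by
  have h1 := mem_mul_inf_ker_mulDiff hz (zero_mem _) (by rwa [add_zero])
  have h2 : (augPart k L (j + 1)).map (ι k) *
      (barWords (augPart k L) r 0 ⊓ LinearMap.ker (mulDiff k L)) ≤
      LinearMap.eqLocus (mulDiff k L ∘ₗ homotopy k L + homotopy k L ∘ₗ mulDiff k L)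
        (((j + 2 + r : ℕ) : k) • LinearMap.id) ⊓
      (barWords (augPart k L) (r + 2) j).comap (homotopy k L) := by
    refine Submodule.mul_le.mpr ?_
    rintro _ ⟨c, hc, rfl⟩ w ⟨hw, hw'⟩
    have h3 := homotopy_mem hc hw
    rw [add_zero] at h3
    refine ⟨?_, Submodule.mem_comap.mpr h3⟩
    replace hw' : mulDiff k L w = 0 := hw'
    rw [SetLike.mem_coe, LinearMap.mem_eqLocus, LinearMap.add_apply, LinearMap.comp_apply,
      LinearMap.comp_apply, mulDiff_ι_mul, hw', mul_zero, zero_add,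
      mulDiff_homotopy hc hw hw', topToRandom_eq_smul hw hw', mul_smul_comm, ← add_smul]
    push_cast
    rfl
  obtain ⟨h3, h4⟩ := h2 h1
  have h5 : mulDiff k L (homotopy k L z) = ((j + 2 + r : ℕ) : k) • z := by
    have : mulDiff k L (homotopy k L z) + homotopy k L (mulDiff k L z) =
      ((j + 2 + r : ℕ) : k) • z := h3
    rwa [hD, map_zero, add_zero] at this
  have h6 : ((j + 2 + r : ℕ) : k) ≠ 0 := Nat.cast_ne_zero.mpr (by omega)
  refine ⟨((j + 2 + r : ℕ) : k)⁻¹ • homotopy k L z, Submodule.smul_mem _ _ h4, ?_⟩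
  rw [map_smul, h5, smul_smul, inv_mul_cancel₀ h6, one_smul]

/-- If w = D y, then the differential of [σc | y] is [c | w] plus terms where c is multiplied into
y. Such products raise the degree of the first letter and so lower that of the tail. -/
theorem exists_sub_mulDiff_mem {r j d : ℕ} (hd : d ≤ j)
    (ih : ∀ w ∈ barWords (augPart k L) r (d + 1), mulDiff k L w = 0 →
      ∃ y ∈ barWords (augPart k L) (r + 1) d, mulDiff k L y = w) {z : Bar k L}
    (hz : z ∈ (augPart k L (j - d)).map (ι k) *
      (barWords (augPart k L) r (d + 1) ⊓ LinearMap.ker (mulDiff k L))) :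
    ∃ y ∈ barWords (augPart k L) (r + 2) j,
      z - mulDiff k L y ∈ tailSpan k L r (j + 1) d := by
  induction hz using Submodule.mul_induction_on' with
  | mem_mul_mem m hm w hw =>
    obtain ⟨c, hc, rfl⟩ := hm
    obtain ⟨y, hy, rfl⟩ := ih w hw.1 hw.2
    have h3 := ι_mul_mem_barWords (sgn_mem hc) hy
    have h4 := head_mem (sgn_mem hc) hy
    rw [Nat.sub_add_cancel hd] at h3 h4
    refine ⟨_, h3, ?_⟩
    rwa [mulDiff_ι_mul, sgn_sgn, sub_add_cancel_left, neg_mem_iff]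
  | add x _ y _ hx hy =>
    obtain ⟨x', hx', hx⟩ := hx
    obtain ⟨y', hy', hy⟩ := hy
    refine ⟨x' + y', add_mem hx' hy', ?_⟩
    rw [map_add, add_sub_add_comm]
    exact add_mem hx hy

/-- The cohomology of the bar construction of an exterior algebra is concentrated in degree
zero. -/
theorem exists_mulDiff_eq [CharZero k] {r j : ℕ} {z : Bar k L}
    (hz : z ∈ barWords (augPart k L) r (j + 1)) (hD : mulDiff k L z = 0) :
    ∃ y ∈ barWords (augPart k L) (r + 1) j, mulDiff k L y = z := by
  induction r generalizing j z with
  | zero =>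
    rw [barWords_zero_of_ne (Nat.succ_ne_zero j), Submodule.mem_bot] at hz
    exact ⟨0, zero_mem _, by rw [hz, map_zero]⟩
  | succ r ih =>
    -- Inner induction on a bound for the degree of the tails; the outer induction, on the length,
    -- makes tails that are cocycles of positive degree exact.
    have key : ∀ d, ∀ z ∈ tailSpan k L r (j + 1) d, mulDiff k L z = 0 →
        ∃ y ∈ barWords (augPart k L) (r + 2) j, mulDiff k L y = z := by
      intro d
      induction d with
      | zero =>
        intro z hz hD
        refine exists_mulDiff_eq_of_tail_zero (tailSpan_le ?_ hz) hD
        intro a b hab hb c hc w hw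
        obtain ⟨rfl, rfl⟩ : a = j + 1 ∧ b = 0 := by omega
        exact Submodule.mul_mem_mul (Submodule.mem_map_of_mem hc) hw
      | succ d ihd =>
        intro z hz hD
        -- For d > j a tail of degree d + 1 would exceed the total degree j + 1.
        rcases lt_or_ge j d with hd | hd
        · refine ihd z (tailSpan_le ?_ hz) hD
          exact fun a b hab hb c hc w hw => ι_mul_mem_tailSpan (by omega) hc hw
        -- Tails of maximal degree d + 1 accompany first letters of minimal degree j - d, so in a
        -- cocycle they are themselves cocycles.
        · have hsplit : tailSpan k L r (j + 1) (d + 1) ≤ (augPart k L (j - d)).map (ι k) *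
              barWords (augPart k L) r (d + 1) ⊔ tailSpan k L r (j + 1) d := by
            refine tailSpan_le fun a b hab hb c hc w hw => ?_
            by_cases hb' : b = d + 1
            · obtain rfl : a = j - d := by omega
              subst hb'
              exact Submodule.mem_sup_left
                (Submodule.mul_mem_mul (Submodule.mem_map_of_mem hc) hw)
            · exact Submodule.mem_sup_right (ι_mul_mem_tailSpan (by omega) hc hw)
          have hle : tailSpan k L r (j + 1) d ≤ (⨆ (i' : ℕ) (_ : j - d < i'),
              augPart k L i').map (ι k) * (⊤ : Submodule k (Bar k L)) := by
            refine tailSpan_le fun a b hab hb c hc w hw => ?_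
            exact Submodule.mul_mem_mul (Submodule.mem_map_of_mem (Submodule.mem_iSup_of_mem a
              (Submodule.mem_iSup_of_mem (by omega) hc))) Submodule.mem_top
          obtain ⟨z₁, hz₁, z₂, hz₂, rfl⟩ := Submodule.mem_sup.mp (hsplit hz)
          obtain ⟨y, hy, h3⟩ := exists_sub_mulDiff_mem hd (fun w hw hw' => ih hw hw')
            (mem_mul_inf_ker_mulDiff hz₁ (hle hz₂) hD)
          obtain ⟨y', hy', h4⟩ := ihd (z₁ - mulDiff k L y + z₂) (add_mem h3 hz₂) (by
            rw [sub_add_eq_add_sub, map_sub, hD, mulDiff_mulDiff, sub_zero])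
          exact ⟨y + y', add_mem hy hy', by rw [map_add, h4]; abel⟩
    exact key (j + 1) z (barWords_succ_le_tailSpan r (j + 1) hz) hD

end Koszul

/-! ### Componentwise solutions and splitting of filtrations -/

section Gradings

variable {k M N : Type*} [Field k] [AddCommGroup M] [Module k M] [AddCommGroup N] [Module k N]

/-- Independence of the images makes each component of a cocycle a cocycle, so the equation can be
solved componentwise. -/
theorem exists_eq_of_iSupIndep_map {I : Type*} {G : I → Submodule k M} {D : M →ₗ[k] N}
    {H : Submodule k M} {f : M →ₗ[k] M}
    (hG : iSupIndep fun i => (G i).map D)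
    (h : ∀ i, ∀ z ∈ G i, D z = 0 → ∃ y ∈ H, f y = z) {z : M} (hz : z ∈ ⨆ i, G i) (hD : D z = 0) :
    ∃ y ∈ H, f y = z := by
  classical
  obtain ⟨v, hv, rfl⟩ := (Submodule.mem_iSup_iff_exists_finsupp _ _).mp hz
  rw [Finsupp.sum, map_sum] at hD
  have h0 := (iSupIndep_iff_finsetSum_eq_zero_imp_eq_zero _).mp hG v.support (fun i => D (v i))
    (fun i _ => Submodule.mem_map_of_mem (hv i)) hD
  choose y hy hy' using fun i : v.support => h i (v i) (hv i) (h0 i i.2)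
  refine ⟨∑ i, y i, sum_mem fun i _ => hy i, ?_⟩
  rw [map_sum, Finsupp.sum, ← Finset.sum_attach v.support, Finset.univ_eq_attach]
  exact Finset.sum_congr rfl fun i _ => hy' i

/-- An exhaustive filtration of a vector space splits. -/
theorem exists_isInternal_of_filtration {F : ℕ → Submodule k M} (hmono : Monotone F)
    (hF : ⨆ i, F i = ⊤) : ∃ g : ℕ → Submodule k M, DirectSum.IsInternal g ∧
      ∀ n, F n = ⨆ (i : ℕ) (_ : i ≤ n), g i := by
  have hex : ∀ n, ∃ C, F n ⊔ C = F (n + 1) ∧ Disjoint (F n) C := by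
    intro n
    obtain ⟨C, hC⟩ := Submodule.exists_isCompl (F n)
    refine ⟨C ⊓ F (n + 1), ?_, hC.disjoint.mono_right inf_le_left⟩
    rw [← sup_inf_assoc_of_le C (hmono (Nat.le_add_right n 1)), hC.sup_eq_top, top_inf_eq]
  choose C hC hdisj using hex
  -- The summands are F 0 and a complement of each F n in F (n + 1).
  let g : ℕ → Submodule k M := fun n => Nat.casesOn n (F 0) C
  have hg : ∀ n, F n = ⨆ (i : ℕ) (_ : i ≤ n), g i := by
    intro n
    induction n with
    | zero => simp [g]
    | succ n ih =>
      rw [← hC, ih]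
      apply le_antisymm
      · exact sup_le (iSup₂_le fun i hi => le_iSup₂_of_le i (by omega) le_rfl)
          (le_iSup₂_of_le (n + 1) le_rfl le_rfl)
      · refine iSup₂_le fun i hi => ?_
        rcases Nat.lt_or_ge i (n + 1) with h | h
        · exact le_sup_of_le_left (le_iSup₂_of_le i (by omega) le_rfl)
        · obtain rfl : i = n + 1 := by omega
          exact le_sup_right
  refine ⟨g, DirectSum.isInternal_submodule_of_iSupIndep_of_iSup_eq_top ?_ ?_, hg⟩
  · rw [iSupIndep_iff_finsetSum_eq_zero_imp_eq_zero]
    intro s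
    -- In a vanishing sum the term of largest index n + 1 lies both in F n and in its complement.
    induction s using Finset.induction_on_max with
    | empty => simp
    | insert n s hs ih =>
      intro v hv h0
      have hns : n ∉ s := fun h => (hs n h).false
      rw [Finset.sum_insert hns] at h0
      have hn : v n = 0 := by
        rcases n with _ | n
        · have : s = ∅ := Finset.eq_empty_of_forall_notMem fun i hi => absurd (hs i hi) (by omega)
          simpa [this] using h0
        · refine Submodule.disjoint_def.mp (hdisj n) _ ?_ (hv (n + 1) (Finset.mem_insert_self _ _))
          rw [eq_neg_of_add_eq_zero_left h0, neg_mem_iff, hg]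
          refine sum_mem fun i hi => Submodule.mem_iSup_of_mem i (Submodule.mem_iSup_of_mem
            (Nat.lt_succ_iff.mp (hs i hi)) (hv i (Finset.mem_insert_of_mem hi)))
      rw [hn, zero_add] at h0
      intro i hi
      rcases Finset.mem_insert.mp hi with rfl | hi
      · exact hn
      · exact ih v (fun j hj => hv j (Finset.mem_insert_of_mem hj)) h0 i hi
  · rw [eq_top_iff, ← hF]
    refine iSup_le fun n => ?_
    rw [hg]
    exact iSup₂_le fun i _ => le_iSup g i

end Gradings

/-! ### Weights -/

namespace Koszul

open LieCoalgebra TensorAlgebra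

variable {k L : Type*} [Field k] [AddCommGroup L] [Module k L]

/-- The span of the products of `l` elements of `L` of total weight `n`. -/
noncomputable def extPart (g : ℕ → Submodule k L) (l n : ℕ) : Submodule k (ExteriorAlgebra k L) :=
  wordSpan (fun i => (g i).map (ExteriorAlgebra.ι k)) l n

/-- The letters of degree `i` and weight `n`. -/
noncomputable def letterPart (g : ℕ → Submodule k L) (p : ℕ × ℕ) : Submodule k (augIdeal k L) :=
  (extPart g (p.1 + 1) p.2).comap (augIdeal k L).subtype

variable {g : ℕ → Submodule k L}

theorem extPart_le (l n : ℕ) : extPart g l n ≤ ⋀[k]^l L :=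
  (wordSpan_le_pow l n).trans (pow_le_pow_left' (iSup_le fun i => by
    rintro _ ⟨x, -, rfl⟩; exact ⟨x, rfl⟩) l)

theorem exteriorPower_le_iSup (hg : ⨆ n, g n = ⊤) (l : ℕ) : ⋀[k]^l L ≤ ⨆ n, extPart g l n := by
  refine le_trans ?_ (pow_le_iSup_wordSpan l)
  rw [← Submodule.map_iSup, hg, Submodule.map_top]

theorem letterPart_le (i n : ℕ) : letterPart g (i, n) ≤ augPart k L i :=
  Submodule.comap_mono (extPart_le _ _)

theorem augPart_le_iSup (hg : ⨆ n, g n = ⊤) (i : ℕ) :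
    augPart k L i ≤ ⨆ n, letterPart g (i, n) := by
  intro a ha
  have h1 : (a : ExteriorAlgebra k L) ∈ (⨆ n, letterPart g (i, n)).map (augIdeal k L).subtype := by
    rw [Submodule.map_iSup]
    refine (iSup_mono fun n c hc => ?_ : ⨆ n, extPart g (i + 1) n ≤ _)
      (exteriorPower_le_iSup hg (i + 1) (mem_augPart.mp ha))
    exact ⟨⟨c, mem_augIdeal_of_mem (Nat.succ_ne_zero i) (extPart_le _ _ hc)⟩, hc, rfl⟩
  obtain ⟨b, hb, hab⟩ := h1
  rwa [← Subtype.ext hab]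

theorem sgn_mem_letterPart {p : ℕ × ℕ} {a : augIdeal k L} (ha : a ∈ letterPart g p) :
    sgn k L a ∈ letterPart g p := by
  rw [letterPart, Submodule.mem_comap, Submodule.subtype_apply, coe_sgn,
    parity_apply (mem_augPart.mp (letterPart_le _ _ ha))]
  exact neg_mem (zsmul_mem ha _)

/-- The product preserves the weight and, in the shifted degree, adds one. -/
theorem augMulShift_mem_letterPart {p q : ℕ × ℕ} {a b : augIdeal k L} (ha : a ∈ letterPart g p)
    (hb : b ∈ letterPart g q) : augMulShift k L a b ∈ letterPart g (p + q + (1, 0)) := by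
  rw [letterPart, Submodule.mem_comap, Submodule.subtype_apply, coe_augMulShift,
    parity_apply (mem_augPart.mp (letterPart_le _ _ ha)), smul_mul_assoc]
  have := wordSpan_mul_mem (Submodule.mem_comap.mp ha) (Submodule.mem_comap.mp hb)
  refine zsmul_mem ?_ _
  have h1 : (p + q + (1, 0)).1 + 1 = p.1 + 1 + (q.1 + 1) := by
    simp only [Prod.fst_add]; ring
  have h2 : (p + q + (1, 0)).2 = p.2 + q.2 := by simp
  rw [h1, h2]
  exact this

/-- The derivation of the exterior algebra extending `E`. -/
noncomputable def extDerivation (E : L →ₗ[k] L) : ExteriorAlgebra k L →ₗ[k] ExteriorAlgebra k L :=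
  mulTensor k L ∘ₗ E.rTensor _ ∘ₗ partialTensor k L

theorem extDerivation_ι_mul (E : L →ₗ[k] L) (x : L) (c : ExteriorAlgebra k L) :
    extDerivation E (ExteriorAlgebra.ι k x * c) =
      ExteriorAlgebra.ι k (E x) * c + ExteriorAlgebra.ι k x * extDerivation E c := by
  simp only [extDerivation, LinearMap.comp_apply, partialTensor_ι_mul, map_sub,
    LinearMap.rTensor_tmul, mulTensor_tmul]
  rw [← LinearMap.comp_apply (E.rTensor _), LinearMap.rTensor_comp_lTensor,
    ← LinearMap.lTensor_comp_rTensor, LinearMap.comp_apply, mulTensor_mulLeft, sub_neg_eq_add]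

theorem extDerivation_of_mem (E : L →ₗ[k] L) (hE : ∀ n, ∀ x ∈ g n, E x = (n : k) • x) {l n : ℕ}
    {c : ExteriorAlgebra k L} (hc : c ∈ extPart g l n) : extDerivation E c = (n : k) • c := by
  refine wordSpan_induction (P := fun _ (n : ℕ) c => extDerivation E c = (n : k) • c) ?_ ?_ ?_ ?_ hc
  · simp
  · intro r s x y hx hy; rw [map_add, hx, hy, smul_add]
  · intro c
    simp [extDerivation, partialTensor_algebraMap]
  · rintro r a b _ ⟨x, hx, rfl⟩ w _ ih
    rw [extDerivation_ι_mul, hE a x hx, ih, map_smul, smul_mul_assoc, mul_smul_comm, ← add_smul,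
      Nat.cast_add]

theorem extDerivation_mem (E : L →ₗ[k] L) (c : ExteriorAlgebra k L) :
    extDerivation E c ∈ augIdeal k L := by
  rw [mem_augIdeal, extDerivation, LinearMap.comp_apply]
  generalize (E.rTensor _ ∘ₗ partialTensor k L) c = t
  induction t with
  | zero => simp
  | add s t hs ht => rw [map_add, map_add, hs, ht, add_zero]
  | tmul x c => rw [mulTensor_tmul, map_mul]; simp [ExteriorAlgebra.algebraMapInv]

/-- The weight is the eigenvalue of the operator obtained by extending multiplication by weights on
L to a derivation of ΛL and then of the tensor algebra. -/
theorem iSupIndep_weight [CharZero k] (hg : DirectSum.IsInternal g) (j : ℕ) :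
    iSupIndep fun n => ⨆ r, barWords (letterPart g) r (j, n) := by
  let E := (extDerivation (diagonalMap hg fun n => (n : k)) ∘ₗ (augIdeal k L).subtype).codRestrict
    (augIdeal k L) fun c => extDerivation_mem _ _
  refine iSupIndep_of_apply_eq_smul (barDiff LinearMap.id E 0) (fun n => (n : k))
    Nat.cast_injective ?_
  intro n x hx
  have : (⨆ r, barWords (letterPart g) r (j, n)) ≤
      LinearMap.eqLocus (barDiff LinearMap.id E 0) ((n : k) • LinearMap.id) := by
    refine iSup_le fun r w hw => ?_
    rw [LinearMap.mem_eqLocus, barDiff_id_of_mem_barWords E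
      ((Nat.castAddMonoidHom k).comp (AddMonoidHom.snd ℕ ℕ)) 0 ?_ hw]
    · simp
    · intro p a ha
      apply Subtype.ext
      simpa [E] using extDerivation_of_mem _ (fun n x hx => diagonalMap_apply hg _ hx)
        (Submodule.mem_comap.mp ha)
  exact this hx

theorem head_mem_letterWords {r : ℕ} {p q : ℕ × ℕ} {a : augIdeal k L} (ha : a ∈ letterPart g p)
    {w : Bar k L} (hw : w ∈ barWords (letterPart g) r q) :
    head k L a w ∈ barWords (letterPart g) r (p + q + (1, 0)) := by
  refine barWords_induction (V := letterPart g) (P := fun r q w =>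
    head k L a w ∈ barWords (letterPart g) r (p + q + (1, 0))) ?_ ?_ ?_ ?_ hw
  · intro r s; simp
  · intro r s x y hx hy; rw [map_add]; exact add_mem hx hy
  · intro c; simp [barHead_one]
  · intro r s t v hv w hw _
    rw [barHead_ι_mul]
    have := ι_mul_mem_barWords (augMulShift_mem_letterPart ha hv) hw
    rwa [show p + s + (1, 0) + t = p + (s + t) + (1, 0) by abel] at this

theorem mulDiff_of_mem_zero {p : ℕ × ℕ} {w : Bar k L} (hw : w ∈ barWords (letterPart g) 0 p) :
    mulDiff k L w = 0 := by
  refine barWords_induction (V := letterPart g) (P := fun r s w => r = 0 →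
    mulDiff k L w = 0) ?_ ?_ ?_ ?_ hw rfl
  · simp
  · intro r s x y hx hy h; rw [map_add, hx h, hy h, add_zero]
  · intro c _; rw [map_smul, barDiff_one, smul_zero]
  · intro r a b v _ w _ _ h; omega

theorem mulDiff_mem {r : ℕ} {p : ℕ × ℕ} {w : Bar k L} (hw : w ∈ barWords (letterPart g) (r + 1) p) :
    mulDiff k L w ∈ barWords (letterPart g) r (p + (1, 0)) := by
  have : ∀ r', ∀ p, ∀ w ∈ barWords (letterPart g) r' p, ∀ r, r' = r + 1 →
      mulDiff k L w ∈ barWords (letterPart g) r (p + (1, 0)) := by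
    intro r' p w hw
    refine barWords_induction (V := letterPart g) (P := fun r' p w => ∀ r, r' = r + 1 →
      mulDiff k L w ∈ barWords (letterPart g) r (p + (1, 0))) ?_ ?_ ?_ ?_ hw
    · intro r s r' _; simp
    · intro r s x y hx hy r' h; rw [map_add]; exact add_mem (hx r' h) (hy r' h)
    · intro c r h; omega
    · rintro r a b v hv w hw ih r' h
      obtain rfl : r = r' := by omega
      rw [mulDiff_ι_mul]
      refine add_mem ?_ (head_mem_letterWords hv hw)
      rcases r with _ | r
      · rw [mulDiff_of_mem_zero hw, mul_zero]
        exact zero_mem _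
      · rw [add_assoc]
        exact ι_mul_mem_barWords (sgn_mem_letterPart hv) (ih r rfl)
  exact this _ p w hw r rfl

end Koszul

/-! ### Induction on the weight -/

namespace Koszul

open LieCoalgebra TensorAlgebra

variable {k L : Type*} [Field k] [AddCommGroup L] [Module k L] {g : ℕ → Submodule k L}

theorem mem_iSup_letterPart {i n : ℕ} {a : augIdeal k L}
    (ha : (a : ExteriorAlgebra k L) ∈ ⨆ (m : ℕ) (_ : m < n), extPart g (i + 1) m) :
    a ∈ ⨆ (m : ℕ) (_ : m < n), letterPart g (i, m) := by
  have h1 : (a : ExteriorAlgebra k L) ∈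
      (⨆ (m : ℕ) (_ : m < n), letterPart g (i, m)).map (augIdeal k L).subtype := by
    simp only [Submodule.map_iSup]
    refine (iSup₂_mono fun m _ c hc => ?_ : (⨆ (m : ℕ) (_ : m < n), extPart g (i + 1) m) ≤ _) ha
    exact ⟨⟨c, mem_augIdeal_of_mem (Nat.succ_ne_zero i) (extPart_le _ _ hc)⟩, hc, rfl⟩
  obtain ⟨b, hb, hab⟩ := h1
  rwa [← Subtype.ext hab]

theorem letterWords_le {r : ℕ} {p : ℕ × ℕ} :
    barWords (letterPart g) r p ≤ barWords (augPart k L) r p.1 := by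
  intro w hw
  refine barWords_induction (V := letterPart g)
    (P := fun r p w => w ∈ barWords (augPart k L) r p.1) ?_ ?_ ?_ ?_ hw
  · exact fun r p => zero_mem _
  · exact fun r p x y => add_mem
  · exact fun c => Submodule.smul_mem _ _ one_mem_barWords
  · exact fun r a b v hv w _ hw => ι_mul_mem_barWords (letterPart_le _ _ hv) hw

variable (g) in
/-- The part of the bar construction of degree `j` and weight `n`. -/
noncomputable def weightPart (j n : ℕ) : Submodule k (Bar k L) :=
  ⨆ r, barWords (letterPart g) r (j, n)

theorem letterWords_le_weightPart (r j n : ℕ) :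
    barWords (letterPart g) r (j, n) ≤ weightPart g j n :=
  le_iSup (fun r => barWords (letterPart g) r (j, n)) r

/-- A letter has finitely many weight components, so the induction on the weight can start. -/
theorem exists_weight_lt (hg : DirectSum.IsInternal g) {i : ℕ} {a : augIdeal k L}
    (ha : a ∈ augPart k L i) : ∃ N, ι k a ∈ ⨆ (n : ℕ) (_ : n < N), weightPart g i n := by
  have hz := barWords_le_iSup (augPart_le_iSup hg.submodule_iSup_eq_top) 1 i (ι_mem_barWords ha)
  rw [← Submodule.mem_iSup_of_directed]
  · refine (iSup_le fun n => ?_ : (⨆ n, barWords (letterPart g) 1 (i, n)) ≤ _) hz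
    exact le_iSup_of_le (n + 1) (le_iSup₂_of_le n n.lt_succ_self
      (letterWords_le_weightPart 1 i n))
  · exact directed_of_isDirected_le fun M N hMN => iSup₂_le fun n hn =>
      le_iSup₂_of_le n (hn.trans_le hMN) le_rfl

theorem mulDiff_mem_weightPart {j n : ℕ} {w : Bar k L} (hw : w ∈ weightPart g j n) :
    mulDiff k L w ∈ weightPart g (j + 1) n := by
  have : weightPart g j n ≤ (weightPart g (j + 1) n).comap (mulDiff k L) := by
    refine iSup_le fun r w hw => ?_
    rw [Submodule.mem_comap]
    rcases r with _ | r
    · rw [mulDiff_of_mem_zero hw]; exact zero_mem _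
    · exact letterWords_le_weightPart r (j + 1) n (mulDiff_mem hw)
  exact this hw

/-- The product part preserves the weight, so a primitive furnished by Koszulness may be cut down to
its component of weight n. -/
theorem exists_mulDiff_eq_of_mem_letterWords [CharZero k] (hg : DirectSum.IsInternal g)
    {r j n : ℕ} {z : Bar k L} (hz : z ∈ barWords (letterPart g) r (j + 1, n))
    (hD : mulDiff k L z = 0) : ∃ y ∈ barWords (letterPart g) (r + 1) (j, n), mulDiff k L y = z := by
  obtain ⟨y, hy, rfl⟩ := exists_mulDiff_eq (letterWords_le hz) hD
  refine exists_homogeneous_preimage (G := fun n => barWords (letterPart g) (r + 1) (j, n))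
    (G' := fun n => barWords (letterPart g) r (j + 1, n)) (fun n x hx => mulDiff_mem hx)
    ((iSupIndep_weight hg (j + 1)).mono fun n => letterWords_le_weightPart r (j + 1) n) ?_ hz
  exact barWords_le_iSup (augPart_le_iSup hg.submodule_iSup_eq_top) (r + 1) j hy

/-- The images of words of length r have length r - 1, detected by the derivation that counts
letters. Constants have zero image, so the eigenvalue -1 at r = 0 is harmless. -/
theorem iSupIndep_map_mulDiff [CharZero k] (p : ℕ × ℕ) :
    iSupIndep fun r => (barWords (letterPart g) r p).map (mulDiff k L) := by
  refine iSupIndep_of_apply_eq_smul (barDiff LinearMap.id LinearMap.id 0)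
    (fun r => (r : k) - 1) (fun r s h => Nat.cast_injective (sub_left_injective h)) ?_
  rintro r _ ⟨w, hw, rfl⟩
  rcases r with _ | r
  · rw [mulDiff_of_mem_zero hw, map_zero, smul_zero]
  · rw [barDiff_id_of_mem_barWords LinearMap.id 0 1 (by simp) (mulDiff_mem hw)]
    simp

theorem exists_mulDiff_eq_of_mem_weightPart [CharZero k] (hg : DirectSum.IsInternal g)
    {j n : ℕ} {z : Bar k L} (hz : z ∈ weightPart g (j + 1) n) (hD : mulDiff k L z = 0) :
    ∃ y ∈ weightPart g j n, mulDiff k L y = z := by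
  refine exists_eq_of_iSupIndep_map (iSupIndep_map_mulDiff (j + 1, n)) ?_ hz hD
  intro r z hz hD
  obtain ⟨y, hy, hyz⟩ := exists_mulDiff_eq_of_mem_letterWords hg hz hD
  exact ⟨y, letterWords_le_weightPart _ j n hy, hyz⟩

/-- A differential on letters which lowers the weight lowers the weight of words. -/
theorem barDiff_mem_of_lowers {d : augIdeal k L →ₗ[k] augIdeal k L}
    (hd : ∀ i n, ∀ a ∈ letterPart g (i, n), d a ∈ ⨆ (m : ℕ) (_ : m < n), letterPart g (i + 1, m))
    {j n : ℕ} {w : Bar k L} (hw : w ∈ weightPart g j n) :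
    barDiff (sgn k L) d 0 w ∈ ⨆ (m : ℕ) (_ : m < n), weightPart g (j + 1) m := by
  have key : ∀ r, ∀ p : ℕ × ℕ, ∀ w ∈ barWords (letterPart g) r p, barDiff (sgn k L) d 0 w ∈
      ⨆ (m : ℕ) (_ : m < p.2), barWords (letterPart g) r (p.1 + 1, m) := by
    intro r p w hw
    refine barWords_induction (V := letterPart g) (P := fun r p w => barDiff (sgn k L) d 0 w ∈
      ⨆ (m : ℕ) (_ : m < p.2), barWords (letterPart g) r (p.1 + 1, m)) ?_ ?_ ?_ ?_ hw
    · intro r p; simp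
    · intro r p x y hx hy; rw [map_add]; exact add_mem hx hy
    · intro c; simp [barDiff_one]
    · intro r a b v hv w hw ih
      rw [barDiff_zero_ι_mul]
      refine add_mem ?_ ?_
      · have : (⨆ (m : ℕ) (_ : m < a.2), letterPart g (a.1 + 1, m)) ≤
            (⨆ (m : ℕ) (_ : m < (a + b).2), barWords (letterPart g) (r + 1)
              ((a + b).1 + 1, m)).comap (LinearMap.mulRight k w ∘ₗ ι k) := by
          refine iSup₂_le fun m hm c hc => ?_
          refine Submodule.mem_iSup_of_mem (m + b.2) (Submodule.mem_iSup_of_mem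
            (by simpa using hm) ?_)
          have h1 := ι_mul_mem_barWords hc hw
          rwa [show ((a.1 + 1, m) + b : ℕ × ℕ) = ((a + b).1 + 1, m + b.2) from
            Prod.ext (by simp only [Prod.fst_add]; ring) rfl] at h1
        exact this (hd a.1 a.2 v hv)
      · have : (⨆ (m : ℕ) (_ : m < b.2), barWords (letterPart g) r (b.1 + 1, m)) ≤
            (⨆ (m : ℕ) (_ : m < (a + b).2), barWords (letterPart g) (r + 1)
              ((a + b).1 + 1, m)).comap (LinearMap.mulLeft k (ι k (sgn k L v))) := by
          refine iSup₂_le fun m hm c hc => ?_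
          refine Submodule.mem_iSup_of_mem (a.2 + m) (Submodule.mem_iSup_of_mem
            (by simpa using hm) ?_)
          have h1 := ι_mul_mem_barWords (sgn_mem_letterPart hv) hc
          rwa [show (a + (b.1 + 1, m) : ℕ × ℕ) = ((a + b).1 + 1, a.2 + m) from
            Prod.ext (by simp only [Prod.fst_add]; ring) rfl] at h1
        exact this ih
  have : weightPart g j n ≤ (⨆ (m : ℕ) (_ : m < n), weightPart g (j + 1) m).comap
      (barDiff (sgn k L) d 0) := by
    refine iSup_le fun r w hw => ?_
    exact (iSup₂_mono fun m _ => letterWords_le_weightPart r (j + 1) m :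
      (⨆ (m : ℕ) (_ : m < n), barWords (letterPart g) r (j + 1, m)) ≤ _) (key r (j, n) w hw)
  exact this hw

/-- The splitting behind the weight argument: a product part that preserves the weight and the
extension of d, which will lower it. -/
theorem barDiff_eq_add (d : augIdeal k L →ₗ[k] augIdeal k L) (w : Bar k L) :
    barDiff (sgn k L) d (augMulShift k L) w = mulDiff k L w + barDiff (sgn k L) d 0 w := by
  have hh : ∀ a, barHead (sgn k L) d (augMulShift k L) a = head k L a := by
    intro a
    apply ext_word
    · simp [barHead_one]
    · intro v w _; simp [barHead_ι_mul]
  have := ext_word (k := k) (A := augIdeal k L) (f := barDiff (sgn k L) d (augMulShift k L))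
    (g := mulDiff k L + barDiff (sgn k L) d 0) (by simp [barDiff_one]) (by
      intro v w hw
      rw [barDiff_ι_mul, hw, LinearMap.add_apply, LinearMap.add_apply, mulDiff_ι_mul,
        barDiff_zero_ι_mul, hh, mul_add]
      abel)
  exact LinearMap.congr_fun this w

/-- If the differential lowers the weight, the bar construction has no cohomology in positive
degrees. -/
theorem exists_barDiff_eq [CharZero k] (hg : DirectSum.IsInternal g)
    {d : augIdeal k L →ₗ[k] augIdeal k L}
    (hd : ∀ i n, ∀ a ∈ letterPart g (i, n), d a ∈ ⨆ (m : ℕ) (_ : m < n), letterPart g (i + 1, m))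
    (hDD : ∀ w, barDiff (sgn k L) d (augMulShift k L) (barDiff (sgn k L) d (augMulShift k L) w) = 0)
    {j N : ℕ} {z : Bar k L} (hz : z ∈ ⨆ (n : ℕ) (_ : n < N), weightPart g (j + 1) n)
    (hD : barDiff (sgn k L) d (augMulShift k L) z = 0) :
    ∃ y, barDiff (sgn k L) d (augMulShift k L) y = z := by
  induction N generalizing z with
  | zero =>
    simp only [not_lt_zero, iSup_false, iSup_bot, Submodule.mem_bot] at hz
    exact ⟨0, by rw [hz, map_zero]⟩
  | succ N ih =>
    have hsplit : (⨆ (n : ℕ) (_ : n < N + 1), weightPart g (j + 1) n) ≤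
        weightPart g (j + 1) N ⊔ ⨆ (n : ℕ) (_ : n < N), weightPart g (j + 1) n := by
      refine iSup₂_le fun n hn => ?_
      rcases Nat.lt_or_ge n N with h | h
      · exact le_sup_of_le_right (le_iSup₂_of_le n h le_rfl)
      · obtain rfl : n = N := by omega
        exact le_sup_left
    obtain ⟨z₁, hz₁, z₂, hz₂, rfl⟩ := Submodule.mem_sup.mp (hsplit hz)
    have hlow : barDiff (sgn k L) d (augMulShift k L) z₂ ∈
        ⨆ (n : ℕ) (_ : n < N), weightPart g (j + 2) n := by
      have : (⨆ (n : ℕ) (_ : n < N), weightPart g (j + 1) n) ≤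
          (⨆ (n : ℕ) (_ : n < N), weightPart g (j + 2) n).comap
            (barDiff (sgn k L) d (augMulShift k L)) := by
        refine iSup₂_le fun n hn w hw => ?_
        rw [Submodule.mem_comap, barDiff_eq_add]
        refine add_mem (Submodule.mem_iSup_of_mem n (Submodule.mem_iSup_of_mem hn
          (mulDiff_mem_weightPart hw))) ?_
        exact (iSup₂_le fun m hm => le_iSup₂_of_le m (hm.trans hn) le_rfl :
          (⨆ (m : ℕ) (_ : m < n), weightPart g (j + 2) m) ≤ _) (barDiff_mem_of_lowers hd hw)
      exact this hz₂
    -- All other terms of the codifferential have weight below N, so the component of weight N gives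
    -- this equation.
    have h0 : mulDiff k L z₁ = 0 := by
      refine Submodule.disjoint_def.mp (iSupIndep_weight hg (j + 2) N) _
        (mulDiff_mem_weightPart hz₁) ?_
      rw [map_add, barDiff_eq_add, add_assoc] at hD
      rw [eq_neg_of_add_eq_zero_left hD, neg_mem_iff]
      exact (iSup₂_mono' fun n hn => ⟨n, hn.ne, le_rfl⟩ :
        (⨆ (n : ℕ) (_ : n < N), weightPart g (j + 2) n) ≤ _)
        (add_mem (barDiff_mem_of_lowers hd hz₁) hlow)
    obtain ⟨y, hy, rfl⟩ := exists_mulDiff_eq_of_mem_weightPart hg hz₁ h0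
    -- Subtracting the full codifferential of y removes z₁ and leaves only weights below N.
    obtain ⟨y', hy'⟩ := ih (z := z₂ - barDiff (sgn k L) d 0 y)
      (sub_mem hz₂ (barDiff_mem_of_lowers hd hy)) (by
        have h1 : z₂ - barDiff (sgn k L) d 0 y = (mulDiff k L y + z₂) -
            barDiff (sgn k L) d (augMulShift k L) y := by
          rw [barDiff_eq_add d y]; abel
        rw [h1, map_sub, hD, hDD, sub_zero])
    refine ⟨y + y', ?_⟩
    rw [map_add, hy', barDiff_eq_add]
    abel

end Koszul

/-! ### Chevalley-Eilenberg algebras of conilpotent Lie coalgebras -/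

namespace LieCoalgebra

open Koszul TensorAlgebra

variable {k L : Type*} [Field k] [AddCommGroup L] [Module k L] (𝓛 : LieCoalgebra k L)

/-- A conilpotent Lie coalgebra has a grading such that the cobracket lowers weights. -/
theorem IsConilpotent.exists_grading {𝓛 : LieCoalgebra k L} (h : 𝓛.IsConilpotent) :
    ∃ g : ℕ → Submodule k L, DirectSum.IsInternal g ∧ ∀ n, ∀ x ∈ g n, 𝓛.cobracket x ∈
      ⨆ (p : ℕ) (q : ℕ) (_ : p + q < n),
        LinearMap.range (TensorProduct.map (g p).subtype (g q).subtype) := by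
  obtain ⟨F, hmono, hF, h0, hΔ⟩ := h
  -- Here F p acquires the weights up to 2p - 1. For p + q = i the total weight is at most 2i - 2,
  -- whereas any n with ⌊(n + 1)/2⌋ = i is at least 2i - 1, so the cobracket strictly lowers the
  -- weight.
  obtain ⟨g, hg, hFg⟩ := exists_isInternal_of_filtration (F := fun n => F ((n + 1) / 2))
    (fun m n hmn => hmono (by omega)) (by
      rw [eq_top_iff, ← hF]
      exact iSup_le fun i => le_iSup_of_le (2 * i) (hmono (by omega)))
  refine ⟨g, hg, fun n x hx => ?_⟩
  have hx' : x ∈ F ((n + 1) / 2) := by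
    have : F ((n + 1) / 2) = _ := hFg n
    rw [this]
    exact Submodule.mem_iSup_of_mem n (Submodule.mem_iSup_of_mem le_rfl hx)
  refine Set.mem_of_mem_of_subset (hΔ _ x hx') (SetLike.coe_subset_coe.mpr
    (iSup₂_le fun p q => iSup_le fun hpq => ?_))
  set W := ⨆ (p : ℕ) (q : ℕ) (_ : p + q < n),
    LinearMap.range (TensorProduct.map (g p).subtype (g q).subtype) with hW
  have htmul : ∀ a ∈ F p, ∀ b ∈ F q, a ⊗ₜ[k] b ∈ W := by
    intro a ha b hb
    -- Terms with p = 0 or q = 0 vanish because F 0 = 0; for them the bound 2p - 1 would be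
    -- truncated.
    rcases Nat.eq_zero_or_pos p with rfl | hp
    · rw [h0, Submodule.mem_bot] at ha
      rw [ha, TensorProduct.zero_tmul]; exact zero_mem _
    rcases Nat.eq_zero_or_pos q with rfl | hq
    · rw [h0, Submodule.mem_bot] at hb
      rw [hb, TensorProduct.tmul_zero]; exact zero_mem _
    have hFp : F p = ⨆ (i : ℕ) (_ : i ≤ 2 * p - 1), g i := by
      rw [← hFg, show (2 * p - 1 + 1) / 2 = p by omega]
    have hFq : F q = ⨆ (i : ℕ) (_ : i ≤ 2 * q - 1), g i := by
      rw [← hFg, show (2 * q - 1 + 1) / 2 = q by omega]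
    have h1 : F p ≤ W.comap ((TensorProduct.mk k L L).flip b) := by
      rw [hFp]
      refine iSup₂_le fun i hi a ha => ?_
      have h2 : F q ≤ W.comap (TensorProduct.mk k L L a) := by
        rw [hFq]
        refine iSup₂_le fun j hj b hb => ?_
        exact Submodule.mem_iSup_of_mem i (Submodule.mem_iSup_of_mem j (Submodule.mem_iSup_of_mem
          (by omega) ⟨⟨a, ha⟩ ⊗ₜ ⟨b, hb⟩, rfl⟩))
      exact h2 hb
    exact h1 ha
  rintro _ ⟨t, rfl⟩
  induction t with
  | zero => simp
  | add s t hs ht => rw [map_add]; exact add_mem hs ht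
  | tmul a b => exact htmul a a.2 b b.2

/-- The differential lowers weights if the cobracket does. -/
theorem diff_mem_of_lowers {g : ℕ → Submodule k L} (hΔ : ∀ n, ∀ x ∈ g n, 𝓛.cobracket x ∈
    ⨆ (p : ℕ) (q : ℕ) (_ : p + q < n),
      LinearMap.range (TensorProduct.map (g p).subtype (g q).subtype)) {l n : ℕ}
    {c : ExteriorAlgebra k L} (hc : c ∈ extPart g l n) :
    𝓛.diff c ∈ ⨆ (m : ℕ) (_ : m < n), extPart g (l + 1) m := by
  have hwedge : ∀ n, ∀ x ∈ g n, 𝓛.diff (ExteriorAlgebra.ι k x) ∈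
      ⨆ (m : ℕ) (_ : m < n), extPart g 2 m := by
    intro n x hx
    rw [diff_ι]
    refine Submodule.smul_mem _ _ ?_
    have : (⨆ (p : ℕ) (q : ℕ) (_ : p + q < n),
        LinearMap.range (TensorProduct.map (g p).subtype (g q).subtype)) ≤
        (⨆ (m : ℕ) (_ : m < n), extPart g 2 m).comap (wedge k L) := by
      refine iSup₂_le fun p q => iSup_le fun hpq => ?_
      rintro _ ⟨t, rfl⟩
      refine Submodule.mem_iSup_of_mem (p + q) (Submodule.mem_iSup_of_mem hpq ?_)
      induction t with
      | zero => simp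
      | add s t hs ht => rw [map_add, map_add]; exact add_mem hs ht
      | tmul a b =>
        rw [TensorProduct.map_tmul, wedge_tmul]
        have h1 := mul_mem_wordSpan (V := fun i => (g i).map (ExteriorAlgebra.ι k)) (a := q)
          (Submodule.mem_map_of_mem b.2) (algebraMap_mem_wordSpan (1 : k))
        have h2 := mul_mem_wordSpan (V := fun i => (g i).map (ExteriorAlgebra.ι k)) (a := p)
          (Submodule.mem_map_of_mem a.2) h1
        rw [map_one, mul_one, add_zero] at h2
        exact h2
    exact this (hΔ n x hx)
  refine wordSpan_induction (V := fun i => (g i).map (ExteriorAlgebra.ι k))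
    (P := fun l n c => 𝓛.diff c ∈ ⨆ (m : ℕ) (_ : m < n), extPart g (l + 1) m) ?_ ?_ ?_ ?_ hc
  · intro l n; simp
  · intro l n x y hx hy; rw [map_add]; exact add_mem hx hy
  · intro c; rw [diff_algebraMap]; exact zero_mem _
  · rintro l a b _ ⟨x, hx, rfl⟩ w hw ih
    rw [diff_mul']
    refine add_mem ?_ ?_
    · have : (⨆ (m : ℕ) (_ : m < a), extPart g 2 m) ≤
          (⨆ (m : ℕ) (_ : m < a + b), extPart g (l + 1 + 1) m).comap (LinearMap.mulRight k w) := by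
        refine iSup₂_le fun m hm c hc => ?_
        have h1 := wordSpan_mul_mem hc hw
        rw [show 2 + l = l + 1 + 1 by ring] at h1
        exact Submodule.mem_iSup_of_mem (m + b) (Submodule.mem_iSup_of_mem (by omega) h1)
      exact this (hwedge a x hx)
    · have : (⨆ (m : ℕ) (_ : m < b), extPart g (l + 1) m) ≤
          (⨆ (m : ℕ) (_ : m < a + b), extPart g (l + 1 + 1) m).comap
            (LinearMap.mulLeft k (parity k L (ExteriorAlgebra.ι k x))) := by
        refine iSup₂_le fun m hm c hc => ?_
        refine Submodule.mem_iSup_of_mem (a + m) (Submodule.mem_iSup_of_mem (by omega) ?_)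
        have h1 : parity k L (ExteriorAlgebra.ι k x) = -ExteriorAlgebra.ι k x := by simp [parity]
        rw [LinearMap.mulLeft_apply, h1, neg_mul, neg_mem_iff]
        exact mul_mem_wordSpan (Submodule.mem_map_of_mem hx) hc
      exact this ih

/-- The bar construction of the Chevalley-Eilenberg algebra of a conilpotent Lie coalgebra has no
cohomology in positive degrees. -/
theorem IsConilpotent.hasTrivialSuspension [CharZero k] {𝓛 : LieCoalgebra k L}
    (h : 𝓛.IsConilpotent) : 𝓛.reducedCE.toAInfinity.HasTrivialSuspension := by
  obtain ⟨g, hg, hΔ⟩ := h.exists_grading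
  refine ⟨fun n hn a ha _ => ?_, fun n hn a ha hm => ?_⟩
  · have h0 : ∀ a ∈ augDeg k L n, a = 0 := by
      intro a ha
      rwa [augDeg, if_neg (by omega), Submodule.mem_bot] at ha
    rw [show a = 0 from h0 a ha]
    exact zero_mem _
  -- Cohomological degree n ≥ 2 is bar degree n - 1 = i + 1 ≥ 1, where the bar construction is
  -- exact.
  · obtain ⟨i, rfl⟩ : ∃ i : ℕ, n = ((i + 1 : ℕ) : ℤ) + 1 := ⟨(n - 2).toNat, by omega⟩
    replace ha : a ∈ augPart k L (i + 1) := by rw [← augDeg_natCast_add_one]; exact ha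
    obtain ⟨N, hN⟩ := exists_weight_lt hg ha
    refine exists_barDiff_eq hg (d := 𝓛.reducedCE.d) ?_ 𝓛.reducedCE.toAInfinity.D_D hN ?_
    · intro i n a ha
      exact mem_iSup_letterPart (𝓛.diff_mem_of_lowers hΔ ha)
    · have := 𝓛.reducedCE.toAInfinity.D_ι a
      rw [hm, map_zero] at this
      exact this

end LieCoalgebra

/-! ### Conilpotency of dual Lie coalgebras -/

section DualConilpotent

variable {k 𝔤 L : Type*} [Field k] [LieRing 𝔤] [LieAlgebra k 𝔤] [AddCommGroup L] [Module k L]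

/-- It suffices that the cobracket lowers the steps of a filtration in both factors. -/
theorem LieCoalgebra.isConilpotent_of_filtration (𝓛 : LieCoalgebra k L) {G : ℕ → Submodule k L}
    (hmono : Monotone G) (hG : ⨆ i, G i = ⊤) (h0 : G 0 = ⊥)
    (hΔ : ∀ m, ∀ x ∈ G (m + 1), 𝓛.cobracket x ∈
      LinearMap.range (TensorProduct.map (G m).subtype (G m).subtype)) : 𝓛.IsConilpotent := by
  have hrange : ∀ {U V U' V' : Submodule k L}, U ≤ U' → V ≤ V' →
      LinearMap.range (TensorProduct.map U.subtype V.subtype) ≤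
        LinearMap.range (TensorProduct.map U'.subtype V'.subtype) := by
    rintro U V U' V' hU hV _ ⟨t, rfl⟩
    refine ⟨TensorProduct.map (Submodule.inclusion hU) (Submodule.inclusion hV) t, ?_⟩
    rw [← LinearMap.comp_apply, ← TensorProduct.map_comp, Submodule.subtype_comp_inclusion,
      Submodule.subtype_comp_inclusion]
  -- Halving i lowers log₂ i by exactly one, so G m ⊗ G m with m = log₂ i lies in F ⌊i/2⌋ ⊗ F ⌈i/2⌉,
  -- whose indices add up to i.
  obtain ⟨F, hF0, hF⟩ : ∃ F : ℕ → Submodule k L, F 0 = ⊥ ∧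
      ∀ i ≠ 0, F i = G (Nat.log 2 i + 1) :=
    ⟨fun i => if i = 0 then ⊥ else G (Nat.log 2 i + 1), if_pos rfl, fun i hi => if_neg hi⟩
  refine ⟨F, ?_, ?_, hF0, ?_⟩
  · intro i j hij
    rcases Nat.eq_zero_or_pos i with rfl | hi
    · rw [hF0]; exact bot_le
    · rw [hF i hi.ne', hF j (hi.trans_le hij).ne']
      exact hmono (Nat.add_le_add_right (Nat.log_mono_right hij) 1)
  · rw [eq_top_iff, ← hG]
    refine iSup_le fun i => le_iSup_of_le (2 ^ i) ?_
    rw [hF _ (pow_ne_zero i two_ne_zero), Nat.log_pow Nat.one_lt_two]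
    exact hmono i.le_succ
  · intro i x hx
    rcases Nat.lt_or_ge i 2 with hi | hi
    · have : 𝓛.cobracket x = 0 := by
        rcases Nat.eq_zero_or_pos i with rfl | hi'
        · rw [hF0, Submodule.mem_bot] at hx
          rw [hx, map_zero]
        -- F 1 = G 1, and the cobracket of G 1 lies in G 0 ⊗ G 0 = 0.
        · obtain rfl : i = 1 := by omega
          rw [hF 1 one_ne_zero, Nat.log_one_right] at hx
          obtain ⟨t, ht⟩ := hΔ 0 x hx
          rw [← ht]
          have : (G 0).subtype = 0 := by
            ext ⟨a, ha⟩
            rw [h0, Submodule.mem_bot] at ha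
            simpa using ha
          rw [this, TensorProduct.map_zero_left, LinearMap.zero_apply]
      rw [this]
      exact zero_mem _
    · refine Submodule.mem_iSup_of_mem (i / 2) (Submodule.mem_iSup_of_mem (i - i / 2)
        (Submodule.mem_iSup_of_mem (by omega) ?_))
      have hlog : Nat.log 2 i = Nat.log 2 (i / 2) + 1 := Nat.log_of_one_lt_of_le one_lt_two hi
      have h1 : G (Nat.log 2 i) ≤ F (i / 2) := by rw [hF _ (by omega), hlog]
      have h2 : G (Nat.log 2 i) ≤ F (i - i / 2) := by
        rw [hF _ (by omega), hlog]
        exact hmono (Nat.add_le_add_right (Nat.log_mono_right (by omega)) 1)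
      rw [hF i (by omega)] at hx
      exact hrange h1 h2 (hΔ _ x hx)

/-- A tensor which is annihilated by `ρ` in both factors is a tensor of elements of its kernel. -/
theorem mem_range_map_ker {M : Type*} [AddCommGroup M] [Module k M] (ρ : L →ₗ[k] M) {t : L ⊗[k] L}
    (h₁ : ρ.lTensor L t = 0) (h₂ : ρ.lTensor L (TensorProduct.comm k L L t) = 0) :
    t ∈ LinearMap.range
      (TensorProduct.map (LinearMap.ker ρ).subtype (LinearMap.ker ρ).subtype) := by
  -- Flatness first moves the right factor into the kernel; after a swap, and since ker ρ ⊗ M embeds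
  -- in L ⊗ M, it does the same for the left factor.
  obtain ⟨s, rfl⟩ := exists_lTensor_ker_subtype ρ h₁
  have hcomm : ∀ s, TensorProduct.comm k L L ((LinearMap.ker ρ).subtype.lTensor L s) =
      (LinearMap.ker ρ).subtype.rTensor L (TensorProduct.comm k L (LinearMap.ker ρ) s) := by
    intro s
    induction s with
    | zero => simp
    | add a b ha hb => simp only [map_add, ha, hb]
    | tmul a b => simp
  have h3 : (LinearMap.ker ρ).subtype.rTensor M
      (ρ.lTensor _ (TensorProduct.comm k L (LinearMap.ker ρ) s)) = 0 := by
    rw [← h₂, hcomm, ← LinearMap.comp_apply, ← LinearMap.comp_apply,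
      LinearMap.rTensor_comp_lTensor, LinearMap.lTensor_comp_rTensor]
  have h4 : ρ.lTensor _ (TensorProduct.comm k L (LinearMap.ker ρ) s) = 0 :=
    Module.Flat.rTensor_preserves_injective_linearMap _ (LinearMap.ker ρ).injective_subtype
      (h3.trans (map_zero _).symm)
  obtain ⟨u, hu⟩ := exists_lTensor_ker_subtype ρ h4
  refine ⟨TensorProduct.comm k _ _ u, (TensorProduct.comm k L L).injective ?_⟩
  rw [hcomm, ← hu, ← LinearMap.comp_apply (LinearMap.rTensor L _),
    LinearMap.rTensor_comp_lTensor]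
  clear hu
  induction u with
  | zero => simp
  | add a b ha hb => simp only [map_add, ha, hb]
  | tmul a b => simp

/-- The functionals in `L` which vanish on a subspace of `𝔤`. -/
def functionalAnnihilator (e : L →ₗ[k] Module.Dual k 𝔤) (K : Submodule k 𝔤) : Submodule k L :=
  LinearMap.ker (LinearMap.lcomp k k K.subtype ∘ₗ e)

theorem mem_functionalAnnihilator {e : L →ₗ[k] Module.Dual k 𝔤} {K : Submodule k 𝔤} {ξ : L} :
    ξ ∈ functionalAnnihilator e K ↔ ∀ x ∈ K, e ξ x = 0 := by
  rw [functionalAnnihilator, LinearMap.mem_ker, LinearMap.ext_iff]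
  simp

theorem evalAt₂_comm (e : L →ₗ[k] Module.Dual k 𝔤) (x y : 𝔤) (t : L ⊗[k] L) :
    evalAt₂ e x y (TensorProduct.comm k L L t) = evalAt₂ e y x t := by
  induction t with
  | zero => simp
  | add a b ha hb => rw [map_add, map_add, map_add, ha, hb]
  | tmul a b => simp only [TensorProduct.comm_tmul, evalAt₂_tmul, mul_comm]

/-- Restricting the second factor to K gives a tensor in L ⊗ K*, and evaluations at points of 𝔤 and
K separate such tensors. -/
theorem lTensor_restrict_eq_zero {e : L →ₗ[k] Module.Dual k 𝔤} (he : Function.Injective e)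
    {K : Submodule k 𝔤} {t : L ⊗[k] L} (h : ∀ x, ∀ y ∈ K, evalAt₂ e x y t = 0) :
    (LinearMap.lcomp k k K.subtype ∘ₗ e).lTensor L t = 0 := by
  refine tensor_separation he (X := K) (fun y => LinearMap.applyₗ y)
    (fun w hw => LinearMap.ext fun y => hw y) fun x y => ?_
  rw [← h x y y.2, evalAt₂, LinearMap.comp_apply, ← LinearMap.comp_apply (TensorProduct.map _ _),
    LinearMap.map_comp_lTensor]
  rfl

/-- A tensor which vanishes if one of the arguments is in `K` is a tensor of functionals vanishing
on `K`. -/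
theorem mem_range_map_functionalAnnihilator {e : L →ₗ[k] Module.Dual k 𝔤}
    (he : Function.Injective e) {K : Submodule k 𝔤} {t : L ⊗[k] L}
    (h₁ : ∀ x, ∀ y ∈ K, evalAt₂ e x y t = 0) (h₂ : ∀ x ∈ K, ∀ y, evalAt₂ e x y t = 0) :
    t ∈ LinearMap.range (TensorProduct.map (functionalAnnihilator e K).subtype
      (functionalAnnihilator e K).subtype) := by
  refine mem_range_map_ker _ (lTensor_restrict_eq_zero he h₁) (lTensor_restrict_eq_zero he ?_)
  intro x y hy
  rw [evalAt₂_comm]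
  exact h₂ y hy x

/-- Filter by the annihilators Gₘ of the terms of the lower central series. If y lies in term m then
[x, y] lies in term m + 1, so for ξ in Gₘ₊₁ the form ξ([x, y]) vanishes when either argument is in
term m. Term 0 is all of 𝔤, whence G₀ = 0; `hnil` makes the filtration exhaustive. -/
theorem LieCoalgebra.ofFunctionals_isConilpotent {e : L →ₗ[k] Module.Dual k 𝔤}
    (he : Function.Injective e)
    (h : ∀ ξ : L, ∃ t : L ⊗[k] L, ∀ x y, evalAt₂ e x y t = e ξ ⁅x, y⁆)
    (hnil : ∀ ξ : L, ∃ m, ∀ x ∈ LieModule.lowerCentralSeries k 𝔤 𝔤 m, e ξ x = 0) :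
    (LieCoalgebra.ofFunctionals e he h).IsConilpotent := by
  have hcob : ∀ ξ x y, evalAt₂ e x y ((LieCoalgebra.ofFunctionals e he h).cobracket ξ) =
    e ξ ⁅x, y⁆ := fun ξ => (h ξ).choose_spec
  refine LieCoalgebra.isConilpotent_of_filtration _
    (G := fun m => functionalAnnihilator e (LieModule.lowerCentralSeries k 𝔤 𝔤 m).toSubmodule)
    ?_ ?_ ?_ ?_
  · intro m n hmn ξ hξ
    rw [mem_functionalAnnihilator] at hξ ⊢
    exact fun x hx => hξ x (LieModule.antitone_lowerCentralSeries k 𝔤 𝔤 hmn hx)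
  · rw [eq_top_iff]
    intro ξ _
    obtain ⟨m, hm⟩ := hnil ξ
    exact Submodule.mem_iSup_of_mem m (mem_functionalAnnihilator.mpr hm)
  · rw [eq_bot_iff]
    intro ξ hξ
    rw [mem_functionalAnnihilator] at hξ
    rw [Submodule.mem_bot]
    refine he (LinearMap.ext fun x => ?_)
    rw [map_zero]
    exact hξ x (by simp)
  · intro m ξ hξ
    rw [mem_functionalAnnihilator] at hξ
    have hlie : ∀ x, ∀ y ∈ LieModule.lowerCentralSeries k 𝔤 𝔤 m,
        e ξ ⁅(x : 𝔤), y⁆ = 0 := by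
      intro x y hy
      refine hξ _ ?_
      rw [LieModule.lowerCentralSeries_succ]
      exact LieSubmodule.lie_mem_lie (LieSubmodule.mem_top x) hy
    refine mem_range_map_functionalAnnihilator he (fun x y hy => ?_) fun x hx y => ?_
    · rw [hcob]; exact hlie x y hy
    · rw [hcob, ← lie_skew, map_neg, hlie y x hx, neg_zero]

theorem LieCoalgebra.dual_isConilpotent (k 𝔤 : Type*) [Field k] [LieRing 𝔤] [LieAlgebra k 𝔤]
    [FiniteDimensional k 𝔤] [LieRing.IsNilpotent 𝔤] : (LieCoalgebra.dual k 𝔤).IsConilpotent := by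
  refine LieCoalgebra.ofFunctionals_isConilpotent _ _ fun ξ => ?_
  obtain ⟨m, hm⟩ := LieModule.IsNilpotent.nilpotent k 𝔤 𝔤
  refine ⟨m, fun x hx => ?_⟩
  rw [hm, LieSubmodule.mem_bot] at hx
  rw [hx, map_zero]

/-- A continuous functional vanishes on some open ideal I with nilpotent quotient, and I contains a
term of the lower central series. -/
theorem LieCoalgebra.continuousDual_isConilpotent {k 𝔤 : Type*} [Field k] [LieRing 𝔤]
    [LieAlgebra k 𝔤] [TopologicalSpace 𝔤] (h : IsProNilpotent k 𝔤) :
    (LieCoalgebra.continuousDual h).IsConilpotent := by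
  refine LieCoalgebra.ofFunctionals_isConilpotent _ _ fun ξ => ?_
  have hξ : IsLocallyConstant (ξ.1 : 𝔤 → k) := ξ.2
  obtain ⟨I, ⟨-, -, hnil⟩, hsub⟩ := h.basis _
    ((hξ.isOpen_fiber (0 : k)).mem_nhds (map_zero ξ.1))
  -- Nilpotency of 𝔤/I as a Lie algebra is turned into nilpotency as a 𝔤-module: both lower central
  -- series are the same subspaces.
  have hI : LieModule.IsNilpotent 𝔤 (𝔤 ⧸ I) := by
    rw [LieRing.IsNilpotent, LieModule.isNilpotent_iff k] at hnil
    rw [LieModule.isNilpotent_iff k]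
    obtain ⟨m, hm⟩ := hnil
    refine ⟨m, ?_⟩
    simp [← LieSubmodule.toSubmodule_inj, coe_lowerCentralSeries_ideal_quot_eq, hm]
  obtain ⟨m, hm⟩ := (LieModule.isNilpotent_quotient_iff k 𝔤 𝔤 I).mp hI
  exact ⟨m, fun x hx => hsub (hm hx)⟩

end DualConilpotent

/-! ### The main theorem -/

theorem LieCoalgebra.IsConilpotent.isOneGenerated_and_isGeneratedInDegreeOne
    {k L : Type*} [Field k] [CharZero k] [AddCommGroup L] [Module k L]
    {𝓛 : LieCoalgebra k L} (h : 𝓛.IsConilpotent) {H : AInfinityAlgebra k} (hH : H.IsMinimal)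
    (hq : AInfinityAlgebra.QuasiIsomorphic H 𝓛.reducedCE.toAInfinity) :
    H.IsOneGenerated ∧ H.IsGeneratedInDegreeOne := by
  have h1 : H.IsOneGenerated :=
    (hq.hasTrivialSuspension_iff.mpr h.hasTrivialSuspension).isOneGenerated hH
  exact ⟨h1, h1.isGeneratedInDegreeOne hH⟩

theorem mainTheorem1 {k : Type u} [Field k] [CharZero k] :
    -- conilpotent Lie coalgebras
    (∀ (L : Type v) [AddCommGroup L] [Module k L] (𝓛 : LieCoalgebra k L), 𝓛.IsConilpotent →
      ∀ H : AInfinityAlgebra.{u, max u v} k, H.IsMinimal →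
        AInfinityAlgebra.QuasiIsomorphic H 𝓛.reducedCE.toAInfinity →
        H.IsOneGenerated ∧ H.IsGeneratedInDegreeOne) ∧
    -- finite-dimensional nilpotent Lie algebras
    (∀ (𝔤 : Type v) [LieRing 𝔤] [LieAlgebra k 𝔤] [FiniteDimensional k 𝔤] [LieRing.IsNilpotent 𝔤],
      ∀ H : AInfinityAlgebra.{u, max u v} k, H.IsMinimal →
        AInfinityAlgebra.QuasiIsomorphic H (LieCoalgebra.dual k 𝔤).reducedCE.toAInfinity →
        H.IsOneGenerated ∧ H.IsGeneratedInDegreeOne) ∧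
    -- pro-nilpotent Lie algebras
    (∀ (𝔤 : Type v) [LieRing 𝔤] [LieAlgebra k 𝔤] [TopologicalSpace 𝔤]
      (h𝔤 : IsProNilpotent k 𝔤),
      ∀ H : AInfinityAlgebra.{u, max u v} k, H.IsMinimal →
        AInfinityAlgebra.QuasiIsomorphic H
          (LieCoalgebra.continuousDual h𝔤).reducedCE.toAInfinity →
        H.IsOneGenerated ∧ H.IsGeneratedInDegreeOne) := by
  refine ⟨fun L _ _ 𝓛 h H hH hq => h.isOneGenerated_and_isGeneratedInDegreeOne hH hq, ?_, ?_⟩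
  · intro 𝔤 _ _ _ _ H hH hq
    exact (LieCoalgebra.dual_isConilpotent k 𝔤).isOneGenerated_and_isGeneratedInDegreeOne hH hq
  · intro 𝔤 _ _ _ h𝔤 H hH hq
    exact (LieCoalgebra.continuousDual_isConilpotent
      h𝔤).isOneGenerated_and_isGeneratedInDegreeOne hH hq
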